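/- Let $d_x,d_y,k\ge 1$ be integers, $\delta>0$, and put $d=d_x+d_y$. Let $f$ be a probability density on $\mathbb R^{d_x}\times\mathbb R^{d_y}$ with marginal densities $f_X(x)=\int f(x,y)\,dy$ and $f_Y(y)=\int f(x,y)\,dx$, and let $(X_1,Y_1),\dots,(X_N,Y_N)$ be i.i.d. with density $f$. Write $Z_i=(X_i,Y_i)\in\mathbb R^{d}$. **Estimators.** For $p\in\{2,\infty\}$ let $\rho_{k,i,p}$ be the $\ell_p$ distance from $Z_i$ to its $k$-th nearest neighbour among the other samples, $n_{x,i,p}=\#\{j\ne i:\|X_j-X_i\|_p\le\rho_{k,i,p}\}$ and $n_{y,i,p}=\#\{j\ne i:\|Y_j-Y_i\|_p\le\rho_{k,i,p}\}$. Let $\psi=\Gamma'/\Gamma$ be the digamma function, $c_{m,2}=\pi^{m/2}/\Gamma(m/2+1)$, and $a_N=\big((\log N)^{1+\delta}/N\big)^{1/d}$. Put $$\iota_{k,i,\infty}=\psi(k)+\log N-\psi(n_{x,i,\infty}+1)-\psi(n_{y,i,\infty}+1)\ \text{ if }\rho_{k,i,\infty}\le a_N,\qquad \iota_{k,i,\infty}=0\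 \text{ otherwise},$$ $$\iota_{k,i,2}=\psi(k)+\log N+\log\frac{c_{d_x,2}\,c_{d_y,2}}{c_{d,2}}-\log n_{x,i,2}-\log n_{y,i,2}\ \text{ if }\rho_{k,i,2}\le a_N,\qquad \iota_{k,i,2}=0\ \text{ otherwise}.$$ The truncated KSG and truncated BI-KSG estimators are $\widehat I_{\rm tKSG}=\frac1N\sum_{i=1}^N\iota_{k,i,\infty}$ and $\widehat I_{\rm tBI\text{-}KSG}=\frac1N\sum_{i=1}^N\iota_{k,i,2}$. The estimated quantity is the mutual information $I(X;Y)=H(X)+H(Y)-H(X,Y)$, where $H=-\int g\log g$ is the differential entropy of a density $g$. **Assumption.** There are finite constants $C_a,\dots,C_h$ and $C_0>0$ such that: (a) $f\le C_a$ almost everywhere; (b) for some $\gamma>0$, $\int f\,|\log f|^{1+\gamma}\le C_b$; (c) $\int f e^{-bf}\le C_c e^{-C_0 b}$ for all $b>1$; (d) at almost every point, $f$ is twice continuously differentiable with Hessian of spectral norm $<C_d$; (e) the conditional densities satisfy $f_{Y|X}<C_e$ and $f_{X|Y}<C_e$ almost everywhere; (f) $f_X<C_f$ and $f_Y<C_f$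 almost everywhere; (g) the set of points of $\mathbb R^{d}$ at which the condition in (d) fails has $(d-1)$-dimensional Hausdorff measure at most $C_g$; (h) the set of points of $\mathbb R^{d_x}$ at which it fails to hold that $f_X$ is twice continuously differentiable with Hessian of spectral norm $<C_d$ has $(d_x-1)$-dimensional Hausdorff measure at most $C_h$, and likewise for $f_Y$ on $\mathbb R^{d_y}$ with $(d_y-1)$-dimensional Hausdorff measure. **Conclusion.** As $N\to\infty$, both $\mathbb E\big[(\widehat I_{\rm tKSG}-I(X;Y))^2\big]$ and $\mathbb E\big[(\widehat I_{\rm tBI\text{-}KSG}-I(X;Y))^2\big]$ are finite for large $N$ and are $$O\!\left(\frac{(\log N)^{2(1+\delta)(1+\frac1{d})}}{N^{2/d}}+\frac{(\log\log N)^2(\log N)^{(2k+2)(1+\delta)}}{N}\right),$$ where the implied constant, and the $N$ from which the bound holds, depend only on $d_x,d_y,k,\delta$ and the constants $C_a,\dots,C_h,C_0$. -/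

import Mathlib

open MeasureTheory ProbabilityTheory
open scoped ENNReal NNReal

noncomputable section

namespace KSG

/-- The digamma function `ψ(x) = Γ'(x) / Γ(x)`. -/
def digamma (x : ℝ) : ℝ := logDeriv Real.Gamma x

/-- The volume `c_{d,2} = π^{d/2} / Γ(d/2 + 1)` of the unit `ℓ_2` ball of `ℝ^d`. -/
def unitBallVol (d : ℕ) : ℝ := Real.pi ^ ((d : ℝ) / 2) / Real.Gamma ((d : ℝ) / 2 + 1)

/-- The `ℓ_p` distance of two real vectors (used for `p = 2` and `p = ∞`). -/
def lpDist {ι : Type*} [Fintype ι] (p : ℝ≥0∞) (v w : ι → ℝ) : ℝ :=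
  ‖(WithLp.toLp p (v - w) : PiLp p (fun _ : ι => ℝ))‖

/-- The vector `(x, y) ∈ ℝ^{d_x + d_y}`; the coordinates are indexed by `Fin dx ⊕ Fin dy`. -/
def joint {dx dy : ℕ} (z : (Fin dx → ℝ) × (Fin dy → ℝ)) : Fin dx ⊕ Fin dy → ℝ :=
  Sum.elim z.1 z.2

/-! ### The estimators -/

section Estimators

variable {dx dy N : ℕ}

/-- `ρ_{k,i,p}`: the distance from the `i`-th sample to its `k`-th nearest neighbour among the
other samples, that is, the least `r ≥ 0` such that at least `k` other samples lie within
`ℓ_p` distance `r` of it. -/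
def knnDist (p : ℝ≥0∞) (k : ℕ) (z : Fin N → (Fin dx → ℝ) × (Fin dy → ℝ)) (i : Fin N) : ℝ :=
  sInf {r : ℝ | 0 ≤ r ∧ k ≤ Nat.card {j : Fin N // j ≠ i ∧ lpDist p (joint (z j)) (joint (z i)) ≤ r}}

/-- `n_{x,i,p}`: the number of other samples whose `X`-part is within `ρ_{k,i,p}` of `X_i`. -/
def nX (p : ℝ≥0∞) (k : ℕ) (z : Fin N → (Fin dx → ℝ) × (Fin dy → ℝ)) (i : Fin N) : ℕ :=
  Nat.card {j : Fin N // j ≠ i ∧ lpDist p (z j).1 (z i).1 ≤ knnDist p k z i}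

/-- `n_{y,i,p}`: the number of other samples whose `Y`-part is within `ρ_{k,i,p}` of `Y_i`. -/
def nY (p : ℝ≥0∞) (k : ℕ) (z : Fin N → (Fin dx → ℝ) × (Fin dy → ℝ)) (i : Fin N) : ℕ :=
  Nat.card {j : Fin N // j ≠ i ∧ lpDist p (z j).2 (z i).2 ≤ knnDist p k z i}

/-- The truncation threshold `a_N = ((log N)^{1+δ} / N)^{1/(d_x+d_y)}`. -/
def threshold (dx dy : ℕ) (δ : ℝ) (N : ℕ) : ℝ :=
  (Real.log N ^ (1 + δ) / N) ^ (1 / ((dx : ℝ) + dy))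

open Classical in
/-- The local estimate `ι_{k,i,∞}`. -/
def iotaKSG (k : ℕ) (δ : ℝ) (z : Fin N → (Fin dx → ℝ) × (Fin dy → ℝ)) (i : Fin N) : ℝ :=
  if knnDist ∞ k z i ≤ threshold dx dy δ N then
    digamma k + Real.log N - digamma ((nX ∞ k z i : ℝ) + 1) - digamma ((nY ∞ k z i : ℝ) + 1)
  else 0

open Classical in
/-- The local estimate `ι_{k,i,2}`. -/
def iotaBIKSG (k : ℕ) (δ : ℝ) (z : Fin N → (Fin dx → ℝ) × (Fin dy → ℝ)) (i : Fin N) : ℝ :=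
  if knnDist 2 k z i ≤ threshold dx dy δ N then
    digamma k + Real.log N
      + Real.log (unitBallVol dx * unitBallVol dy / unitBallVol (dx + dy))
      - Real.log (nX 2 k z i) - Real.log (nY 2 k z i)
  else 0

/-- The truncated KSG estimator of mutual information. -/
def tKSG (k : ℕ) (δ : ℝ) (z : Fin N → (Fin dx → ℝ) × (Fin dy → ℝ)) : ℝ :=
  (1 / (N : ℝ)) * ∑ i, iotaKSG k δ z i

/-- The truncated bias-improved KSG estimator of mutual information. -/
def tBIKSG (k : ℕ) (δ : ℝ) (z : Fin N → (Fin dx → ℝ) × (Fin dy → ℝ)) : ℝ :=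
  (1 / (N : ℝ)) * ∑ i, iotaBIKSG k δ z i

end Estimators

/-! ### Densities, entropies and mutual information -/

section Densities

variable {dx dy : ℕ}

/-- The marginal density `f_X(x) = ∫ f(x, y) dy`. -/
def margX (f : (Fin dx → ℝ) × (Fin dy → ℝ) → ℝ) (x : Fin dx → ℝ) : ℝ := ∫ y, f (x, y)

/-- The marginal density `f_Y(y) = ∫ f(x, y) dx`. -/
def margY (f : (Fin dx → ℝ) × (Fin dy → ℝ) → ℝ) (y : Fin dy → ℝ) : ℝ := ∫ x, f (x, y)

/-- The differential entropy `-∫ g log g` of a density `g` (with `0 log 0 = 0`). -/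
def diffEntropy {α : Type*} [MeasureSpace α] (g : α → ℝ) : ℝ := -∫ a, g a * Real.log (g a)

/-- The mutual information `I(X;Y) = H(X) + H(Y) - H(X,Y)` of a pair with joint density `f`. -/
def mutualInfo (f : (Fin dx → ℝ) × (Fin dy → ℝ) → ℝ) : ℝ :=
  diffEntropy (margX f) + diffEntropy (margY f) - diffEntropy f

/-- `f` as a function on the Euclidean space `ℝ^{d_x + d_y}`. -/
def onJoint (f : (Fin dx → ℝ) × (Fin dy → ℝ) → ℝ) (v : EuclideanSpace ℝ (Fin dx ⊕ Fin dy)) : ℝ :=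
  f (fun i => v (Sum.inl i), fun j => v (Sum.inr j))

/-- `g` as a function on the Euclidean space `ℝ^d`. -/
def onEuclidean {d : ℕ} (g : (Fin d → ℝ) → ℝ) (v : EuclideanSpace ℝ (Fin d)) : ℝ :=
  g (WithLp.ofLp v)

/-- At the point `v`, the function `g` is twice continuously differentiable and its Hessian has
spectral norm `< C`. (The norm of the second derivative as a bilinear form on a Euclidean space
is the spectral norm of the Hessian matrix.) -/
def HessianBoundAt {ι : Type*} [Fintype ι] (g : EuclideanSpace ℝ ι → ℝ) (C : ℝ)
    (v : EuclideanSpace ℝ ι) : Prop :=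
  ContDiffAt ℝ 2 g v ∧ ‖fderiv ℝ (fderiv ℝ g) v‖ < C

/-- `f` is a probability density on `ℝ^{d_x} × ℝ^{d_y}`. -/
structure IsDensity (f : (Fin dx → ℝ) × (Fin dy → ℝ) → ℝ) : Prop where
  measurable : Measurable f
  nonneg : ∀ z, 0 ≤ f z
  lintegral_eq_one : ∫⁻ z, ENNReal.ofReal (f z) = 1

/-- The regularity conditions on the joint density `f`, with their constants. -/
structure RateAssumption (f : (Fin dx → ℝ) × (Fin dy → ℝ) → ℝ)
    (Ca Cb Cc Cd Ce Cf Cg Ch C0 : ℝ) : Prop where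
  C0_pos : 0 < C0
  /-- (a) -/
  bounded : ∀ᵐ z, f z ≤ Ca
  /-- (b) -/
  logMoment : ∃ γ : ℝ, 0 < γ ∧ Integrable (fun z => f z * |Real.log (f z)| ^ (1 + γ)) ∧
    ∫ z, f z * |Real.log (f z)| ^ (1 + γ) ≤ Cb
  /-- (c) -/
  tail : ∀ b : ℝ, 1 < b → ∫ z, f z * Real.exp (-b * f z) ≤ Cc * Real.exp (-C0 * b)
  /-- (d) -/
  smooth : ∀ᵐ v, HessianBoundAt (onJoint f) Cd v
  /-- (e) -/
  condY : ∀ᵐ z : (Fin dx → ℝ) × (Fin dy → ℝ), 0 < margX f z.1 → f z / margX f z.1 < Ce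
  condX : ∀ᵐ z : (Fin dx → ℝ) × (Fin dy → ℝ), 0 < margY f z.2 → f z / margY f z.2 < Ce
  /-- (f) -/
  boundedX : ∀ᵐ x, margX f x < Cf
  boundedY : ∀ᵐ y, margY f y < Cf
  /-- (g) -/
  boundary : Measure.hausdorffMeasure ((dx : ℝ) + dy - 1)
    {v | ¬ HessianBoundAt (onJoint f) Cd v} ≤ ENNReal.ofReal Cg
  /-- (h) -/
  boundaryX : Measure.hausdorffMeasure ((dx : ℝ) - 1)
    {v | ¬ HessianBoundAt (onEuclidean (margX f)) Cd v} ≤ ENNReal.ofReal Ch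
  boundaryY : Measure.hausdorffMeasure ((dy : ℝ) - 1)
    {v | ¬ HessianBoundAt (onEuclidean (margY f)) Cd v} ≤ ENNReal.ofReal Ch

end Densities

/-- The rate
`(log N)^{2(1+δ)(1+1/(dx+dy))} / N^{2/(dx+dy)} + (log log N)^2 (log N)^{(2k+2)(1+δ)} / N`. -/
def rate (dx dy k : ℕ) (δ : ℝ) (N : ℕ) : ℝ :=
  Real.log N ^ (2 * (1 + δ) * (1 + 1 / ((dx : ℝ) + dy))) / (N : ℝ) ^ (2 / ((dx : ℝ) + dy))
    + Real.log (Real.log N) ^ 2 * Real.log N ^ ((2 * (k : ℝ) + 2) * (1 + δ)) / N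

end KSG

end

/-! The mean squared error is at most the squared bias plus a variance bound, and the two are
estimated by unrelated arguments.

The variance needs no regularity of `f`. Moving one sample changes the nearest neighbour distance of
only O(k) other points, since each cone of directions at that sample holds at most `k` of them
(`card_ball_lt_le`). For all other points the distance stays and the counts `n_x`, `n_y` move by at
most one, which changes their logarithms by the order of the reciprocal of a count; within a cone
these reciprocals are dominated by those of the ranks, so they sum to a harmonic number
(`sum_inv_card_le`). Thus the estimator has bounded differences O(log N / N), and
`integral_sq_le_of_bounded_differences` gives a variance O((log N)² / N), below the second term of
the rate.

For the bias, condition (c), imposed for all `b`, forces `f = 0` or `f ≥ C0` almost everywhere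
(`ae_eq_zero_or_ge_of_tail`); by (e) the marginals are then bounded below at almost every sample
point. Condition (g) makes translation Lipschitz in `L¹` (`lintegral_abs_translate_sub_le`): the
points from which the segment `h` meets the bad set have volume O(‖h‖), and elsewhere second
differences are O(‖h‖²). The marginals inherit this. Consequently, outside an exceptional set of
probability O(a_N), balls of every radius `r ≤ a_N` have mass at least a constant times the power of
`r`, and ball averages differ from the densities by O(r) in mean.

Fix a non-exceptional sample point. The logarithm of the mass of its nearest neighbour ball has mean
exactly H_{k-1} - H_{N-1} (`integral_log_distr_kthSmallest`). Leave-one-out arguments, which never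
use a conditional law of the counts, show that `φ(n_x)` and `φ(n_y)` estimate the logarithm of `N`
times a marginal ball mass up to O(a_N) in mean (`abs_integral_neighbours_sub_log_le`). When masses
are replaced by density times volume, the powers of the radius cancel because the dimensions add,
and `infoDensity f` remains. The error of this replacement is summed over all samples in a ball of
radius `a_N`, of which there are O((log N)^(1+δ)) on average. The bias is therefore O(a_N (log
N)^(1+δ)), whose square is the first term of the rate; exceptional points contribute only their
probability times a logarithm. -/

noncomputable section

namespace KSG

/-! ### Order statistics -/

section OrderStatistics

variable {ι : Type*} [Fintype ι]

/-- The number of indices at which `τ` is at most `r`. -/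
def countLE (τ : ι → ℝ) (r : ℝ) : ℕ := Nat.card {j : ι // τ j ≤ r}

/-- The `k`-th smallest value of a nonnegative function. -/
def kthSmallest (k : ℕ) (τ : ι → ℝ) : ℝ := sInf {r : ℝ | 0 ≤ r ∧ k ≤ countLE τ r}

open Classical in
lemma countLE_eq_card_filter (τ : ι → ℝ) (r : ℝ) :
    countLE τ r = (Finset.univ.filter fun j => τ j ≤ r).card := by
  rw [countLE, Nat.card_eq_fintype_card, Fintype.card_subtype]

open Classical in
lemma countLE_eq_sum (τ : ι → ℝ) (r : ℝ) :
    countLE τ r = ∑ j, if τ j ≤ r then 1 else 0 := by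
  rw [countLE_eq_card_filter, Finset.card_filter]

lemma countLE_le_card (τ : ι → ℝ) (r : ℝ) : countLE τ r ≤ Fintype.card ι := by
  classical
  rw [countLE_eq_card_filter]; exact Finset.card_le_univ _

lemma countLE_mono (τ : ι → ℝ) : Monotone (countLE τ) := by
  classical
  intro r s h
  simp only [countLE_eq_card_filter]
  exact Finset.card_le_card fun j hj => by
    simp only [Finset.mem_filter, Finset.mem_univ, true_and] at hj ⊢; exact hj.trans h

lemma countLE_anti {τ σ : ι → ℝ} (h : ∀ j, σ j ≤ τ j) (r : ℝ) : countLE τ r ≤ countLE σ r := by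
  classical
  simp only [countLE_eq_card_filter]
  exact Finset.card_le_card fun j hj => by
    simp only [Finset.mem_filter, Finset.mem_univ, true_and] at hj ⊢; exact (h j).trans hj

omit [Fintype ι] in
lemma kthSmallest_nonneg (k : ℕ) (τ : ι → ℝ) : 0 ≤ kthSmallest k τ :=
  Real.sInf_nonneg fun _ h => h.1

omit [Fintype ι] in
lemma kthSmallest_le_of_le {k : ℕ} {τ : ι → ℝ} {r : ℝ} (hr : 0 ≤ r) (h : k ≤ countLE τ r) :
    kthSmallest k τ ≤ r :=
  csInf_le ⟨0, fun _ h => h.1⟩ ⟨hr, h⟩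

/-- The infimum is attained: a finite family has no value in `(R, r]` for some `r > R`, so the count
is constant just to the right of `R`. -/
lemma le_countLE_kthSmallest {k : ℕ} (τ : ι → ℝ) (hk : k ≤ Fintype.card ι) :
    k ≤ countLE τ (kthSmallest k τ) := by
  classical
  set R := kthSmallest k τ with hR
  have hne : {r : ℝ | 0 ≤ r ∧ k ≤ countLE τ r}.Nonempty := by
    refine ⟨∑ j, |τ j|, Finset.sum_nonneg fun _ _ => abs_nonneg _, ?_⟩
    rw [countLE_eq_card_filter, Finset.filter_true_of_mem]
    · simpa using hk
    · intro j _
      exact (le_abs_self _).trans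
        (Finset.single_le_sum (f := fun j => |τ j|) (fun _ _ => abs_nonneg _) (Finset.mem_univ j))
  have hgt : ∃ r, R < r ∧ ∀ j, τ j ≤ r → τ j ≤ R := by
    have : ∀ᶠ r in nhdsWithin R (Set.Ioi R), ∀ j, τ j ≤ r → τ j ≤ R := by
      rw [Filter.eventually_all]
      intro j
      by_cases h : τ j ≤ R
      · exact Filter.Eventually.of_forall fun _ _ => h
      · filter_upwards [Ioo_mem_nhdsGT (not_le.1 h)] with r hr h'
        exact absurd h' (not_le.2 hr.2)
    obtain ⟨r, hr, hr'⟩ := (this.and self_mem_nhdsWithin).exists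
    exact ⟨r, hr', hr⟩
  obtain ⟨r, hr, hr'⟩ := hgt
  obtain ⟨s, hs, hsr⟩ := exists_lt_of_csInf_lt hne (show sInf _ < r from hr)
  refine hs.2.trans ((countLE_mono τ hsr.le).trans ?_)
  simp only [countLE_eq_card_filter]
  exact Finset.card_le_card fun j hj => by
    simp only [Finset.mem_filter, Finset.mem_univ, true_and] at hj ⊢; exact hr' j hj

lemma kthSmallest_le_iff {k : ℕ} {τ : ι → ℝ} (hk : k ≤ Fintype.card ι) {r : ℝ} (hr : 0 ≤ r) :
    kthSmallest k τ ≤ r ↔ k ≤ countLE τ r :=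
  ⟨fun h => (le_countLE_kthSmallest τ hk).trans (countLE_mono τ h), kthSmallest_le_of_le hr⟩

/-- The largest value not exceeding the order statistic must equal it. Both `1 ≤ k` and
nonnegativity matter: thresholds start at `0`, so otherwise the infimum could be `0` without `0`
being a value. -/
lemma exists_eq_kthSmallest {k : ℕ} {τ : ι → ℝ} (hk1 : 1 ≤ k) (hk : k ≤ Fintype.card ι)
    (hτ : ∀ j, 0 ≤ τ j) : ∃ j, τ j = kthSmallest k τ := by
  classical
  have h := le_countLE_kthSmallest τ hk
  set R := kthSmallest k τ with hR
  have hne : (Finset.univ.filter fun j => τ j ≤ R).Nonempty := by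
    rw [← Finset.card_pos, ← countLE_eq_card_filter]; omega
  obtain ⟨j, hj, hmax⟩ := Finset.exists_max_image _ τ hne
  simp only [Finset.mem_filter, Finset.mem_univ, true_and] at hj hmax
  refine ⟨j, le_antisymm hj (kthSmallest_le_of_le (hτ j) (h.trans ?_))⟩
  simp only [countLE_eq_card_filter]
  exact Finset.card_le_card fun i hi => by
    simp only [Finset.mem_filter, Finset.mem_univ, true_and] at hi ⊢; exact hmax i hi

open Classical in
lemma countLE_succAbove {n : ℕ} (τ : Fin (n + 1) → ℝ) (l : Fin (n + 1)) (r : ℝ) :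
    countLE τ r = (if τ l ≤ r then 1 else 0) + countLE (fun j => τ (l.succAbove j)) r := by
  simp only [countLE_eq_sum]
  exact Fin.sum_univ_succAbove _ l

lemma countLE_succAbove_le {n : ℕ} (τ : Fin (n + 1) → ℝ) (l : Fin (n + 1)) (r : ℝ) :
    countLE (fun j => τ (l.succAbove j)) r ≤ countLE τ r := by
  classical
  rw [countLE_succAbove τ l r]; omega

lemma kthSmallest_le_succAbove {n k : ℕ} (hk : k ≤ n) (τ : Fin (n + 1) → ℝ) (l : Fin (n + 1)) :
    kthSmallest k τ ≤ kthSmallest k (fun j => τ (l.succAbove j)) :=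
  kthSmallest_le_of_le (kthSmallest_nonneg _ _)
    ((le_countLE_kthSmallest _ (by simpa using hk)).trans (countLE_succAbove_le τ l _))

/-- The mechanism of all leave-one-out arguments below: deleting a point lying strictly beyond the
`k`-th smallest value does not move that value, which is thereby a function of the other,
independent points. -/
lemma kthSmallest_succAbove_of_lt {n k : ℕ} (hk : k ≤ n) (τ : Fin (n + 1) → ℝ) (l : Fin (n + 1))
    (h : kthSmallest k τ < τ l) :
    kthSmallest k (fun j => τ (l.succAbove j)) = kthSmallest k τ := by
  classical
  refine le_antisymm (kthSmallest_le_of_le (kthSmallest_nonneg _ _) ?_)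
    (kthSmallest_le_succAbove hk τ l)
  have := le_countLE_kthSmallest (k := k) τ (by simp; omega)
  rwa [countLE_succAbove τ l, if_neg (not_le.2 h), zero_add] at this

lemma kthSmallest_succAbove_of_lt' {n k : ℕ} (hk : k ≤ n) (τ : Fin (n + 1) → ℝ) (l : Fin (n + 1))
    (h : kthSmallest k (fun j => τ (l.succAbove j)) < τ l) :
    kthSmallest k (fun j => τ (l.succAbove j)) = kthSmallest k τ :=
  kthSmallest_succAbove_of_lt hk τ l ((kthSmallest_le_succAbove hk τ l).trans_lt h)

lemma measurable_countLE {α : Type*} [MeasurableSpace α] {τ : α → ι → ℝ} {r : α → ℝ}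
    (hτ : ∀ j, Measurable fun a => τ a j) (hr : Measurable r) :
    Measurable fun a => countLE (τ a) (r a) := by
  classical
  simp only [countLE_eq_sum]
  exact Finset.measurable_sum _ fun j _ =>
    Measurable.ite (measurableSet_le (hτ j) hr) measurable_const measurable_const

lemma measurable_kthSmallest {α : Type*} [MeasurableSpace α] {k : ℕ} (hk : k ≤ Fintype.card ι)
    {τ : α → ι → ℝ} (hτ : ∀ j, Measurable fun a => τ a j) :
    Measurable fun a => kthSmallest k (τ a) := by
  refine measurable_of_Iic fun r => ?_
  by_cases hr : 0 ≤ r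
  · have : (fun a => kthSmallest k (τ a)) ⁻¹' Set.Iic r = {a | k ≤ countLE (τ a) r} := by
      ext a; simp [kthSmallest_le_iff hk hr]
    rw [this]
    exact measurableSet_le measurable_const (measurable_countLE hτ measurable_const)
  · convert MeasurableSet.empty
    ext a
    simp only [Set.mem_preimage, Set.mem_Iic, Set.mem_empty_iff_false, iff_false, not_le]
    exact (not_le.1 hr).trans_le (kthSmallest_nonneg _ _)

end OrderStatistics

/-! ### The digamma function at positive integers -/

lemma digamma_natCast_add_one (n : ℕ) :
    digamma ((n : ℝ) + 1) = harmonic n - Real.eulerMascheroniConstant := by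
  rw [digamma, logDeriv_apply, Real.deriv_Gamma_nat, Real.Gamma_nat_eq_factorial]
  have : (n.factorial : ℝ) ≠ 0 := by positivity
  field_simp
  ring

lemma harmonic_le_log_add_one (n : ℕ) :
    (harmonic n : ℝ) - Real.eulerMascheroniConstant ≤ Real.log (n + 1) := by
  have := Real.eulerMascheroniSeq_lt_eulerMascheroniConstant n
  rw [Real.eulerMascheroniSeq] at this
  linarith

lemma log_le_harmonic_sub {n : ℕ} (hn : 1 ≤ n) :
    Real.log n ≤ (harmonic n : ℝ) - Real.eulerMascheroniConstant := by
  have := Real.eulerMascheroniConstant_lt_eulerMascheroniSeq' n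
  rw [Real.eulerMascheroniSeq', if_neg (by omega)] at this
  linarith

/-- The properties of `n ↦ ψ(n + 1)` and `n ↦ log n` that the error analysis relies on. -/
structure LogLike (φ : ℕ → ℝ) : Prop where
  log_le : ∀ n : ℕ, 1 ≤ n → Real.log n ≤ φ n
  le_log : ∀ n : ℕ, 1 ≤ n → φ n ≤ Real.log (n + 1)
  abs_zero : |φ 0| ≤ 1
  abs_succ_sub : ∀ n : ℕ, |φ (n + 1) - φ n| ≤ 2 / (n + 1)

/-- Since ψ(n+1) = H_n - γ, the sandwich says that H_n - log(n+1) stays below γ and H_n - log n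
above it; the value at `0` is -γ and increments are 1/(n+1). -/
lemma logLike_digamma : LogLike fun n => digamma ((n : ℝ) + 1) where
  log_le n hn := by rw [digamma_natCast_add_one]; exact log_le_harmonic_sub hn
  le_log n _ := by rw [digamma_natCast_add_one]; exact harmonic_le_log_add_one n
  abs_zero := by
    rw [digamma_natCast_add_one]
    have h1 := Real.one_half_lt_eulerMascheroniConstant
    have h2 := Real.eulerMascheroniConstant_lt_two_thirds
    simp only [harmonic_zero, Rat.cast_zero, zero_sub, abs_neg]
    rw [abs_of_pos (by linarith)]; linarith
  abs_succ_sub n := by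
    simp only [digamma_natCast_add_one]
    rw [harmonic_succ]
    push_cast
    have h : (0 : ℝ) < n + 1 := by positivity
    rw [show (harmonic n : ℝ) + ((n : ℝ) + 1)⁻¹ - Real.eulerMascheroniConstant -
      (harmonic n - Real.eulerMascheroniConstant) = ((n : ℝ) + 1)⁻¹ by ring,
      abs_of_pos (by positivity), ← one_div]
    gcongr; norm_num

lemma logLike_log : LogLike fun n => Real.log n where
  log_le n _ := le_rfl
  le_log n hn := Real.log_le_log (by exact_mod_cast hn) (by linarith)
  -- An empty count contributes `Real.log 0 = 0`.
  abs_zero := by simp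
  abs_succ_sub n := by
    rcases Nat.eq_zero_or_pos n with rfl | hn
    · simp
    have hn' : (1 : ℝ) ≤ n := by exact_mod_cast hn
    push_cast
    rw [← Real.log_div (by positivity) (by positivity), abs_of_nonneg]
    · refine (Real.log_le_sub_one_of_pos (by positivity)).trans ?_
      -- The factor `2` in `abs_succ_sub` is needed only here, where the increment is bounded by 1/n
      -- ≤ 2/(n+1).
      rw [show ((n : ℝ) + 1) / n - 1 = 1 / n by field_simp; ring, div_le_div_iff₀] <;> linarith
    · apply Real.log_nonneg; rw [le_div_iff₀] <;> linarith

lemma LogLike.abs_le {φ : ℕ → ℝ} (h : LogLike φ) {n N : ℕ} (hn : n + 1 ≤ N) :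
    |φ n| ≤ 1 + Real.log N := by
  have hN : 0 ≤ Real.log N := Real.log_natCast_nonneg N
  rcases Nat.eq_zero_or_pos n with rfl | hn0
  · linarith [h.abs_zero]
  · have h1 : 0 ≤ Real.log n := Real.log_natCast_nonneg n
    have h2 : Real.log ((n : ℝ) + 1) ≤ Real.log N :=
      Real.log_le_log (by positivity) (by exact_mod_cast hn)
    rw [abs_of_nonneg (h1.trans (h.log_le n hn0))]
    linarith [h.le_log n hn0]

/-! ### Splitting off one coordinate of a product measure -/

section ProductMeasure

variable {E : Type*} [MeasurableSpace E] (μ : Measure E) [IsProbabilityMeasure μ] {n : ℕ}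

lemma measurePreserving_insertNth (i : Fin (n + 1)) :
    MeasurePreserving (fun q : E × (Fin n → E) => (i.insertNth q.1 q.2 : Fin (n + 1) → E))
      (μ.prod (Measure.pi fun _ => μ)) (Measure.pi fun _ => μ) := by
  have := (measurePreserving_piFinSuccAbove (fun _ : Fin (n + 1) => μ) i).symm
  exact this

lemma measurable_insertNth (i : Fin (n + 1)) :
    Measurable (fun q : E × (Fin n → E) => (i.insertNth q.1 q.2 : Fin (n + 1) → E)) :=
  (MeasurableEquiv.piFinSuccAbove (fun _ : Fin (n + 1) => E) i).symm.measurable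

lemma measurableEmbedding_insertNth (i : Fin (n + 1)) :
    MeasurableEmbedding (fun q : E × (Fin n → E) => (i.insertNth q.1 q.2 : Fin (n + 1) → E)) :=
  (MeasurableEquiv.piFinSuccAbove (fun _ : Fin (n + 1) => E) i).symm.measurableEmbedding

lemma integral_pi_insertNth (i : Fin (n + 1)) (g : (Fin (n + 1) → E) → ℝ) :
    ∫ z, g z ∂(Measure.pi fun _ => μ) =
      ∫ q : E × (Fin n → E), g (i.insertNth q.1 q.2) ∂(μ.prod (Measure.pi fun _ => μ)) :=
  ((measurePreserving_insertNth μ i).integral_comp (measurableEmbedding_insertNth i) g).symm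

lemma lintegral_pi_insertNth (i : Fin (n + 1)) (g : (Fin (n + 1) → E) → ℝ≥0∞) (hg : Measurable g) :
    ∫⁻ z, g z ∂(Measure.pi fun _ => μ) =
      ∫⁻ y, ∫⁻ a, g (i.insertNth a y) ∂μ ∂(Measure.pi fun _ : Fin n => μ) := by
  rw [← (measurePreserving_insertNth μ i).lintegral_comp hg]
  exact lintegral_prod_symm _ (hg.comp (measurable_insertNth i)).aemeasurable

end ProductMeasure

/-! ### Functions with bounded differences -/

section BoundedDifferences

variable {E : Type*} [MeasurableSpace E] (μ : Measure E) [IsProbabilityMeasure μ]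

lemma integrable_of_abs_le {α : Type*} [MeasurableSpace α] {ν : Measure α} [IsFiniteMeasure ν]
    {g : α → ℝ} (hg : Measurable g) {B : ℝ} (hB : ∀ a, |g a| ≤ B) : Integrable g ν :=
  Integrable.of_bound hg.aestronglyMeasurable B (Filter.Eventually.of_forall hB)

/-- A function with oscillation at most `c` stays within `c` of its mean, so its variance is at most
`c²`. -/
lemma integral_sq_le_of_abs_sub_le {α : Type*} [MeasurableSpace α] (ν : Measure α)
    [IsProbabilityMeasure ν] {G : α → ℝ} (hG : Measurable G) {B c : ℝ} (hB : ∀ a, |G a| ≤ B)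
    (hc : ∀ a b, |G a - G b| ≤ c) : ∫ a, G a ^ 2 ∂ν ≤ (∫ a, G a ∂ν) ^ 2 + c ^ 2 := by
  have hGi : Integrable G ν := integrable_of_abs_le hG hB
  have hG2 : Integrable (fun a => G a ^ 2) ν :=
    integrable_of_abs_le (hG.pow_const 2) (B := B ^ 2) fun a => by
      rw [abs_pow]; exact pow_le_pow_left₀ (abs_nonneg _) (hB a) 2
  set m := ∫ a, G a ∂ν with hm
  have hdev : ∀ a, |G a - m| ≤ c := by
    intro a
    have : G a - m = ∫ b, (G a - G b) ∂ν := by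
      rw [integral_sub (integrable_const _) hGi]; simp [hm]
    rw [this]
    have := norm_integral_le_of_norm_le_const (μ := ν) (f := fun b => G a - G b) (C := c)
      (Filter.Eventually.of_forall fun b => hc a b)
    simpa using this
  have h1 : ∫ a, (G a - m) ^ 2 ∂ν ≤ c ^ 2 := by
    have hi : Integrable (fun a => (G a - m) ^ 2) ν :=
      integrable_of_abs_le ((hG.sub_const m).pow_const 2) (B := c ^ 2) fun a => by
        rw [abs_pow]; exact pow_le_pow_left₀ (abs_nonneg _) (hdev a) 2
    calc ∫ a, (G a - m) ^ 2 ∂ν ≤ ∫ _, c ^ 2 ∂ν := by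
          refine integral_mono hi (integrable_const _) fun a => ?_
          exact sq_le_sq' (by linarith [abs_le.1 (hdev a)]) (abs_le.1 (hdev a)).2
      _ = c ^ 2 := by simp
  have h2 : ∫ a, (G a - m) ^ 2 ∂ν = ∫ a, G a ^ 2 ∂ν - m ^ 2 := by
    have : ∀ a, (G a - m) ^ 2 = G a ^ 2 - 2 * m * G a + m ^ 2 := fun a => by ring
    simp only [this]
    have hi : Integrable (fun a => G a ^ 2 - 2 * m * G a) ν := hG2.sub (hGi.const_mul _)
    rw [integral_add hi (integrable_const _),
      integral_sub hG2 (hGi.const_mul _), integral_const_mul, ← hm]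
    simp only [integral_const, probReal_univ, smul_eq_mul, one_mul]
    ring
  linarith

/-- Variance by conditioning on one coordinate: the conditional mean `G` of that coordinate has
oscillation at most `c`, while for a frozen coordinate the function of the other `n` again has
bounded differences. Stating the bound for the second moment lets the inductive estimate be
integrated directly. -/
lemma integral_sq_le_of_bounded_differences (n : ℕ) {F : (Fin n → E) → ℝ} (hF : Measurable F)
    {B c : ℝ} (hB : ∀ z, |F z| ≤ B)
    (hc : ∀ z z' j, (∀ l, l ≠ j → z l = z' l) → |F z - F z'| ≤ c) :
    ∫ z, F z ^ 2 ∂(Measure.pi fun _ => μ) ≤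
      (∫ z, F z ∂(Measure.pi fun _ => μ)) ^ 2 + n * c ^ 2 := by
  induction n with
  | zero =>
    have h : ∀ z : Fin 0 → E, F z = F Fin.elim0 := fun z => by congr; exact Subsingleton.elim _ _
    simp only [h]
    simp
  | succ n ih =>
    set π := Measure.pi (fun _ : Fin n => μ)
    have hF' : Measurable fun q : E × (Fin n → E) => F ((0 : Fin (n + 1)).insertNth q.1 q.2) :=
      hF.comp (measurable_insertNth 0)
    have hFi : ∀ a, Integrable (fun y => F ((0 : Fin (n + 1)).insertNth a y)) π := fun a =>
      integrable_of_abs_le (hF'.comp measurable_prodMk_left) fun y => hB _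
    have hFp : Integrable (fun q : E × (Fin n → E) => F ((0 : Fin (n + 1)).insertNth q.1 q.2))
        (μ.prod π) := integrable_of_abs_le hF' fun q => hB _
    have hFp2 : Integrable (fun q : E × (Fin n → E) => F ((0 : Fin (n + 1)).insertNth q.1 q.2) ^ 2)
        (μ.prod π) := integrable_of_abs_le (hF'.pow_const 2) (B := B ^ 2) fun q => by
          rw [abs_pow]; exact pow_le_pow_left₀ (abs_nonneg _) (hB _) 2
    set G : E → ℝ := fun a => ∫ y, F ((0 : Fin (n + 1)).insertNth a y) ∂π with hG
    have hGm : Measurable G := hF'.stronglyMeasurable.integral_prod_right.measurable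
    have hGB : ∀ a, |G a| ≤ B := fun a => by
      simpa [hG] using norm_integral_le_of_norm_le_const (μ := π) (C := B)
        (f := fun y => F ((0 : Fin (n + 1)).insertNth a y)) (Filter.Eventually.of_forall fun y => hB _)
    have hGc : ∀ a b, |G a - G b| ≤ c := fun a b => by
      rw [hG]
      simp only
      rw [← integral_sub (hFi a) (hFi b)]
      have := norm_integral_le_of_norm_le_const (μ := π) (C := c)
        (f := fun y => F ((0 : Fin (n + 1)).insertNth a y) - F ((0 : Fin (n + 1)).insertNth b y))
        (Filter.Eventually.of_forall fun y => hc _ _ 0 fun l hl => by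
          obtain ⟨l', rfl⟩ := Fin.exists_succAbove_eq hl
          simp)
      simpa using this
    have hinner : ∀ a, ∫ y, F ((0 : Fin (n + 1)).insertNth a y) ^ 2 ∂π ≤ G a ^ 2 + n * c ^ 2 := by
      intro a
      refine ih (hF'.comp measurable_prodMk_left) (fun y => hB _) fun z z' j h => hc _ _ j.succ ?_
      intro l hl
      rcases Fin.eq_zero_or_eq_succ l with rfl | ⟨l', rfl⟩
      · simp
      · have := h l' fun e => hl (by rw [e])
        simpa using this
    rw [integral_pi_insertNth μ 0 (fun z => F z ^ 2), integral_pi_insertNth μ 0 F,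
      integral_prod _ hFp2, integral_prod _ hFp]
    have hG2i : Integrable (fun a => G a ^ 2) μ :=
      integrable_of_abs_le (hGm.pow_const 2) (B := B ^ 2) fun a => by
        rw [abs_pow]; exact pow_le_pow_left₀ (abs_nonneg _) (hGB a) 2
    have h1 := integral_mono (μ := μ) hFp2.integral_prod_left
      (hG2i.add (integrable_const (n * c ^ 2))) hinner
    have h2 := integral_sq_le_of_abs_sub_le μ hGm hGB hGc
    simp only [Pi.add_apply] at h1
    rw [integral_add hG2i (integrable_const _)] at h1
    simp only [integral_const, probReal_univ, smul_eq_mul, one_mul] at h1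
    push_cast
    linarith

lemma integral_sub_sq_le_of_bounded_differences (n : ℕ) {F : (Fin n → E) → ℝ} (hF : Measurable F)
    {B c : ℝ} (hB : ∀ z, |F z| ≤ B)
    (hc : ∀ z z' j, (∀ l, l ≠ j → z l = z' l) → |F z - F z'| ≤ c) (I : ℝ) :
    ∫ z, (F z - I) ^ 2 ∂(Measure.pi fun _ => μ) ≤
      (∫ z, F z ∂(Measure.pi fun _ => μ) - I) ^ 2 + n * c ^ 2 := by
  have hi : Integrable F (Measure.pi fun _ => μ) := integrable_of_abs_le hF hB
  have h := integral_sq_le_of_bounded_differences μ n (F := fun z => F z - I)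
    (hF.sub_const I) (B := B + |I|) (fun z => (abs_sub _ _).trans (by gcongr; exact hB z))
    (c := c) (fun z z' j hj => by simpa using hc z z' j hj)
  rwa [integral_sub hi (integrable_const _), integral_const, probReal_univ, one_smul] at h

end BoundedDifferences

/-! ### Cones -/

section Cones

variable {V : Type*} [NormedAddCommGroup V]

-- Cover the unit sphere by finitely many balls of radius 1/2 and classify vectors by the ball that
-- their direction lies in. Two directions of one class are at distance at most 1, which for any
-- norm makes the shorter vector lie in the ball about the longer one that reaches the origin.
variable (V) in
lemma exists_cone_classes [NormedSpace ℝ V] [FiniteDimensional ℝ V] : ∃ (T : Finset V) (cls : V → V), (∀ u, cls u ∈ T) ∧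
    ∀ u v, cls u = cls v → ‖v‖ ≤ ‖u‖ → ‖v - u‖ ≤ ‖u‖ := by
  classical
  have : ProperSpace V := FiniteDimensional.proper_real V
  obtain ⟨t, -, htf, hcov⟩ := (isCompact_sphere (0 : V) 1).finite_cover_balls (e := 1 / 2) (by norm_num)
  have hex : ∀ u : V, u ≠ 0 → ∃ x ∈ t, ‖‖u‖⁻¹ • u - x‖ < 1 / 2 := by
    intro u hu
    have : ‖u‖⁻¹ • u ∈ Metric.sphere (0 : V) 1 := by
      simp [norm_smul, inv_mul_cancel₀ (norm_ne_zero_iff.2 hu)]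
    have := hcov this
    simp only [Set.mem_iUnion, mem_ball_iff_norm] at this
    obtain ⟨x, hx, h⟩ := this
    exact ⟨x, hx, h⟩
  choose! x hx hxu using hex
  refine ⟨insert 0 htf.toFinset, fun u => if u = 0 then 0 else x u, fun u => ?_, fun u v h hvu => ?_⟩
  · by_cases hu : u = 0
    · simp [hu]
    · simp [hu, hx u hu]
  · rcases eq_or_ne v 0 with rfl | hv
    · simp
    have hu : u ≠ 0 := fun hu => hv (by simpa [hu] using hvu)
    simp only [hu, hv, if_false] at h
    have h1 : ‖‖v‖⁻¹ • v - ‖u‖⁻¹ • u‖ ≤ 1 := by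
      have e : ‖v‖⁻¹ • v - ‖u‖⁻¹ • u = (‖v‖⁻¹ • v - x v) - (‖u‖⁻¹ • u - x u) := by rw [h]; abel
      rw [e]
      linarith [norm_sub_le (‖v‖⁻¹ • v - x v) (‖u‖⁻¹ • u - x u), hxu u hu, hxu v hv]
    have hu' : 0 < ‖u‖ := norm_pos_iff.2 hu
    have hv' : 0 < ‖v‖ := norm_pos_iff.2 hv
    -- Rotate first, at cost ‖v‖ times the distance of directions, then rescale along `u`, at cost
    -- ‖u‖ - ‖v‖; together at most ‖u‖.
    have e : v - u = ‖v‖ • (‖v‖⁻¹ • v - ‖u‖⁻¹ • u) + (‖v‖ / ‖u‖ - 1) • u := by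
      rw [smul_sub, smul_smul, smul_smul, mul_inv_cancel₀ hv'.ne', one_smul, sub_smul, one_smul,
        div_eq_mul_inv]
      abel
    have h2 : ‖(‖v‖ / ‖u‖ - 1) • u‖ = ‖u‖ - ‖v‖ := by
      rw [norm_smul, Real.norm_eq_abs, abs_of_nonpos (by rw [sub_nonpos, div_le_one hu']; exact hvu)]
      field_simp
      ring
    calc ‖v - u‖ ≤ ‖‖v‖ • (‖v‖⁻¹ • v - ‖u‖⁻¹ • u)‖ + ‖(‖v‖ / ‖u‖ - 1) • u‖ := by
          rw [e]; exact norm_add_le _ _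
      _ ≤ ‖v‖ * 1 + (‖u‖ - ‖v‖) := by
          rw [h2, norm_smul, norm_norm]; gcongr
      _ = ‖u‖ := by ring

/-- Inserting a point of maximal value gives it the full rank and can only raise the other ranks.
Ties count upwards, so they only shrink the sum. -/
lemma sum_inv_rank_le {ι : Type*} (Q : Finset ι) (u : ι → ℝ) :
    ∑ i ∈ Q, (1 : ℝ) / (Q.filter fun l => u l ≤ u i).card ≤ harmonic Q.card := by
  classical
  induction Q using Finset.induction_on_max_value (f := u) with
  | empty => simp
  | insert a s ha hmax ih =>
    rw [Finset.sum_insert ha, Finset.card_insert_of_notMem ha, harmonic_succ]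
    push_cast
    have h1 : (1 : ℝ) / ((insert a s).filter fun l => u l ≤ u a).card = ((s.card : ℝ) + 1)⁻¹ := by
      rw [Finset.filter_true_of_mem, Finset.card_insert_of_notMem ha]
      · push_cast; rw [one_div]
      · intro l hl
        rcases Finset.mem_insert.1 hl with rfl | hl
        · rfl
        · exact hmax l hl
    have h2 : ∑ i ∈ s, (1 : ℝ) / ((insert a s).filter fun l => u l ≤ u i).card ≤
        ∑ i ∈ s, (1 : ℝ) / (s.filter fun l => u l ≤ u i).card := by
      refine Finset.sum_le_sum fun i hi => ?_
      have hpos : 0 < (s.filter fun l => u l ≤ u i).card :=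
        Finset.card_pos.2 ⟨i, by simp [hi]⟩
      have hle : (s.filter fun l => u l ≤ u i).card ≤ ((insert a s).filter fun l => u l ≤ u i).card :=
        Finset.card_le_card (Finset.filter_subset_filter _ (Finset.subset_insert _ _))
      gcongr
    rw [h1]
    linarith

variable {ι : Type*} [Fintype ι] [DecidableEq ι]

/-- The points that have `x j` in their ball meet at most `k` per cone when their balls contain
fewer than `k` other points. -/
lemma card_ball_lt_le {T : Finset V} {cls : V → V} (hT : ∀ u, cls u ∈ T)
    (hcls : ∀ u v, cls u = cls v → ‖v‖ ≤ ‖u‖ → ‖v - u‖ ≤ ‖u‖) (x : ι → V)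
    {D : ι → ι → ℝ} (hD : ∀ l i, D l i = ‖x l - x i‖) (ρ : ι → ℝ) (j : ι) (k : ℕ) :
    ((Finset.univ.erase j).filter fun i => D j i ≤ ρ i ∧
      (((Finset.univ.erase i).erase j).filter fun l => D l i ≤ ρ i).card < k).card ≤
      k * T.card := by
  classical
  obtain rfl : D = fun l i => ‖x l - x i‖ := funext fun l => funext fun i => hD l i
  refine Finset.card_le_mul_card_image_of_maps_to (f := fun i => cls (x i - x j)) (t := T)
    (fun i _ => hT _) k fun q _ => ?_
  set Q := ((Finset.univ.erase j).filter fun i => ‖x j - x i‖ ≤ ρ i ∧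
      (((Finset.univ.erase i).erase j).filter fun l => ‖x l - x i‖ ≤ ρ i).card < k).filter
      fun i => cls (x i - x j) = q with hQ
  rcases Q.eq_empty_or_nonempty with h | h
  · simp [h]
  -- The point of the cone farthest from `x j` has every other point of the cone in its ball. As
  -- that ball holds fewer than `k` such points, the cone has at most `k`.
  obtain ⟨i, hi, hmax⟩ := Finset.exists_max_image Q (fun i => ‖x i - x j‖) h
  have hi' := hi
  simp only [hQ, Finset.mem_filter, Finset.mem_erase, Finset.mem_univ, and_true] at hi'
  obtain ⟨⟨hij, hρ, hlt⟩, hq⟩ := hi'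
  have hsub : Q.erase i ⊆ ((Finset.univ.erase i).erase j).filter fun l => ‖x l - x i‖ ≤ ρ i := by
    intro l hl
    have hlQ := Finset.mem_of_mem_erase hl
    have hlm := hmax l hlQ
    have hli := Finset.ne_of_mem_erase hl
    simp only [hQ, Finset.mem_filter, Finset.mem_erase, Finset.mem_univ, and_true] at hlQ
    simp only [Finset.mem_filter, Finset.mem_erase, Finset.mem_univ, and_true]
    refine ⟨⟨hlQ.1.1, hli⟩, ?_⟩
    have := hcls (x i - x j) (x l - x j) (hq.trans hlQ.2.symm) hlm
    rw [sub_sub_sub_cancel_right] at this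
    rw [norm_sub_rev] at hρ
    exact this.trans hρ
  have := Finset.card_le_card hsub
  rw [Finset.card_erase_of_mem hi] at this
  omega

/-- In one cone, a ball about `x i` that reaches `x j` contains every point of the cone at least as
close to `x j` as `x i` is. The count at `i` is thus at least the rank of `i` by distance to `x j`,
and reciprocals of ranks sum to a harmonic number. -/
lemma sum_inv_card_le {T : Finset V} {cls : V → V} (hT : ∀ u, cls u ∈ T)
    (hcls : ∀ u v, cls u = cls v → ‖v‖ ≤ ‖u‖ → ‖v - u‖ ≤ ‖u‖) (x : ι → V)
    {D : ι → ι → ℝ} (hD : ∀ l i, D l i = ‖x l - x i‖) (ρ : ι → ℝ) (j : ι) :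
    ∑ i ∈ (Finset.univ.erase j).filter (fun i => D j i ≤ ρ i),
      (1 : ℝ) / ((Finset.univ.erase i).filter fun l => D l i ≤ ρ i).card ≤
      T.card * (harmonic (Fintype.card ι) : ℝ) := by
  classical
  obtain rfl : D = fun l i => ‖x l - x i‖ := funext fun l => funext fun i => hD l i
  rw [← Finset.sum_fiberwise_of_maps_to (g := fun i => cls (x i - x j)) (t := T) fun i _ => hT _,
    ← nsmul_eq_mul]
  refine Finset.sum_le_card_nsmul _ _ _ fun q _ => ?_
  set Q := ((Finset.univ.erase j).filter fun i => ‖x j - x i‖ ≤ ρ i).filter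
      fun i => cls (x i - x j) = q with hQ
  have hmono : (harmonic Q.card : ℝ) ≤ harmonic (Fintype.card ι) := by
    have : Monotone harmonic := monotone_nat_of_le_succ fun n => by
      rw [harmonic_succ]; linarith [show (0 : ℚ) ≤ ((n + 1 : ℕ) : ℚ)⁻¹ by positivity]
    exact_mod_cast this (Finset.card_le_univ Q)
  refine le_trans ?_ hmono
  refine le_trans (Finset.sum_le_sum fun i hi => ?_) (sum_inv_rank_le Q fun i => ‖x i - x j‖)
  have hpos : 0 < (Q.filter fun l => ‖x l - x j‖ ≤ ‖x i - x j‖).card :=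
    Finset.card_pos.2 ⟨i, by simp [hi]⟩
  have hi' := hi
  simp only [hQ, Finset.mem_filter, Finset.mem_erase, Finset.mem_univ, and_true] at hi'
  obtain ⟨⟨hij, hρ⟩, hq⟩ := hi'
  have hle : (Q.filter fun l => ‖x l - x j‖ ≤ ‖x i - x j‖).card ≤
      ((Finset.univ.erase i).filter fun l => ‖x l - x i‖ ≤ ρ i).card := by
    -- The rank includes `i`, which its own count omits; the count includes `j` instead, so
    -- exchanging the two loses nothing.
    have hsub : insert j ((Q.filter fun l => ‖x l - x j‖ ≤ ‖x i - x j‖).erase i) ⊆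
        (Finset.univ.erase i).filter fun l => ‖x l - x i‖ ≤ ρ i := by
      intro l hl
      simp only [Finset.mem_filter, Finset.mem_erase, Finset.mem_univ, and_true]
      rcases Finset.mem_insert.1 hl with rfl | hl
      · exact ⟨Ne.symm hij, hρ⟩
      · refine ⟨Finset.ne_of_mem_erase hl, ?_⟩
        have hl' := Finset.mem_of_mem_erase hl
        simp only [hQ, Finset.mem_filter, Finset.mem_erase, Finset.mem_univ, and_true] at hl'
        have := hcls (x i - x j) (x l - x j) (hq.trans hl'.1.2.symm) hl'.2
        rw [sub_sub_sub_cancel_right] at this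
        rw [norm_sub_rev] at hρ
        exact this.trans hρ
    have hc := Finset.card_le_card hsub
    rw [Finset.card_insert_of_notMem, Finset.card_erase_of_mem (by simp [hi])] at hc
    · omega
    · simp [hQ]
  gcongr

end Cones

/-! ### A common form of the two estimators -/

section Estimator

variable {dx dy : ℕ}

open Classical in
/-- The common form of the local estimates. -/
def localEstimate {N : ℕ} (p : ℝ≥0∞) (φ : ℕ → ℝ) (A a : ℝ) (k : ℕ)
    (z : Fin N → (Fin dx → ℝ) × (Fin dy → ℝ)) (i : Fin N) : ℝ :=
  if knnDist p k z i ≤ a then A + Real.log N - φ (nX p k z i) - φ (nY p k z i) else 0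

/-- The common form of the two truncated estimators. -/
def estimator {N : ℕ} (p : ℝ≥0∞) (φ : ℕ → ℝ) (A a : ℝ) (k : ℕ)
    (z : Fin N → (Fin dx → ℝ) × (Fin dy → ℝ)) : ℝ :=
  (1 / (N : ℝ)) * ∑ i, localEstimate p φ A a k z i

lemma tKSG_eq_estimator {N : ℕ} (k : ℕ) (δ : ℝ) (z : Fin N → (Fin dx → ℝ) × (Fin dy → ℝ)) :
    tKSG k δ z = estimator ∞ (fun n => digamma ((n : ℝ) + 1)) (digamma k)
      (threshold dx dy δ N) k z := rfl

lemma tBIKSG_eq_estimator {N : ℕ} (k : ℕ) (δ : ℝ) (z : Fin N → (Fin dx → ℝ) × (Fin dy → ℝ)) :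
    tBIKSG k δ z = estimator 2 (fun n => Real.log n)
      (digamma k + Real.log (unitBallVol dx * unitBallVol dy / unitBallVol (dx + dy)))
      (threshold dx dy δ N) k z := by
  unfold tBIKSG estimator iotaBIKSG localEstimate
  congr 1
  refine Finset.sum_congr rfl fun i _ => ?_
  split_ifs <;> ring

lemma natCard_ne_and_eq {N : ℕ} (i : Fin N) (Q : Fin N → Prop) [DecidablePred Q] :
    Nat.card {j : Fin N // j ≠ i ∧ Q j} = ((Finset.univ.erase i).filter Q).card := by
  rw [Nat.card_eq_fintype_card, Fintype.card_subtype]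
  congr 1; ext; simp

lemma natCard_ne_and_eq_succAbove {n : ℕ} (i : Fin (n + 1)) (Q : Fin (n + 1) → Prop) :
    Nat.card {j : Fin (n + 1) // j ≠ i ∧ Q j} = Nat.card {l : Fin n // Q (i.succAbove l)} := by
  refine Nat.card_congr (Equiv.symm (Equiv.ofBijective
    (fun l => ⟨i.succAbove l.1, Fin.succAbove_ne i l.1, l.2⟩) ⟨?_, ?_⟩))
  · rintro ⟨a, _⟩ ⟨b, _⟩ h
    simpa using h
  · rintro ⟨j, hj, hQ⟩
    obtain ⟨l, rfl⟩ := Fin.exists_succAbove_eq hj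
    exact ⟨⟨l, hQ⟩, rfl⟩

variable {n : ℕ} (p : ℝ≥0∞) (k : ℕ) (z : Fin (n + 1) → (Fin dx → ℝ) × (Fin dy → ℝ))
  (i : Fin (n + 1))

lemma knnDist_eq_kthSmallest : knnDist p k z i =
    kthSmallest k fun l => lpDist p (joint (z (i.succAbove l))) (joint (z i)) := by
  simp only [knnDist, kthSmallest, countLE, natCard_ne_and_eq_succAbove]

lemma nX_eq_countLE : nX p k z i =
    countLE (fun l => lpDist p (z (i.succAbove l)).1 (z i).1) (knnDist p k z i) := by
  simp only [nX, countLE, natCard_ne_and_eq_succAbove]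

lemma nY_eq_countLE : nY p k z i =
    countLE (fun l => lpDist p (z (i.succAbove l)).2 (z i).2) (knnDist p k z i) := by
  simp only [nY, countLE, natCard_ne_and_eq_succAbove]

open Classical in
lemma le_card_knnDist (hk : k ≤ n) : k ≤ ((Finset.univ.erase i).filter fun l =>
    lpDist p (joint (z l)) (joint (z i)) ≤ knnDist p k z i).card := by
  rw [← natCard_ne_and_eq, natCard_ne_and_eq_succAbove, knnDist_eq_kthSmallest]
  exact le_countLE_kthSmallest _ (by simpa using hk)

lemma knnDist_nonneg : 0 ≤ knnDist p k z i := by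
  rw [knnDist_eq_kthSmallest]; exact kthSmallest_nonneg _ _

open Classical in
lemma knnDist_le_of_le_card {r : ℝ} (hr : 0 ≤ r) (h : k ≤ ((Finset.univ.erase i).filter fun l =>
    lpDist p (joint (z l)) (joint (z i)) ≤ r).card) : knnDist p k z i ≤ r := by
  rw [← natCard_ne_and_eq, natCard_ne_and_eq_succAbove] at h
  rw [knnDist_eq_kthSmallest]
  exact kthSmallest_le_of_le hr h

lemma nX_add_one_le : nX p k z i + 1 ≤ n + 1 := by
  rw [nX_eq_countLE]
  simpa using countLE_le_card (fun l => lpDist p (z (i.succAbove l)).1 (z i).1) _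

lemma nY_add_one_le : nY p k z i + 1 ≤ n + 1 := by
  rw [nY_eq_countLE]
  simpa using countLE_le_card (fun l => lpDist p (z (i.succAbove l)).2 (z i).2) _

lemma abs_localEstimate_le {φ : ℕ → ℝ} (hφ : LogLike φ) (A a : ℝ) :
    |localEstimate p φ A a k z i| ≤ (|A| + 3) * (1 + Real.log (n + 1)) := by
  have hl : 0 ≤ Real.log ((n : ℝ) + 1) := by
    exact_mod_cast Real.log_natCast_nonneg (n + 1)
  have hA := abs_nonneg A
  have h1 := hφ.abs_le (nX_add_one_le p k z i)
  have h2 := hφ.abs_le (nY_add_one_le p k z i)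
  push_cast at h1 h2
  rw [localEstimate]
  split_ifs
  · push_cast
    rw [abs_le] at *
    have h3 := neg_abs_le A
    have h4 := le_abs_self A
    constructor <;> nlinarith [mul_nonneg hA hl]
  · simp only [abs_zero]; positivity

end Estimator

/-! ### Bounded differences of the estimator -/

section Differences

variable {dx dy n : ℕ} (p : ℝ≥0∞) (k : ℕ)

open Classical in
/-- The points whose nearest neighbour distance depends on the `j`-th sample. -/
def affected (z : Fin (n + 1) → (Fin dx → ℝ) × (Fin dy → ℝ)) (j : Fin (n + 1)) :
    Finset (Fin (n + 1)) :=
  (Finset.univ.erase j).filter fun i =>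
    lpDist p (joint (z j)) (joint (z i)) ≤ knnDist p k z i ∧
    (((Finset.univ.erase i).erase j).filter fun l =>
      lpDist p (joint (z l)) (joint (z i)) ≤ knnDist p k z i).card < k

variable {p k} {z z' : Fin (n + 1) → (Fin dx → ℝ) × (Fin dy → ℝ)} {i j : Fin (n + 1)}

/-- For such an `i`, at least `k` points other than the `j`-th already lie within its distance, and
these do not move. Applied in both directions it yields equality of the distances. -/
lemma knnDist_le_of_notMem_affected (hk : k ≤ n) (h : ∀ l, l ≠ j → z l = z' l) (hij : i ≠ j)
    (hi : i ∉ affected p k z j) : knnDist p k z' i ≤ knnDist p k z i := by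
  classical
  have h1 := le_card_knnDist p k z i hk
  have h2 : k ≤ (((Finset.univ.erase i).erase j).filter fun l =>
      lpDist p (joint (z l)) (joint (z i)) ≤ knnDist p k z i).card := by
    by_cases hj : lpDist p (joint (z j)) (joint (z i)) ≤ knnDist p k z i
    · by_contra hc
      exact hi (by simp only [affected, Finset.mem_filter]; exact ⟨by simpa using hij, hj, not_le.1 hc⟩)
    · refine h1.trans (Finset.card_le_card fun l hl => ?_)
      simp only [Finset.mem_filter, Finset.mem_erase, Finset.mem_univ, and_true] at hl ⊢
      refine ⟨⟨?_, hl.1⟩, hl.2⟩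
      rintro rfl
      exact hj hl.2
  refine knnDist_le_of_le_card p k z' i (knnDist_nonneg p k z i)
    (h2.trans (Finset.card_le_card fun l hl => ?_))
  simp only [Finset.mem_filter, Finset.mem_erase, Finset.mem_univ, and_true] at hl ⊢
  refine ⟨hl.1.2, ?_⟩
  rw [← h l hl.1.1, ← h i hij]
  exact hl.2

/-- The two counts can differ only through `j`, hence by at most one, and the increment of `φ` is at
most twice the reciprocal of the larger count, which is the one that includes `j`. -/
lemma abs_loglike_card_sub_le {φ : ℕ → ℝ} (hφ : LogLike φ) {ι : Type*} [DecidableEq ι]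
    (S : Finset ι) {j : ι} (hj : j ∈ S) (P P' : ι → Prop) [DecidablePred P] [DecidablePred P']
    (h : ∀ l ∈ S, l ≠ j → (P l ↔ P' l)) :
    |φ (S.filter P).card - φ (S.filter P').card| ≤
      2 * ((if P j then (1 : ℝ) / (S.filter P).card else 0) +
        (if P' j then (1 : ℝ) / (S.filter P').card else 0)) := by
  obtain ⟨T, hjT, rfl⟩ : ∃ T : Finset ι, j ∉ T ∧ S = insert j T :=
    ⟨S.erase j, by simp, (Finset.insert_erase hj).symm⟩
  have hPP' : T.filter P = T.filter P' := Finset.filter_congr fun l hl =>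
    h l (Finset.mem_insert_of_mem hl) fun e => hjT (e ▸ hl)
  have hjf : ∀ Q : ι → Prop, ∀ [DecidablePred Q], j ∉ T.filter Q := fun Q _ hm =>
    hjT (Finset.mem_of_mem_filter j hm)
  rw [Finset.filter_insert, Finset.filter_insert, hPP']
  have key := hφ.abs_succ_sub (T.filter P').card
  have e : ∀ x : ℝ, 2 / x = 2 * (1 / x) := fun x => by ring
  rw [e] at key
  split_ifs with h1 h2 h2
  · rw [sub_self, abs_zero]; positivity
  · rw [Finset.card_insert_of_notMem (hjf P')]
    push_cast
    simpa using key
  · rw [Finset.card_insert_of_notMem (hjf P'), abs_sub_comm]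
    push_cast
    simpa using key
  · simp

open Classical in
/-- The influence of the `j`-th sample on the number of `X`-neighbours of the `i`-th one. -/
def influenceX (p : ℝ≥0∞) (k : ℕ) (z : Fin (n + 1) → (Fin dx → ℝ) × (Fin dy → ℝ))
    (j i : Fin (n + 1)) : ℝ :=
  if lpDist p (z j).1 (z i).1 ≤ knnDist p k z i then (1 : ℝ) / nX p k z i else 0

open Classical in
/-- The influence of the `j`-th sample on the number of `Y`-neighbours of the `i`-th one. -/
def influenceY (p : ℝ≥0∞) (k : ℕ) (z : Fin (n + 1) → (Fin dx → ℝ) × (Fin dy → ℝ))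
    (j i : Fin (n + 1)) : ℝ :=
  if lpDist p (z j).2 (z i).2 ≤ knnDist p k z i then (1 : ℝ) / nY p k z i else 0

lemma influenceX_nonneg : 0 ≤ influenceX p k z j i := by
  rw [influenceX]; split_ifs <;> positivity

lemma influenceY_nonneg : 0 ≤ influenceY p k z j i := by
  rw [influenceY]; split_ifs <;> positivity

lemma abs_localEstimate_sub_le {φ : ℕ → ℝ} (hφ : LogLike φ) (A a : ℝ)
    (h : ∀ l, l ≠ j → z l = z' l) (hij : i ≠ j) (hρ : knnDist p k z i = knnDist p k z' i) :
    |localEstimate p φ A a k z i - localEstimate p φ A a k z' i| ≤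
      2 * (influenceX p k z j i + influenceX p k z' j i +
        (influenceY p k z j i + influenceY p k z' j i)) := by
  classical
  have hx : |φ (nX p k z i) - φ (nX p k z' i)| ≤
      2 * (influenceX p k z j i + influenceX p k z' j i) := by
    simp only [influenceX, nX, natCard_ne_and_eq]
    refine abs_loglike_card_sub_le hφ _ (by simpa using hij.symm) _ _ fun l _ hl => ?_
    rw [hρ, h l hl, h i hij]
  have hy : |φ (nY p k z i) - φ (nY p k z' i)| ≤
      2 * (influenceY p k z j i + influenceY p k z' j i) := by
    simp only [influenceY, nY, natCard_ne_and_eq]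
    refine abs_loglike_card_sub_le hφ _ (by simpa using hij.symm) _ _ fun l _ hl => ?_
    rw [hρ, h l hl, h i hij]
  rw [localEstimate, localEstimate, hρ]
  split_ifs
  · rw [abs_le] at *
    constructor <;> linarith
  · have := @influenceX_nonneg _ _ _ p k z i j
    have := @influenceX_nonneg _ _ _ p k z' i j
    have := @influenceY_nonneg _ _ _ p k z i j
    have := @influenceY_nonneg _ _ _ p k z' i j
    rw [sub_self, abs_zero]; positivity

-- Cone classes are chosen once in the joint space and in each marginal space, so `K` is a sum of
-- numbers of cones and depends on neither the sample size nor the samples.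
variable (dx dy p) in
lemma exists_influence_bound [Fact (1 ≤ p)] : ∃ K : ℝ, 0 ≤ K ∧
    ∀ (n k : ℕ) (z : Fin (n + 1) → (Fin dx → ℝ) × (Fin dy → ℝ)) (j : Fin (n + 1)),
      ((affected p k z j).card : ℝ) ≤ k * K ∧
      ∑ i ∈ Finset.univ.erase j, influenceX p k z j i ≤ K * (1 + Real.log (n + 1)) ∧
      ∑ i ∈ Finset.univ.erase j, influenceY p k z j i ≤ K * (1 + Real.log (n + 1)) := by
  classical
  obtain ⟨T, cls, hT, hcls⟩ := exists_cone_classes (PiLp p fun _ : Fin dx ⊕ Fin dy => ℝ)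
  obtain ⟨TX, clsX, hTX, hclsX⟩ := exists_cone_classes (PiLp p fun _ : Fin dx => ℝ)
  obtain ⟨TY, clsY, hTY, hclsY⟩ := exists_cone_classes (PiLp p fun _ : Fin dy => ℝ)
  refine ⟨T.card + TX.card + TY.card, by positivity, fun n k z j => ?_⟩
  have hl : 0 ≤ Real.log ((n : ℝ) + 1) := by
    exact_mod_cast Real.log_natCast_nonneg (n + 1)
  have hh : (harmonic (Fintype.card (Fin (n + 1))) : ℝ) ≤ 1 + Real.log (n + 1) := by
    have := harmonic_le_one_add_log (n + 1)
    simpa using this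
  have hT0 : (0 : ℝ) ≤ T.card := by positivity
  have hTX0 : (0 : ℝ) ≤ TX.card := by positivity
  have hTY0 : (0 : ℝ) ≤ TY.card := by positivity
  refine ⟨?_, ?_, ?_⟩
  · have := card_ball_lt_le hT hcls (fun l => WithLp.toLp p (joint (z l)))
      (D := fun l i => lpDist p (joint (z l)) (joint (z i))) (fun _ _ => rfl)
      (fun i => knnDist p k z i) j k
    have h' : ((affected p k z j).card : ℝ) ≤ k * T.card := by
      unfold affected
      exact_mod_cast (by convert this : _ ≤ k * T.card)
    refine h'.trans ?_
    gcongr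
    linarith
  · have := sum_inv_card_le hTX hclsX (fun l => WithLp.toLp p (z l).1)
      (D := fun l i => lpDist p (z l).1 (z i).1) (fun _ _ => rfl) (fun i => knnDist p k z i) j
    rw [Finset.sum_filter] at this
    simp only [influenceX, nX, natCard_ne_and_eq]
    refine (this.trans (mul_le_mul_of_nonneg_left hh hTX0)).trans ?_
    gcongr
    linarith
  · have := sum_inv_card_le hTY hclsY (fun l => WithLp.toLp p (z l).2)
      (D := fun l i => lpDist p (z l).2 (z i).2) (fun _ _ => rfl) (fun i => knnDist p k z i) j
    rw [Finset.sum_filter] at this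
    simp only [influenceY, nY, natCard_ne_and_eq]
    refine (this.trans (mul_le_mul_of_nonneg_left hh hTY0)).trans ?_
    gcongr
    linarith

variable (dx dy p k) in
/-- Changing one sample changes the estimator by `O(log N / N)`. -/
lemma exists_estimator_bounded_differences [Fact (1 ≤ p)] {φ : ℕ → ℝ} (hφ : LogLike φ) (A : ℝ) :
    ∃ C : ℝ, 0 ≤ C ∧ ∀ n : ℕ, k ≤ n → ∀ (a : ℝ)
      (z z' : Fin (n + 1) → (Fin dx → ℝ) × (Fin dy → ℝ)) (j : Fin (n + 1)),
      (∀ l, l ≠ j → z l = z' l) →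
      |estimator p φ A a k z - estimator p φ A a k z'| ≤
        C * (1 + Real.log (n + 1)) / (n + 1) := by
  classical
  obtain ⟨K, hK, hbd⟩ := exists_influence_bound dx dy p
  -- The three summands account for the moved sample itself, for the points affected under `z` or
  -- under `z'` (each changing by at most `2 * Λ`), and for four influence sums.
  refine ⟨2 * (|A| + 3) + 4 * (|A| + 3) * (k * K) + 8 * K, by positivity,
    fun n hk a z z' j h => ?_⟩
  set L := 1 + Real.log ((n : ℝ) + 1) with hL
  have hL0 : 0 ≤ L := by
    have : 0 ≤ Real.log ((n : ℝ) + 1) := by exact_mod_cast Real.log_natCast_nonneg (n + 1)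
    linarith
  set Λ := (|A| + 3) * L with hΛ
  have hΛ0 : 0 ≤ Λ := by positivity
  have hloc : ∀ i, |localEstimate p φ A a k z i - localEstimate p φ A a k z' i| ≤ 2 * Λ := by
    intro i
    have h1 := abs_localEstimate_le p k z i hφ A a
    have h2 := abs_localEstimate_le p k z' i hφ A a
    rw [abs_le] at *
    constructor <;> linarith [h1.1, h1.2, h2.1, h2.2]
  have hterm : ∀ i ∈ Finset.univ.erase j,
      |localEstimate p φ A a k z i - localEstimate p φ A a k z' i| ≤
      2 * Λ * ((if i ∈ affected p k z j then 1 else 0) + (if i ∈ affected p k z' j then 1 else 0)) +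
      2 * (influenceX p k z j i + influenceX p k z' j i +
        (influenceY p k z j i + influenceY p k z' j i)) := by
    intro i hi
    have hij : i ≠ j := Finset.ne_of_mem_erase hi
    have := @influenceX_nonneg _ _ _ p k z i j
    have := @influenceX_nonneg _ _ _ p k z' i j
    have := @influenceY_nonneg _ _ _ p k z i j
    have := @influenceY_nonneg _ _ _ p k z' i j
    by_cases h1 : i ∈ affected p k z j
    · rw [if_pos h1]
      have : (0 : ℝ) ≤ if i ∈ affected p k z' j then 1 else 0 := by split_ifs <;> norm_num
      nlinarith [hloc i]
    by_cases h2 : i ∈ affected p k z' j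
    · rw [if_pos h2]
      have : (0 : ℝ) ≤ if i ∈ affected p k z j then 1 else 0 := by split_ifs <;> norm_num
      nlinarith [hloc i]
    -- Being unaffected in both samples gives the two opposite inequalities.
    have hρ : knnDist p k z i = knnDist p k z' i :=
      le_antisymm (knnDist_le_of_notMem_affected hk (fun l hl => (h l hl).symm) hij h2)
        (knnDist_le_of_notMem_affected hk h hij h1)
    rw [if_neg h1, if_neg h2]
    simpa using abs_localEstimate_sub_le hφ A a h hij hρ
  have hsum := Finset.sum_le_sum hterm
  have haff : ∀ z : Fin (n + 1) → (Fin dx → ℝ) × (Fin dy → ℝ),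
      ∑ i ∈ Finset.univ.erase j, (if i ∈ affected p k z j then (1 : ℝ) else 0) ≤ k * K := by
    intro z
    refine le_trans ?_ (hbd n k z j).1
    rw [Finset.sum_ite_mem, Finset.sum_const, nsmul_eq_mul, mul_one]
    exact_mod_cast Finset.card_le_card Finset.inter_subset_right
  simp only [Finset.sum_add_distrib, ← Finset.mul_sum] at hsum
  have b1 := haff z
  have b2 := haff z'
  obtain ⟨-, b3, b4⟩ := hbd n k z j
  obtain ⟨-, b5, b6⟩ := hbd n k z' j
  have htot : |∑ i, (localEstimate p φ A a k z i - localEstimate p φ A a k z' i)| ≤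
      2 * Λ + (2 * Λ * (k * K + k * K) + 2 * (K * L + K * L + (K * L + K * L))) := by
    rw [← Finset.add_sum_erase _ _ (Finset.mem_univ j)]
    refine (abs_add_le _ _).trans (add_le_add (hloc j) ?_)
    refine (Finset.abs_sum_le_sum_abs _ _).trans (hsum.trans ?_)
    gcongr
  rw [estimator, estimator, ← mul_sub, ← Finset.sum_sub_distrib, abs_mul,
    abs_of_nonneg (by positivity : (0 : ℝ) ≤ 1 / ((n + 1 : ℕ) : ℝ))]
  push_cast
  rw [div_mul_eq_mul_div, one_mul]
  gcongr
  refine htot.trans (le_of_eq ?_)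
  rw [hΛ]; ring

end Differences

/-! ### Tails of the binomial distribution -/

/-- The probability that a binomial variable with parameters `n` and `q` is at least `k`. -/
def binTail : ℕ → ℕ → ℝ → ℝ
  | _, 0, _ => 1
  | 0, _ + 1, _ => 0
  | n + 1, k + 1, q => q * binTail n k q + (1 - q) * binTail n (k + 1) q

@[simp] lemma binTail_zero_right (n : ℕ) (q : ℝ) : binTail n 0 q = 1 := by
  cases n <;> rfl

lemma binTail_succ_succ (n k : ℕ) (q : ℝ) :
    binTail (n + 1) (k + 1) q = q * binTail n k q + (1 - q) * binTail n (k + 1) q := rfl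

lemma binTail_eq_zero_of_lt {n k : ℕ} (h : n < k) (q : ℝ) : binTail n k q = 0 := by
  induction n generalizing k with
  | zero => obtain ⟨k, rfl⟩ := Nat.exists_eq_succ_of_ne_zero (by omega : k ≠ 0); rfl
  | succ n ih =>
    obtain ⟨k, rfl⟩ := Nat.exists_eq_succ_of_ne_zero (by omega : k ≠ 0)
    rw [binTail_succ_succ, ih (by omega), ih (by omega)]; ring

lemma binTail_apply_zero (n : ℕ) {k : ℕ} (hk : 1 ≤ k) : binTail n k 0 = 0 := by
  obtain ⟨k, rfl⟩ := Nat.exists_eq_succ_of_ne_zero (by omega : k ≠ 0)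
  induction n with
  | zero => rfl
  | succ n ih => rw [binTail_succ_succ, ih]; ring

lemma binTail_apply_one {n k : ℕ} (hk : k ≤ n) : binTail n k 1 = 1 := by
  induction n generalizing k with
  | zero => obtain rfl : k = 0 := by omega
            rfl
  | succ n ih =>
    cases k with
    | zero => simp
    | succ k => rw [binTail_succ_succ, ih (by omega)]; ring

/-- The difference is the probability of exactly `k` successes in `n` trials: the tail grows when
one of the `n + 1` trials is pivotal. -/
lemma hasDerivAt_binTail (n k : ℕ) (q : ℝ) :
    HasDerivAt (binTail (n + 1) (k + 1))
      (((n : ℝ) + 1) * (binTail n k q - binTail n (k + 1) q)) q := by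
  have hstep : ∀ {a b : ℝ} {n k : ℕ}, HasDerivAt (binTail n k) a q →
      HasDerivAt (binTail n (k + 1)) b q → HasDerivAt (binTail (n + 1) (k + 1))
        (binTail n k q - binTail n (k + 1) q + (q * a + (1 - q) * b)) q := by
    intro a b n k ha hb
    have h := ((hasDerivAt_id q).mul ha).add (((hasDerivAt_id q).const_sub 1).mul hb)
    refine (h.congr_deriv ?_).congr_of_eventuallyEq (Filter.Eventually.of_forall fun x => ?_)
    · simp only [id]; ring
    · simp only [binTail_succ_succ, Pi.add_apply, Pi.mul_apply, id]
  have h0 : ∀ n, HasDerivAt (binTail n 0) 0 q := fun n => by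
    have : binTail n 0 = fun _ => 1 := funext fun x => binTail_zero_right n x
    rw [this]; exact hasDerivAt_const _ _
  induction n generalizing k with
  | zero =>
    have hz : ∀ k, HasDerivAt (binTail 0 (k + 1)) 0 q := fun k => by
      have : binTail 0 (k + 1) = fun _ => 0 := rfl
      rw [this]; exact hasDerivAt_const _ _
    cases k with
    | zero => refine (hstep (h0 0) (hz 0)).congr_deriv ?_; push_cast; ring
    | succ k => refine (hstep (hz k) (hz (k + 1))).congr_deriv ?_; push_cast; ring
  | succ n ih =>
    cases k with
    | zero =>
      refine (hstep (h0 (n + 1)) (ih 0)).congr_deriv ?_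
      have := binTail_succ_succ n 0 q
      push_cast
      rw [this]
      simp only [binTail_zero_right]
      ring
    | succ k =>
      refine (hstep (ih k) (ih (k + 1))).congr_deriv ?_
      rw [binTail_succ_succ n k, binTail_succ_succ n (k + 1)]
      push_cast
      ring

lemma binTail_anti_right {n k : ℕ} {q : ℝ} (h0 : 0 ≤ q) (h1 : q ≤ 1) :
    0 ≤ binTail n k q ∧ binTail n (k + 1) q ≤ binTail n k q := by
  induction n generalizing k with
  | zero => cases k <;> simp [binTail]
  | succ n ih =>
    have h1' : 0 ≤ 1 - q := by linarith
    cases k with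
    | zero =>
      refine ⟨by simp, ?_⟩
      rw [binTail_succ_succ, binTail_zero_right]
      have := (ih (k := 0)).2
      rw [binTail_zero_right] at *
      nlinarith
    | succ k =>
      rw [binTail_succ_succ, binTail_succ_succ]
      have a := ih (k := k)
      have b := ih (k := k + 1)
      exact ⟨add_nonneg (mul_nonneg h0 a.1) (mul_nonneg h1' b.1),
        add_le_add (mul_le_mul_of_nonneg_left a.2 h0) (mul_le_mul_of_nonneg_left b.2 h1')⟩

/-- `∫₀¹ P(Bin(n, q) ≥ k) dq / q = H_n - H_{k - 1}`, after the substitution `q = exp (-s)`. -/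
lemma integral_binTail_exp (k m : ℕ) :
    IntegrableOn (fun s => binTail (k + m) (k + 1) (Real.exp (-s))) (Set.Ioi 0) ∧
    ∫ s in Set.Ioi 0, binTail (k + m) (k + 1) (Real.exp (-s)) =
      (harmonic (k + m) : ℝ) - harmonic k := by
  induction m with
  | zero =>
    have : ∀ s, binTail (k + 0) (k + 1) (Real.exp (-s)) = 0 := fun s =>
      binTail_eq_zero_of_lt (by omega) _
    simp only [this]
    simp
  | succ m ih =>
    set n := k + m with hn
    rw [show k + (m + 1) = n + 1 by omega]
    -- `D` is `q` times the probability of exactly `k` successes. It is the increment of the tail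
    -- from `n` to `n + 1` trials, and -(n+1) D is the derivative in `s` of the latter tail, so its
    -- integral is 1/(n+1), one step of the harmonic sum.
    set D : ℝ → ℝ := fun s => Real.exp (-s) * (binTail n k (Real.exp (-s)) -
      binTail n (k + 1) (Real.exp (-s))) with hD
    have hder : ∀ s, HasDerivAt (fun s => binTail (n + 1) (k + 1) (Real.exp (-s)))
        (-(((n : ℝ) + 1) * D s)) s := by
      intro s
      have h1 : HasDerivAt (fun s => Real.exp (-s)) (-Real.exp (-s)) s := by
        simpa using (hasDerivAt_neg s).exp
      refine ((hasDerivAt_binTail n k (Real.exp (-s))).comp s h1).congr_deriv ?_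
      simp only [hD]; ring
    have hD0 : ∀ s ∈ Set.Ioi (0 : ℝ), 0 ≤ D s := fun s hs =>
      mul_nonneg (Real.exp_pos _).le (sub_nonneg.2 (binTail_anti_right (Real.exp_pos _).le
        (Real.exp_le_one_iff.2 (by simpa using (Set.mem_Ioi.1 hs).le))).2)
    have hneg : ∀ s ∈ Set.Ioi (0 : ℝ), -(((n : ℝ) + 1) * D s) ≤ 0 := fun s hs => by
      have := mul_nonneg (by positivity : (0 : ℝ) ≤ n + 1) (hD0 s hs); linarith
    have hlim : Filter.Tendsto (fun s => binTail (n + 1) (k + 1) (Real.exp (-s))) Filter.atTop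
        (nhds 0) := by
      have h1 : Filter.Tendsto (fun s : ℝ => Real.exp (-s)) Filter.atTop (nhds 0) :=
        Real.tendsto_exp_neg_atTop_nhds_zero
      have h2 := (hasDerivAt_binTail n k 0).continuousAt.tendsto.comp h1
      rwa [binTail_apply_zero _ (by omega)] at h2
    have hi := integrableOn_Ioi_deriv_of_nonpos' (a := 0) (fun s _ => hder s) hneg hlim
    have hv := integral_Ioi_of_hasDerivAt_of_nonpos' (a := 0) (fun s _ => hder s) hneg hlim
    have hn0 : ((n : ℝ) + 1) ≠ 0 := by positivity
    have hDi : IntegrableOn D (Set.Ioi 0) := by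
      have := hi.const_mul (-((n : ℝ) + 1)⁻¹)
      refine this.congr (Filter.Eventually.of_forall fun s => ?_)
      simp only; field_simp
    have hDv : ∫ s in Set.Ioi 0, D s = ((n : ℝ) + 1)⁻¹ := by
      have h1 : ∫ s in Set.Ioi 0, -(((n : ℝ) + 1) * D s) = -(((n : ℝ) + 1) * ∫ s in Set.Ioi 0, D s) := by
        rw [integral_neg, integral_const_mul]
      rw [h1, neg_zero, Real.exp_zero, binTail_apply_one (by omega)] at hv
      field_simp
      linarith
    have hsplit : ∀ s, binTail (n + 1) (k + 1) (Real.exp (-s)) =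
        binTail n (k + 1) (Real.exp (-s)) + D s := fun s => by
      rw [binTail_succ_succ]; simp only [hD]; ring
    simp only [hsplit]
    refine ⟨ih.1.add hDi, ?_⟩
    rw [integral_add ih.1 hDi, ih.2, hDv, harmonic_succ]
    push_cast
    ring

/-! ### Order statistics of an i.i.d. sample -/

section IID

variable {E : Type*} [MeasurableSpace E] (μ : Measure E) [IsProbabilityMeasure μ] {t s : E → ℝ}

omit [MeasurableSpace E] in
lemma countLE_insertNth {n : ℕ} (i : Fin (n + 1)) (a : E) (y : Fin n → E) (r : ℝ)
    [Decidable (t a ≤ r)] :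
    countLE (fun l => t ((i.insertNth a y : Fin (n + 1) → E) l)) r =
      (if t a ≤ r then 1 else 0) + countLE (fun l => t (y l)) r := by
  classical
  rw [countLE_succAbove _ i]
  simp only [Fin.insertNth_apply_same, Fin.insertNth_apply_succAbove]

lemma measure_le_countLE (ht : Measurable t) (n k : ℕ) (r : ℝ) :
    (Measure.pi fun _ : Fin n => μ).real {w | k ≤ countLE (fun l => t (w l)) r} =
      binTail n k (μ.real {x | t x ≤ r}) := by
  classical
  have hmeas : ∀ n k, MeasurableSet {w : Fin n → E | k ≤ countLE (fun l => t (w l)) r} := fun n k =>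
    measurableSet_le measurable_const
      (measurable_countLE (fun j => ht.comp (measurable_pi_apply j)) measurable_const)
  induction n generalizing k with
  | zero =>
    have h : ∀ w : Fin 0 → E, countLE (fun l => t (w l)) r = 0 := fun w => by
      simp [countLE_eq_sum]
    cases k <;> simp [binTail, h]
  | succ n ih =>
    cases k with
    | zero => simp
    | succ k =>
      set A : Set E := {x | t x ≤ r}
      have hA : MeasurableSet A := measurableSet_le ht measurable_const
      have h1 : ∀ (a : E) (y : Fin n → E), ((0 : Fin (n + 1)).insertNth a y : Fin (n + 1) → E) ∈
          {w : Fin (n + 1) → E | k + 1 ≤ countLE (fun l => t (w l)) r} ↔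
          (a, y) ∈ (A ×ˢ {w : Fin n → E | k ≤ countLE (fun l => t (w l)) r}) ∪
            (Aᶜ ×ˢ {w : Fin n → E | k + 1 ≤ countLE (fun l => t (w l)) r}) := by
        intro a y
        simp only [Set.mem_ofPred_eq, countLE_insertNth, Set.mem_union, Set.mem_prod,
          Set.mem_compl_iff, A]
        split_ifs with h
        · simp [h]; omega
        · simp [h]
      have h2 := (measurePreserving_insertNth μ (0 : Fin (n + 1))).measureReal_preimage
        (hmeas (n + 1) (k + 1)).nullMeasurableSet
      rw [← h2, show (fun q : E × (Fin n → E) =>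
          ((0 : Fin (n + 1)).insertNth q.1 q.2 : Fin (n + 1) → E)) ⁻¹'
          {w : Fin (n + 1) → E | k + 1 ≤ countLE (fun l => t (w l)) r} = _ from
          Set.ext fun q => h1 q.1 q.2,
        measureReal_union _ (hA.compl.prod (hmeas n (k + 1))), measureReal_prod_prod,
        measureReal_prod_prod, ih, ih, probReal_compl_eq_one_sub hA, binTail_succ_succ]
      rw [Set.disjoint_left]
      rintro ⟨a, y⟩ ⟨h, -⟩ ⟨h', -⟩
      exact h' h

lemma measure_kthSmallest_le (ht : Measurable t) {n k : ℕ} (hk : k ≤ n) {r : ℝ} (hr : 0 ≤ r) :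
    (Measure.pi fun _ : Fin n => μ).real {w | kthSmallest k (fun l => t (w l)) ≤ r} =
      binTail n k (μ.real {x | t x ≤ r}) := by
  rw [← measure_le_countLE μ ht]
  congr 1
  ext w
  exact kthSmallest_le_iff (by simpa using hk) hr

/-- The distribution function of `t`. -/
def distr (t : E → ℝ) (r : ℝ) : ℝ := μ.real {x | t x ≤ r}

lemma distr_mono (t : E → ℝ) : Monotone (distr μ t) := fun _ _ h =>
  measureReal_mono fun _ hx => le_trans hx h

lemma measurable_distr (t : E → ℝ) : Measurable (distr μ t) := (distr_mono μ t).measurable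

omit [IsProbabilityMeasure μ] in
lemma distr_nonneg (t : E → ℝ) (r : ℝ) : 0 ≤ distr μ t r := measureReal_nonneg

lemma distr_le_one (t : E → ℝ) (r : ℝ) : distr μ t r ≤ 1 := measureReal_le_one

lemma distr_eq_cdf (ht : Measurable t) : distr μ t = cdf (μ.map t) := by
  have := Measure.isProbabilityMeasure_map (μ := μ) ht.aemeasurable
  funext r
  rw [cdf_eq_real, map_measureReal_apply ht measurableSet_Iic]
  rfl

lemma continuous_distr (ht : Measurable t) (hat : ∀ r, μ {x | t x = r} = 0) :
    Continuous (distr μ t) := by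
  have := Measure.isProbabilityMeasure_map (μ := μ) ht.aemeasurable
  rw [distr_eq_cdf μ ht, continuous_iff_continuousAt]
  intro r
  rw [(cdf (μ.map t)).mono.continuousAt_iff_leftLim_eq_rightLim, StieltjesFunction.rightLim_eq]
  have h1 : (cdf (μ.map t)).measure {r} = 0 := by
    rw [measure_cdf, Measure.map_apply ht (measurableSet_singleton r)]
    exact hat r
  rw [StieltjesFunction.measure_singleton, ENNReal.ofReal_eq_zero] at h1
  exact le_antisymm ((cdf (μ.map t)).mono.leftLim_le le_rfl) (by linarith)

/-- The largest `τ`-quantile. Absence of atoms makes the distribution function continuous, so the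
level `τ` is attained, and maximality turns `distr μ t r' ≤ τ` into a condition on `r'` alone. -/
lemma exists_distr_eq (ht : Measurable t) (ht0 : ∀ x, 0 ≤ t x) (hat : ∀ r, μ {x | t x = r} = 0)
    {τ : ℝ} (h0 : 0 ≤ τ) (h1 : τ < 1) :
    ∃ r, 0 ≤ r ∧ distr μ t r = τ ∧ ∀ r', distr μ t r' ≤ τ ↔ r' ≤ r := by
  have hc := continuous_distr μ ht hat
  have hp := Measure.isProbabilityMeasure_map (μ := μ) ht.aemeasurable
  have hlim : Filter.Tendsto (distr μ t) Filter.atTop (nhds 1) := by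
    rw [distr_eq_cdf μ ht]; exact tendsto_cdf_atTop _
  obtain ⟨b, hb⟩ := ((hlim.eventually (lt_mem_nhds h1)).exists)
  have hz : distr μ t 0 = 0 := by
    rw [distr, measureReal_eq_zero_iff]
    refine le_antisymm ((measure_mono fun x hx => ?_).trans (hat 0).le) zero_le
    exact le_antisymm hx (ht0 x)
  set S := {r | distr μ t r ≤ τ} with hS
  have hSne : S.Nonempty := ⟨0, by simpa [hS, hz] using h0⟩
  have hSb : BddAbove S := ⟨b, fun r hr => by
    by_contra hbr
    exact absurd ((distr_mono μ t (not_le.1 hbr).le).trans hr) (not_le.2 hb)⟩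
  have hScl : IsClosed S := isClosed_le hc continuous_const
  have hmem : sSup S ∈ S := hScl.csSup_mem hSne hSb
  refine ⟨sSup S, le_csSup hSb (by simpa [hS, hz] using h0), le_antisymm hmem ?_, fun r' =>
    ⟨fun h => le_csSup hSb h, fun h => (distr_mono μ t h).trans hmem⟩⟩
  have : ∀ᶠ r in nhdsWithin (sSup S) (Set.Ioi (sSup S)), τ ≤ distr μ t r := by
    filter_upwards [self_mem_nhdsWithin] with r hr
    by_contra hlt
    exact absurd (le_csSup hSb (show r ∈ S from (not_le.1 hlt).le)) (not_le.2 hr)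
  exact ge_of_tendsto (hc.continuousAt.tendsto.mono_left nhdsWithin_le_nhds) this

lemma measurable_kthSmallest_comp (ht : Measurable t) {n k : ℕ} (hk : k ≤ n) :
    Measurable fun w : Fin n → E => kthSmallest k fun l => t (w l) :=
  measurable_kthSmallest (by simpa using hk) fun j => ht.comp (measurable_pi_apply j)

/-- Probability integral transform: the mass of the nearest neighbour ball is distributed as an
order statistic of uniform variables, whatever `μ` and `t` are. -/
lemma measure_distr_kthSmallest_le (ht : Measurable t) (ht0 : ∀ x, 0 ≤ t x)
    (hat : ∀ r, μ {x | t x = r} = 0) {n k : ℕ} (hk : k ≤ n) {τ : ℝ} (h0 : 0 ≤ τ) (h1 : τ < 1) :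
    (Measure.pi fun _ : Fin n => μ).real
      {w | distr μ t (kthSmallest k fun l => t (w l)) ≤ τ} = binTail n k τ := by
  obtain ⟨r, hr, hrτ, h⟩ := exists_distr_eq μ ht ht0 hat h0 h1
  simp only [h]
  rw [measure_kthSmallest_le μ ht hk hr, ← hrτ]
  rfl

/-- `E log p(R_k) = H_{k - 1} - H_n` for the `k`-th order statistic `R_k` of a sample of size `n`
with continuous distribution function `p`. -/
lemma integral_log_distr_kthSmallest (ht : Measurable t) (ht0 : ∀ x, 0 ≤ t x)
    (hat : ∀ r, μ {x | t x = r} = 0) {n k : ℕ} (hk1 : 1 ≤ k) (hk : k ≤ n) :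
    Integrable (fun w => Real.log (distr μ t (kthSmallest k fun l => t (w l))))
      (Measure.pi fun _ : Fin n => μ) ∧
    ∫ w, Real.log (distr μ t (kthSmallest k fun l => t (w l))) ∂(Measure.pi fun _ : Fin n => μ) =
      (harmonic (k - 1) : ℝ) - harmonic n := by
  set π := Measure.pi fun _ : Fin n => μ
  set p : (Fin n → E) → ℝ := fun w => distr μ t (kthSmallest k fun l => t (w l)) with hp
  have hpm : Measurable p := (measurable_distr μ t).comp (measurable_kthSmallest_comp ht hk)
  have hp0 : ∀ w, 0 ≤ p w := fun w => distr_nonneg _ _ _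
  have hp1 : ∀ w, p w ≤ 1 := fun w => distr_le_one _ _ _
  have hle : ∀ τ, 0 ≤ τ → τ < 1 → π.real {w | p w ≤ τ} = binTail n k τ := fun τ h0 h1 =>
    measure_distr_kthSmallest_le μ ht ht0 hat hk h0 h1
  have hpos : ∀ᵐ w ∂π, 0 < p w := by
    have h := hle 0 le_rfl one_pos
    rw [binTail_apply_zero _ hk1, measureReal_eq_zero_iff] at h
    rw [ae_iff]
    simpa using h
  have hf0 : ∀ w, 0 ≤ -Real.log (p w) := fun w => by
    have := Real.log_nonpos (hp0 w) (hp1 w); linarith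
  have hfm : Measurable fun w => -Real.log (p w) := (Real.measurable_log.comp hpm).neg
  have hlay : ∫⁻ w, ENNReal.ofReal (-Real.log (p w)) ∂π =
      ENNReal.ofReal ((harmonic n : ℝ) - harmonic (k - 1)) := by
    -- Layer cake: the mean of -log p is the integral over `u > 0` of the probability of p ≤
    -- exp(-u), a binomial tail.
    rw [lintegral_eq_lintegral_meas_le π (Filter.Eventually.of_forall hf0) hfm.aemeasurable]
    obtain ⟨hi, hv⟩ := integral_binTail_exp (k - 1) (n - (k - 1))
    rw [show k - 1 + (n - (k - 1)) = n by omega, show k - 1 + 1 = k by omega] at hi hv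
    rw [← hv, ofReal_integral_eq_lintegral_ofReal hi]
    · refine setLIntegral_congr_fun measurableSet_Ioi fun u hu => ?_
      have hu' : (0 : ℝ) < u := hu
      have he : Real.exp (-u) < 1 := Real.exp_lt_one_iff.2 (by linarith)
      rw [← hle _ (Real.exp_pos _).le he, ofReal_measureReal]
      refine measure_congr ?_
      filter_upwards [hpos] with w hw
      refine propext (show u ≤ -Real.log (p w) ↔ p w ≤ Real.exp (-u) from ?_)
      rw [← Real.log_le_iff_le_exp hw]
      constructor <;> intro h <;> linarith
    · filter_upwards [ae_restrict_mem measurableSet_Ioi] with u hu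
      exact (binTail_anti_right (Real.exp_pos _).le
        (Real.exp_le_one_iff.2 (by simpa using (Set.mem_Ioi.1 hu).le))).1
  have hint : Integrable (fun w => -Real.log (p w)) π := by
    refine ⟨hfm.aestronglyMeasurable, ?_⟩
    rw [hasFiniteIntegral_iff_ofReal (Filter.Eventually.of_forall hf0), hlay]
    exact ENNReal.ofReal_lt_top
  refine ⟨by simpa using hint.neg, ?_⟩
  have hmono : (harmonic (k - 1) : ℝ) ≤ harmonic n := by
    have : Monotone harmonic := monotone_nat_of_le_succ fun n => by
      rw [harmonic_succ]; linarith [show (0 : ℚ) ≤ ((n + 1 : ℕ) : ℚ)⁻¹ by positivity]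
    exact_mod_cast this (by omega : k - 1 ≤ n)
  have hval : ∫ w, -Real.log (p w) ∂π = (harmonic n : ℝ) - harmonic (k - 1) := by
    rw [integral_eq_lintegral_of_nonneg_ae (Filter.Eventually.of_forall hf0)
      hfm.aestronglyMeasurable, hlay, ENNReal.toReal_ofReal (by linarith)]
  rw [integral_neg] at hval
  linarith

/-- Exponential bound for the lower tail of the number of sample points in a set. -/
lemma measure_lt_kthSmallest_le (ht : Measurable t) {n k : ℕ} {r : ℝ} (hr : 0 ≤ r) :
    (Measure.pi fun _ : Fin n => μ).real {w | r < kthSmallest k (fun l => t (w l))} ≤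
      2 ^ k * Real.exp (-(n * distr μ t r / 2)) := by
  classical
  set π := Measure.pi fun _ : Fin n => μ
  -- With this weight the product over the sample is 2 to the minus count. Independence factorises
  -- its mean, and Markov's inequality gives the Chernoff bound.
  set g : E → ℝ := fun x => if t x ≤ r then 1 / 2 else 1 with hg
  have hA : MeasurableSet {x | t x ≤ r} := measurableSet_le ht measurable_const
  have hgm : Measurable g := Measurable.ite hA measurable_const measurable_const
  have hg1 : ∀ x, 0 ≤ g x ∧ g x ≤ 1 := fun x => by
    simp only [hg]; split_ifs <;> norm_num
  have hprod : ∀ w : Fin n → E, ∏ l, g (w l) = (1 / 2 : ℝ) ^ countLE (fun l => t (w l)) r := by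
    intro w
    simp only [hg, countLE_eq_card_filter]
    rw [Finset.prod_ite, Finset.prod_const, Finset.prod_const_one, mul_one]
  have hgi : ∫ x, g x ∂μ = 1 - distr μ t r / 2 := by
    have h1 : ∀ x, g x = 1 - Set.indicator {x | t x ≤ r} (fun _ => (1 / 2 : ℝ)) x := by
      intro x
      simp only [hg, Set.indicator, Set.mem_ofPred_eq]
      split_ifs <;> norm_num
    simp only [h1]
    rw [integral_sub (integrable_const _) ((integrable_const _).indicator hA),
      integral_indicator_const _ hA]
    simp [distr]
    ring
  have hF : ∫ w : Fin n → E, ∏ l, g (w l) ∂π = (1 - distr μ t r / 2) ^ n := by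
    rw [← hgi]
    simpa using integral_fintype_prod_eq_pow (ι := Fin n) (μ := μ) (𝕜 := ℝ) g
  have hFm : Measurable fun w : Fin n → E => ∏ l, g (w l) :=
    Finset.measurable_prod _ fun l _ => hgm.comp (measurable_pi_apply l)
  have hFi : Integrable (fun w : Fin n → E => ∏ l, g (w l)) π :=
    integrable_of_abs_le hFm (B := 1) fun w => by
      rw [abs_of_nonneg (Finset.prod_nonneg fun l _ => (hg1 _).1)]
      exact Finset.prod_le_one (fun l _ => (hg1 _).1) fun l _ => (hg1 _).2
  have hmk := mul_meas_ge_le_integral_of_nonneg (μ := π)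
    (Filter.Eventually.of_forall fun w => Finset.prod_nonneg fun l _ => (hg1 (w l)).1) hFi
    ((1 / 2 : ℝ) ^ k)
  have hsub : {w : Fin n → E | r < kthSmallest k (fun l => t (w l))} ⊆
      {w | (1 / 2 : ℝ) ^ k ≤ ∏ l, g (w l)} := by
    intro w hw
    have hlt : countLE (fun l => t (w l)) r < k := by
      by_contra hc
      exact absurd (kthSmallest_le_of_le hr (not_lt.1 hc)) (not_le.2 hw)
    simp only [Set.mem_ofPred_eq, hprod]
    exact pow_le_pow_of_le_one (by norm_num) (by norm_num) hlt.le
  have hle : π.real {w | r < kthSmallest k (fun l => t (w l))} ≤ 2 ^ k * (1 - distr μ t r / 2) ^ n := by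
    refine (measureReal_mono hsub).trans ?_
    rw [hF] at hmk
    have h2 : (1 / 2 : ℝ) ^ k * 2 ^ k = 1 := by rw [← mul_pow]; norm_num
    calc π.real {w | (1 / 2 : ℝ) ^ k ≤ ∏ l, g (w l)}
        = 2 ^ k * ((1 / 2 : ℝ) ^ k * π.real {w | (1 / 2 : ℝ) ^ k ≤ ∏ l, g (w l)}) := by
          rw [← mul_assoc, mul_comm (2 ^ k : ℝ), h2, one_mul]
      _ ≤ _ := by gcongr
  refine hle.trans ?_
  gcongr
  have h3 : 1 - distr μ t r / 2 ≤ Real.exp (-(distr μ t r / 2)) := by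
    have := Real.add_one_le_exp (-(distr μ t r / 2)); linarith
  calc (1 - distr μ t r / 2) ^ n ≤ Real.exp (-(distr μ t r / 2)) ^ n := by
        gcongr
        linarith [distr_le_one μ t r]
    _ = Real.exp (-(n * distr μ t r / 2)) := by
        rw [← Real.exp_nat_mul]; congr 1; ring

/-- The order statistic is one of the sample values, so a nonnegative function of it is at most the
sum over the sample. For `h` vanishing beyond the truncation radius this loses only the expected
number of points in the ball, a power of log N. -/
lemma lintegral_kthSmallest_le (ht : Measurable t) (ht0 : ∀ x, 0 ≤ t x) {n k : ℕ} (hk1 : 1 ≤ k)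
    (hk : k ≤ n) {h : ℝ → ℝ≥0∞} (hh : Measurable h) :
    ∫⁻ w, h (kthSmallest k fun l => t (w l)) ∂(Measure.pi fun _ : Fin n => μ) ≤
      n * ∫⁻ x, h (t x) ∂μ := by
  calc ∫⁻ w, h (kthSmallest k fun l => t (w l)) ∂(Measure.pi fun _ : Fin n => μ)
      ≤ ∫⁻ w, ∑ l, h (t (w l)) ∂(Measure.pi fun _ : Fin n => μ) := by
        refine lintegral_mono fun w => ?_
        obtain ⟨l, hl⟩ := exists_eq_kthSmallest (τ := fun l => t (w l)) hk1 (by simpa using hk)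
          fun l => ht0 _
        simp only [← hl]
        exact Finset.single_le_sum (f := fun l => h (t (w l))) (fun _ _ => zero_le)
          (Finset.mem_univ l)
    _ = ∑ l : Fin n, ∫⁻ w, h (t (w l)) ∂(Measure.pi fun _ : Fin n => μ) :=
        lintegral_finsetSum _ fun l _ => hh.comp (ht.comp (measurable_pi_apply l))
    _ = ∑ l : Fin n, ∫⁻ x, h (t x) ∂μ := by
        refine Finset.sum_congr rfl fun l _ => ?_
        exact (measurePreserving_eval (fun _ : Fin n => μ) l).lintegral_comp (hh.comp ht)
    _ = n * ∫⁻ x, h (t x) ∂μ := by simp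

end IID

/-! ### Leave-one-out bounds for neighbour counts -/

section LeaveOneOut

variable {E : Type*} [MeasurableSpace E] (μ : Measure E) [IsProbabilityMeasure μ] {t s : E → ℝ}

omit [IsProbabilityMeasure μ] in
lemma measurable_measure_le (s : E → ℝ) : Measurable fun r : ℝ => μ {x | s x ≤ r} :=
  Monotone.measurable fun _ _ h => measure_mono fun _ hx => le_trans hx h

/-- The number of sample points with `s` at most the `k`-th order statistic of `t`. -/
def neighbours {n : ℕ} (t s : E → ℝ) (k : ℕ) (w : Fin n → E) : ℕ :=
  countLE (fun l => s (w l)) (kthSmallest k fun l => t (w l))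

lemma measurable_neighbours (ht : Measurable t) (hs : Measurable s) {n k : ℕ} (hk : k ≤ n) :
    Measurable fun w : Fin n → E => neighbours t s k w :=
  measurable_countLE (fun j => hs.comp (measurable_pi_apply j)) (measurable_kthSmallest_comp ht hk)

omit [MeasurableSpace E] in
lemma neighbours_le {n : ℕ} (t s : E → ℝ) (k : ℕ) (w : Fin n → E) : neighbours t s k w ≤ n := by
  unfold neighbours
  simpa using countLE_le_card (fun l => s (w l)) (kthSmallest k fun l => t (w l))

omit [MeasurableSpace E] in
lemma le_neighbours (hst : ∀ x, s x ≤ t x) {n k : ℕ} (hk : k ≤ n) (w : Fin n → E) :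
    k ≤ neighbours t s k w :=
  (le_countLE_kthSmallest (fun l => t (w l)) (by simpa using hk)).trans
    (countLE_anti (fun l => hst (w l)) _)

-- Write the count as a sum over the sample. A point with `t` at most `R` contributes at most the
-- reciprocal mass at its own radius, since masses increase. A point beyond `R` may be deleted
-- without changing `R`; it is then independent of the radius, and its contribution has mean at most
-- one.
open Classical in
lemma lintegral_neighbours_div_le (ht : Measurable t) (hs : Measurable s) {m k : ℕ} (hk : k ≤ m)
    (a : ℝ) :
    ∫⁻ w, (if kthSmallest k (fun l => t (w l)) ≤ a then
        (neighbours t s k w : ℝ≥0∞) / μ {x | s x ≤ kthSmallest k fun l => t (w l)} else 0)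
        ∂(Measure.pi fun _ : Fin (m + 1) => μ) ≤
      (m + 1) * (∫⁻ x, (if t x ≤ a then (μ {y | s y ≤ t x})⁻¹ else 0) ∂μ) + (m + 1) := by
  set P : ℝ → ℝ≥0∞ := fun r => μ {x | s x ≤ r} with hP
  have hPm : Measurable P := measurable_measure_le μ s
  have hPmono : Monotone P := fun _ _ h => measure_mono fun _ hx => le_trans hx h
  set H : ℝ → ℝ≥0∞ := fun r => if r ≤ a then (P r)⁻¹ else 0 with hH
  have hHm : Measurable H := Measurable.ite measurableSet_Iic hPm.inv measurable_const
  have htl : ∀ l : Fin (m + 1), Measurable fun w : Fin (m + 1) → E => t (w l) := fun l =>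
    ht.comp (measurable_pi_apply l)
  have hRl : ∀ l : Fin (m + 1), Measurable fun w : Fin (m + 1) → E =>
      kthSmallest k fun j => t (w (l.succAbove j)) := fun l =>
    measurable_kthSmallest (by simpa using hk) fun j => ht.comp (measurable_pi_apply _)
  set G : Fin (m + 1) → (Fin (m + 1) → E) → ℝ≥0∞ := fun l w =>
    if s (w l) ≤ kthSmallest k (fun j => t (w (l.succAbove j))) then
      (P (kthSmallest k fun j => t (w (l.succAbove j))))⁻¹ else 0 with hG
  have hGm : ∀ l, Measurable (G l) := fun l =>
    Measurable.ite (measurableSet_le (hs.comp (measurable_pi_apply l)) (hRl l))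
      (hPm.comp (hRl l)).inv measurable_const
  have hpt : ∀ w : Fin (m + 1) → E, (if kthSmallest k (fun l => t (w l)) ≤ a then
        (neighbours t s k w : ℝ≥0∞) / P (kthSmallest k fun l => t (w l)) else 0) ≤
        ∑ l, (H (t (w l)) + G l w) := by
    intro w
    split_ifs with hRa
    · set R := kthSmallest k fun l => t (w l) with hR
      rw [neighbours, ← hR, countLE_eq_sum, div_eq_mul_inv]
      push_cast
      rw [Finset.sum_mul]
      refine Finset.sum_le_sum fun l _ => ?_
      split_ifs with hsl
      · rw [one_mul]
        by_cases htR : t (w l) ≤ R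
        · refine le_add_right ?_
          simp only [hH, if_pos (htR.trans hRa)]
          exact ENNReal.inv_le_inv.2 (hPmono htR)
        · refine le_add_left ?_
          have := kthSmallest_succAbove_of_lt hk (fun l => t (w l)) l (not_le.1 htR)
          simp only [hG, this]
          rw [← hR, if_pos hsl]
      · simp
    · exact zero_le
  refine (lintegral_mono hpt).trans ?_
  have hHG : ∀ l ∈ Finset.univ, Measurable fun w => H (t (w l)) + G l w := fun l _ =>
    (hHm.comp (htl l)).add (hGm l)
  rw [lintegral_finsetSum _ hHG]
  have h1 : ∀ l : Fin (m + 1), ∫⁻ w, (H (t (w l)) + G l w) ∂(Measure.pi fun _ => μ) ≤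
      ∫⁻ x, H (t x) ∂μ + 1 := by
    intro l
    have hHl : Measurable fun w : Fin (m + 1) → E => H (t (w l)) := hHm.comp (htl l)
    rw [lintegral_add_left hHl]
    gcongr
    · exact ((measurePreserving_eval (fun _ : Fin (m + 1) => μ) l).lintegral_comp (hHm.comp ht)).le
    · rw [lintegral_pi_insertNth μ l _ (hGm l)]
      calc _ ≤ ∫⁻ _, 1 ∂(Measure.pi fun _ : Fin m => μ) := by
            refine lintegral_mono fun y => ?_
            simp only [hG, Fin.insertNth_apply_same, Fin.insertNth_apply_succAbove]
            set ρ := kthSmallest k fun j => t (y j)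
            have : ∀ x, (if s x ≤ ρ then (P ρ)⁻¹ else 0) =
                Set.indicator {x | s x ≤ ρ} (fun _ => (P ρ)⁻¹) x := fun x => by
              simp [Set.indicator]
            simp only [this]
            rw [lintegral_indicator_const (measurableSet_le hs measurable_const), mul_comm]
            exact ENNReal.div_self_le_one
        _ = 1 := by simp
  refine (Finset.sum_le_sum fun l _ => h1 l).trans (le_of_eq ?_)
  simp [hH, hP]

/-- Add an independent sample and let each of the `n + 1` points in turn play the extra one. A
contributing point lies beyond the radius given by the others, hence does not alter it, so all
contributing points see the same radius `R` and the same count `m - 1`. Their number is at most `m -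
1`, and the sum is at most `1` pointwise. -/
lemma lintegral_div_neighbours_le (ht : Measurable t) (hs : Measurable s) (hst : ∀ x, s x ≤ t x)
    {n k : ℕ} (hk1 : 1 ≤ k) (hk : k ≤ n) :
    ∫⁻ w, ((n : ℝ≥0∞) + 1) * (μ {x | s x ≤ kthSmallest k (fun l => t (w l)) ∧
        kthSmallest k (fun l => t (w l)) < t x} / neighbours t s k w)
        ∂(Measure.pi fun _ : Fin n => μ) ≤ 1 := by
  classical
  have htl : ∀ l : Fin (n + 1), Measurable fun w : Fin (n + 1) → E => t (w l) := fun l =>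
    ht.comp (measurable_pi_apply l)
  have hsl : ∀ l : Fin (n + 1), Measurable fun w : Fin (n + 1) → E => s (w l) := fun l =>
    hs.comp (measurable_pi_apply l)
  have hRl : ∀ l : Fin (n + 1), Measurable fun w : Fin (n + 1) → E =>
      kthSmallest k fun j => t (w (l.succAbove j)) := fun l =>
    measurable_kthSmallest (by simpa using hk) fun j => ht.comp (measurable_pi_apply _)
  set G : Fin (n + 1) → (Fin (n + 1) → E) → ℝ≥0∞ := fun l v =>
    if s (v l) ≤ kthSmallest k (fun j => t (v (l.succAbove j))) ∧
      kthSmallest k (fun j => t (v (l.succAbove j))) < t (v l) then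
      ((neighbours t s k fun j => v (l.succAbove j) : ℕ) : ℝ≥0∞)⁻¹ else 0 with hG
  have hGm : ∀ l, Measurable (G l) := fun l => by
    refine Measurable.ite ((measurableSet_le (hsl l) (hRl l)).inter
      (measurableSet_lt (hRl l) (htl l))) ?_ measurable_const
    have h1 : Measurable fun v : Fin (n + 1) → E => neighbours t s k fun j => v (l.succAbove j) :=
      (measurable_neighbours ht hs hk).comp
        (measurable_pi_lambda _ fun j => measurable_pi_apply (l.succAbove j))
    exact ((measurable_from_nat (f := fun c : ℕ => (c : ℝ≥0∞))).comp h1).inv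
  have hterm : ∀ l : Fin (n + 1), ∫⁻ w, (μ {x | s x ≤ kthSmallest k (fun l => t (w l)) ∧
        kthSmallest k (fun l => t (w l)) < t x} / neighbours t s k w)
        ∂(Measure.pi fun _ : Fin n => μ) = ∫⁻ v, G l v ∂(Measure.pi fun _ => μ) := by
    intro l
    rw [lintegral_pi_insertNth μ l _ (hGm l)]
    refine lintegral_congr fun w => ?_
    simp only [hG, Fin.insertNth_apply_same, Fin.insertNth_apply_succAbove]
    set ρ := kthSmallest k fun j => t (w j)
    have : ∀ x, (if s x ≤ ρ ∧ ρ < t x then ((neighbours t s k fun j => w j : ℕ) : ℝ≥0∞)⁻¹ else 0) =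
        Set.indicator {x | s x ≤ ρ ∧ ρ < t x}
          (fun _ => ((neighbours t s k fun j => w j : ℕ) : ℝ≥0∞)⁻¹) x := fun x => by
      simp [Set.indicator]
    simp only [this]
    have hmeas : MeasurableSet {x | s x ≤ ρ ∧ ρ < t x} :=
      (measurableSet_le hs measurable_const).inter (measurableSet_lt measurable_const ht)
    rw [lintegral_indicator_const hmeas, mul_comm, div_eq_mul_inv]
  have hpt : ∀ v : Fin (n + 1) → E, ∑ l, G l v ≤ 1 := by
    intro v
    set R := kthSmallest k fun l => t (v l) with hR
    set m := countLE (fun l => s (v l)) R with hm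
    have hle : ∀ l, G l v ≤ if s (v l) ≤ R ∧ R < t (v l) then ((m - 1 : ℕ) : ℝ≥0∞)⁻¹ else 0 := by
      intro l
      simp only [hG]
      split_ifs with h1 h2 h2
      · have hr := kthSmallest_succAbove_of_lt' hk (fun l => t (v l)) l h1.2
        rw [← hR] at hr
        have hc := countLE_succAbove (fun l => s (v l)) l R
        rw [if_pos h2.1, ← hm] at hc
        rw [neighbours, hr, show countLE (fun l_1 => s (v (l.succAbove l_1))) R = m - 1 by omega]
      · exfalso
        have hr := kthSmallest_succAbove_of_lt' hk (fun l => t (v l)) l h1.2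
        rw [hr] at h1
        exact h2 h1
      · exact zero_le
      · exact le_rfl
    refine (Finset.sum_le_sum fun l _ => hle l).trans ?_
    -- Among the `m` points with `s ≤ R`, at least `k ≥ 1` also have `t ≤ R` and do not contribute.
    have hcard : (Finset.univ.filter fun l => s (v l) ≤ R ∧ R < t (v l)).card ≤ m - 1 := by
      have h1 := le_countLE_kthSmallest (k := k) (fun l => t (v l)) (by simp; omega)
      rw [← hR, countLE_eq_card_filter] at h1
      have h2 : (Finset.univ.filter fun l => s (v l) ≤ R ∧ R < t (v l)).card +
          (Finset.univ.filter fun l => t (v l) ≤ R).card ≤ m := by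
        rw [hm, countLE_eq_card_filter, ← Finset.card_union_of_disjoint]
        · refine Finset.card_le_card fun l hl => ?_
          simp only [Finset.mem_union, Finset.mem_filter, Finset.mem_univ, true_and] at hl ⊢
          exact hl.elim (fun h => h.1) fun h => (hst _).trans h
        · rw [Finset.disjoint_filter]
          exact fun l _ h h' => absurd h.2 (not_lt.2 h')
      omega
    rw [← Finset.sum_filter, Finset.sum_const, nsmul_eq_mul, ← div_eq_mul_inv]
    refine (ENNReal.div_le_div_right (Nat.cast_le.2 hcard) _).trans ENNReal.div_self_le_one
  calc _ = ((n : ℝ≥0∞) + 1) * ∫⁻ w, (μ {x | s x ≤ kthSmallest k (fun l => t (w l)) ∧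
        kthSmallest k (fun l => t (w l)) < t x} / neighbours t s k w)
        ∂(Measure.pi fun _ : Fin n => μ) := lintegral_const_mul' _ _ (by finiteness)
    _ = ∑ l : Fin (n + 1), ∫⁻ v, G l v ∂(Measure.pi fun _ => μ) := by
        rw [← Finset.sum_congr rfl fun l _ => hterm l]
        simp
    _ = ∫⁻ v, ∑ l, G l v ∂(Measure.pi fun _ => μ) := (lintegral_finsetSum _ fun l _ => hGm l).symm
    _ ≤ ∫⁻ _, 1 ∂(Measure.pi fun _ : Fin (n + 1) => μ) := lintegral_mono hpt
    _ = 1 := by simp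

open Classical in
/-- The bias of `φ(n_s)` as an estimate of `log (N p_s(R))`. -/
lemma abs_integral_neighbours_sub_log_le {φ : ℕ → ℝ} (hφ : LogLike φ) (ht : Measurable t)
    (hs : Measurable s) (ht0 : ∀ x, 0 ≤ t x) (hst : ∀ x, s x ≤ t x)
    (hat : ∀ r, μ {x | t x = r} = 0) {m k : ℕ} (hk1 : 1 ≤ k) (hk : k ≤ m) {a b ε : ℝ}
    (hb0 : 0 ≤ b)
    (hb : ∫⁻ x, (if t x ≤ a then (μ {y | s y ≤ t x})⁻¹ else 0) ∂μ ≤ ENNReal.ofReal b)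
    (hε0 : 0 ≤ ε) (hε1 : ε ≤ 1 / 2) (hε : ∀ r ≤ a, distr μ t r ≤ ε * distr μ s r) :
    Integrable (fun w => if kthSmallest k (fun l => t (w l)) ≤ a then φ (neighbours t s k w) -
      Real.log (((m : ℝ) + 2) * distr μ s (kthSmallest k fun l => t (w l))) else 0)
      (Measure.pi fun _ : Fin (m + 1) => μ) ∧
    |∫ w, (if kthSmallest k (fun l => t (w l)) ≤ a then φ (neighbours t s k w) -
      Real.log (((m : ℝ) + 2) * distr μ s (kthSmallest k fun l => t (w l))) else 0)
      ∂(Measure.pi fun _ : Fin (m + 1) => μ)| ≤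
    2 * b + 2 * ε + (Measure.pi fun _ : Fin (m + 1) => μ).real
      {w | a < kthSmallest k fun l => t (w l)} := by
  set π := Measure.pi fun _ : Fin (m + 1) => μ with hπ
  set R : (Fin (m + 1) → E) → ℝ := fun w => kthSmallest k fun l => t (w l) with hR
  set ν : (Fin (m + 1) → E) → ℕ := fun w => neighbours t s k w with hν
  set N : ℝ := (m : ℝ) + 2 with hN
  have hN0 : 0 < N := by positivity
  have hkm : k ≤ m + 1 := by omega
  have hRm : Measurable R := measurable_kthSmallest_comp ht hkm
  have hνm : Measurable ν := measurable_neighbours ht hs hkm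
  have hνR : Measurable fun w => (ν w : ℝ) := (measurable_from_nat (f := fun c : ℕ => (c : ℝ))).comp hνm
  have hset : MeasurableSet {w | R w ≤ a} := measurableSet_le hRm measurable_const
  have hν1 : ∀ w, 1 ≤ ν w := fun w => hk1.trans (le_neighbours hst hkm w)
  set q : (Fin (m + 1) → E) → ℝ := fun w => distr μ s (R w) with hq
  have hqm : Measurable q := (measurable_distr μ s).comp hRm
  have hpq : ∀ w, distr μ t (R w) ≤ q w := fun w =>
    measureReal_mono fun x hx => (hst x).trans hx
  obtain ⟨hlogi, -⟩ := integral_log_distr_kthSmallest μ ht ht0 hat hk1 hkm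
  have hpos : ∀ᵐ w ∂π, 0 < distr μ t (R w) := by
    have h := measure_distr_kthSmallest_le μ ht ht0 hat hkm le_rfl one_pos
    rw [binTail_apply_zero _ hk1, measureReal_eq_zero_iff] at h
    rw [ae_iff]
    simpa using h
  have hq0 : ∀ᵐ w ∂π, 0 < q w := hpos.mono fun w hw => hw.trans_le (hpq w)
  have hqi : Integrable (fun w => Real.log (N * q w)) π := by
    have h1 : Integrable (fun w => Real.log (q w)) π := by
      refine hlogi.mono (Real.measurable_log.comp hqm).aestronglyMeasurable ?_
      filter_upwards [hpos] with w hw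
      have h1 := Real.log_le_log hw (hpq w)
      have h2 := Real.log_nonpos (hw.trans_le (hpq w)).le (distr_le_one μ s (R w))
      rw [Real.norm_eq_abs, Real.norm_eq_abs, abs_of_nonpos h2, abs_of_nonpos (h1.trans h2)]
      linarith
    refine ((integrable_const (Real.log N)).add h1).congr ?_
    filter_upwards [hq0] with w hw
    simp only [Pi.add_apply]
    rw [Real.log_mul hN0.ne' hw.ne']
  have hφi : Integrable (fun w => φ (ν w)) π := by
    refine integrable_of_abs_le ((measurable_from_nat (f := φ)).comp hνm)
      (B := 1 + Real.log ((m + 2 : ℕ) : ℝ)) fun w => hφ.abs_le ?_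
    have := neighbours_le t s k w
    simp only [hν]; omega
  have hfi : Integrable (fun w => if R w ≤ a then φ (ν w) - Real.log (N * q w) else 0) π := by
    have := (hφi.sub hqi).indicator hset
    exact this.congr (Filter.Eventually.of_forall fun w => by simp [Set.indicator])
  refine ⟨hfi, ?_⟩
  have hPR : ∫ w, (if R w ≤ a then (1 : ℝ) else 0) ∂π = 1 - π.real {w | a < R w} := by
    have h1 : ∀ w, (if R w ≤ a then (1 : ℝ) else 0) = Set.indicator {w | R w ≤ a} 1 w := fun w => by
      simp [Set.indicator]
    simp only [h1]
    rw [integral_indicator_one hset, show {w | a < R w} = {w | R w ≤ a}ᶜ by ext; simp,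
      probReal_compl_eq_one_sub hset]
    ring
  have h1i : Integrable (fun w => if R w ≤ a then (1 : ℝ) else 0) π :=
    integrable_of_abs_le (Measurable.ite hset measurable_const measurable_const) (B := 1) fun w => by
      split_ifs <;> simp
  -- passing from bounds on `∫⁻` to bounds on `∫`
  have hconv : ∀ {g : (Fin (m + 1) → E) → ℝ} {B : ℝ}, Measurable g → (∀ w, 0 ≤ g w) → 0 ≤ B →
      ∫⁻ w, ENNReal.ofReal (g w) ∂π ≤ ENNReal.ofReal B → Integrable g π ∧ ∫ w, g w ∂π ≤ B := by
    intro g B hg hg0 hB h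
    refine ⟨⟨hg.aestronglyMeasurable, ?_⟩, ?_⟩
    · rw [hasFiniteIntegral_iff_ofReal (Filter.Eventually.of_forall hg0)]
      exact h.trans_lt ENNReal.ofReal_lt_top
    · rw [integral_eq_lintegral_of_nonneg_ae (Filter.Eventually.of_forall hg0)
        hg.aestronglyMeasurable]
      exact ENNReal.toReal_le_of_le_ofReal hB h
  have hP : ∀ r, μ {x | s x ≤ r} = ENNReal.ofReal (distr μ s r) := fun r => by
    rw [distr, ofReal_measureReal]
  have hlint_one : (m : ℝ≥0∞) + 1 = ENNReal.ofReal ((m : ℝ) + 1) := by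
    rw [ENNReal.ofReal_add (by positivity) (by positivity)]; simp
  -- the upper bound
  set gU : (Fin (m + 1) → E) → ℝ := fun w => if R w ≤ a then (ν w : ℝ) / q w else 0 with hgU
  set gI : (Fin (m + 1) → E) → ℝ := fun w => if R w ≤ a then (q w)⁻¹ else 0 with hgI
  have hgU0 : ∀ w, 0 ≤ gU w := fun w => by
    simp only [hgU]; split_ifs
    · exact div_nonneg (Nat.cast_nonneg _) (distr_nonneg _ _ _)
    · exact le_rfl
  have hgI0 : ∀ w, 0 ≤ gI w := fun w => by
    simp only [hgI]; split_ifs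
    · exact inv_nonneg.2 (distr_nonneg _ _ _)
    · exact le_rfl
  obtain ⟨hgUi, hgUv⟩ : Integrable gU π ∧ ∫ w, gU w ∂π ≤ ((m : ℝ) + 1) * b + (m + 1) := by
    refine hconv (Measurable.ite hset (hνR.div hqm) measurable_const) hgU0 (by positivity) ?_
    have h := lintegral_neighbours_div_le μ ht hs hk a
    refine (lintegral_mono_ae ?_).trans (h.trans ?_)
    · filter_upwards [hq0] with w hw
      simp only [hgU]
      split_ifs
      · rw [ENNReal.ofReal_div_of_pos hw, hP, ENNReal.ofReal_natCast]
      · simp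
    · rw [ENNReal.ofReal_add (by positivity) (by positivity),
        ENNReal.ofReal_mul (by positivity), hlint_one]
      gcongr
  obtain ⟨hgIi, hgIv⟩ : Integrable gI π ∧ ∫ w, gI w ∂π ≤ ((m : ℝ) + 1) * b := by
    refine hconv (Measurable.ite hset hqm.inv measurable_const) hgI0 (by positivity) ?_
    have h := lintegral_kthSmallest_le μ ht ht0 hk1 hkm
      (h := fun r => if r ≤ a then (μ {y | s y ≤ r})⁻¹ else 0)
      (Measurable.ite measurableSet_Iic (measurable_measure_le μ s).inv measurable_const)
    refine (lintegral_mono_ae ?_).trans (h.trans ?_)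
    · filter_upwards [hq0] with w hw
      simp only [hgI]
      split_ifs
      · rw [ENNReal.ofReal_inv_of_pos hw, hP]
      · simp
    · rw [ENNReal.ofReal_mul (by positivity), ← hlint_one]
      push_cast
      gcongr
  -- Use `log x ≤ x - 1` at x = (ν + 1)/(N q). The two integrals add up to at most (m+1)(2b+1) ≤
  -- N(2b+1), and subtracting the probability of `R ≤ a` removes the `1`.
  have hU : ∫ w, (if R w ≤ a then φ (ν w) - Real.log (N * q w) else 0) ∂π ≤
      2 * b + π.real {w | a < R w} := by
    have hle : ∫ w, (if R w ≤ a then φ (ν w) - Real.log (N * q w) else 0) ∂π ≤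
        ∫ w, (N⁻¹ * (gU w + gI w) - (if R w ≤ a then (1 : ℝ) else 0)) ∂π := by
      refine integral_mono_ae hfi (((hgUi.add hgIi).const_mul _).sub h1i) ?_
      filter_upwards [hq0] with w hw
      simp only [hgU, hgI]
      split_ifs
      · have h1 := hφ.le_log (ν w) (hν1 w)
        have h2 := Real.log_le_sub_one_of_pos (x := ((ν w : ℝ) + 1) / (N * q w)) (by positivity)
        rw [Real.log_div (by positivity) (by positivity)] at h2
        have h3 : N⁻¹ * ((ν w : ℝ) / q w + (q w)⁻¹) = ((ν w : ℝ) + 1) / (N * q w) := by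
          field_simp
        rw [h3]
        linarith
      · simp
    have hgs : Integrable (fun w => N⁻¹ * (gU w + gI w)) π := (hgUi.add hgIi).const_mul _
    rw [integral_sub hgs h1i, integral_const_mul, integral_add hgUi hgIi, hPR] at hle
    have : N⁻¹ * (∫ w, gU w ∂π + ∫ w, gI w ∂π) ≤ 2 * b + 1 := by
      rw [inv_mul_le_iff₀ hN0, hN]
      nlinarith
    linarith
  -- the lower bound
  set gL : (Fin (m + 1) → E) → ℝ := fun w => if R w ≤ a then N * q w / ν w else 0 with hgL
  have hgL0 : ∀ w, 0 ≤ gL w := fun w => by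
    simp only [hgL]; split_ifs
    · exact div_nonneg (mul_nonneg hN0.le (distr_nonneg _ _ _)) (Nat.cast_nonneg _)
    · exact le_rfl
  obtain ⟨hgLi, hgLv⟩ : Integrable gL π ∧ ∫ w, gL w ∂π ≤ 1 + 2 * ε := by
    refine hconv (Measurable.ite hset ((hqm.const_mul N).div hνR) measurable_const) hgL0
      (by positivity) ?_
    have h := lintegral_div_neighbours_le μ ht hs hst hk1 hkm
    have hcmp : ∀ w, ENNReal.ofReal (gL w) ≤ ENNReal.ofReal (1 + 2 * ε) *
        ((((m + 1 : ℕ) : ℝ≥0∞) + 1) * (μ {x | s x ≤ R w ∧ R w < t x} / ν w)) := by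
      intro w
      have hν0 : (0 : ℝ) < ν w := by exact_mod_cast hν1 w
      simp only [hgL]
      split_ifs with hRa
      · have hsplit : q w - distr μ t (R w) = μ.real {x | s x ≤ R w ∧ R w < t x} := by
          rw [show {x | s x ≤ R w ∧ R w < t x} = {x | s x ≤ R w} \ {x | t x ≤ R w} by
            ext; simp [not_le]]
          have hsub : {x | t x ≤ R w} ⊆ {x | s x ≤ R w} := fun x hx => (hst x).trans hx
          rw [measureReal_sdiff hsub (measurableSet_le ht measurable_const)]
          rfl
        have h1 : (1 - ε) * q w ≤ μ.real {x | s x ≤ R w ∧ R w < t x} := by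
          rw [← hsplit]; linarith [hε _ hRa]
        -- This is 1/(1-ε) ≤ 1 + 2ε for ε ≤ 1/2: within radius `a`, all but a fraction `ε` of the
        -- marginal ball lies outside the joint ball.
        have h2 : q w ≤ (1 + 2 * ε) * μ.real {x | s x ≤ R w ∧ R w < t x} := by
          have hq' : 0 ≤ q w := distr_nonneg _ _ _
          nlinarith [mul_nonneg (mul_nonneg hε0 (by linarith : (0 : ℝ) ≤ 1 - 2 * ε)) hq']
        -- `N` exceeds the sample size `m + 1` by one, exactly the normalisation in
        -- `lintegral_div_neighbours_le`.
        have h3 : (((m + 1 : ℕ) : ℝ≥0∞) + 1) = ENNReal.ofReal N := by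
          rw [hN, show (m : ℝ) + 2 = ((m + 1 + 1 : ℕ) : ℝ) by push_cast; ring,
            ENNReal.ofReal_natCast]
          push_cast; rfl
        rw [h3, ← ofReal_measureReal (s := {x | s x ≤ R w ∧ R w < t x}), ← ENNReal.ofReal_natCast,
          ← ENNReal.ofReal_div_of_pos hν0, ← ENNReal.ofReal_mul hN0.le,
          ← ENNReal.ofReal_mul (by positivity)]
        refine ENNReal.ofReal_le_ofReal ?_
        rw [show (1 + 2 * ε) * (N * (μ.real {x | s x ≤ R w ∧ R w < t x} / ν w)) =
          N * ((1 + 2 * ε) * μ.real {x | s x ≤ R w ∧ R w < t x}) / ν w by ring]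
        gcongr
      · simp
    refine (lintegral_mono hcmp).trans ?_
    rw [lintegral_const_mul' _ _ (by finiteness)]
    calc _ ≤ ENNReal.ofReal (1 + 2 * ε) * 1 := by gcongr
      _ = _ := mul_one _
  have hL : -(2 * ε + π.real {w | a < R w}) ≤
      ∫ w, (if R w ≤ a then φ (ν w) - Real.log (N * q w) else 0) ∂π := by
    have hle : ∫ w, ((if R w ≤ a then (1 : ℝ) else 0) - gL w) ∂π ≤
        ∫ w, (if R w ≤ a then φ (ν w) - Real.log (N * q w) else 0) ∂π := by
      refine integral_mono_ae (h1i.sub hgLi) hfi ?_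
      filter_upwards [hq0] with w hw
      have hν0 : (0 : ℝ) < ν w := by exact_mod_cast hν1 w
      simp only [hgL]
      split_ifs
      · have h1 := hφ.log_le (ν w) (hν1 w)
        have h2 := Real.log_le_sub_one_of_pos (x := N * q w / ν w) (by positivity)
        rw [Real.log_div (by positivity) (by positivity)] at h2
        linarith
      · simp
    rw [integral_sub h1i hgLi, hPR] at hle
    linarith
  rw [abs_le]
  constructor <;> linarith

end LeaveOneOut

/-! ### The bias of a local estimate, given the location of the sample point -/

section LocalBias

variable {E : Type*} [MeasurableSpace E] (μ : Measure E) [IsProbabilityMeasure μ]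

open Classical in
/-- The local estimate at a point, in terms of the distances `t`, `s₁`, `s₂` to that point. -/
def pointEstimate {n : ℕ} (φ : ℕ → ℝ) (B a : ℝ) (k : ℕ) (t s₁ s₂ : E → ℝ) (w : Fin n → E) : ℝ :=
  if kthSmallest k (fun l => t (w l)) ≤ a then
    B - φ (neighbours t s₁ k w) - φ (neighbours t s₂ k w) else 0

/-- The quantity inside reduces to H_n - γ - log(n+1), which lies between -1/(n+1) and 0. It will be
used with `n` the number of other samples, so that `n + 1 = N`. -/
lemma abs_digamma_sub_log_sub_le {k : ℕ} (hk : 1 ≤ k) (n : ℕ) :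
    |digamma k - Real.log ((n : ℝ) + 1) - ((harmonic (k - 1) : ℝ) - harmonic n)| ≤ 1 / (n + 1) := by
  have h1 : digamma k = harmonic (k - 1) - Real.eulerMascheroniConstant := by
    have := digamma_natCast_add_one (k - 1)
    rwa [show ((k - 1 : ℕ) : ℝ) + 1 = k by
      rw [Nat.cast_sub hk]; push_cast; ring] at this
  have h2 := harmonic_le_log_add_one n
  have h3 := log_le_harmonic_sub (n := n + 1) (by omega)
  rw [harmonic_succ] at h3
  push_cast at h3
  rw [← one_div] at h3
  have h4 : (0 : ℝ) ≤ 1 / (n + 1) := by positivity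
  rw [h1, abs_le]
  constructor <;> linarith

-- Where `R ≤ a`, the estimate equals the target plus four errors: `V`, the centred logarithm of the
-- joint ball mass, with mean O(1/N); minus `U₁` and `U₂`, the errors of the two counts; and `D`,
-- the deviation of the three masses from power laws. The terms in log r cancel in `D` because the
-- joint exponent is `d₁ + d₂`. The mean of `V` is known only over the whole space, so its part `W`
-- on the truncated event is removed separately.
open Classical in
lemma ofReal_abs_integral_pointEstimate_sub_le {φ : ℕ → ℝ} (hφ : LogLike φ) {t s₁ s₂ : E → ℝ}
    (ht : Measurable t) (hs₁ : Measurable s₁) (hs₂ : Measurable s₂) (ht0 : ∀ x, 0 ≤ t x)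
    (hst₁ : ∀ x, s₁ x ≤ t x) (hst₂ : ∀ x, s₂ x ≤ t x) (hat : ∀ r, μ {x | t x = r} = 0)
    {m k : ℕ} (hk1 : 1 ≤ k) (hk : k ≤ m) {a b ε τ : ℝ} (hb0 : 0 ≤ b)
    (hb₁ : ∫⁻ x, (if t x ≤ a then (μ {y | s₁ y ≤ t x})⁻¹ else 0) ∂μ ≤ ENNReal.ofReal b)
    (hb₂ : ∫⁻ x, (if t x ≤ a then (μ {y | s₂ y ≤ t x})⁻¹ else 0) ∂μ ≤ ENNReal.ofReal b)
    (hε0 : 0 ≤ ε) (hε1 : ε ≤ 1 / 2) (hε₁ : ∀ r ≤ a, distr μ t r ≤ ε * distr μ s₁ r)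
    (hε₂ : ∀ r ≤ a, distr μ t r ≤ ε * distr μ s₂ r)
    (hτ : (Measure.pi fun _ : Fin (m + 1) => μ).real {w | a < kthSmallest k fun l => t (w l)} ≤ τ)
    (hNa : 1 ≤ ((m : ℝ) + 2) * distr μ t a)
    {α α₁ α₂ β d₁ d₂ Λ : ℝ} {η : ℝ → ℝ} (hη : Measurable η)
    (hηΛ : ∀ r, 0 < r → r ≤ a → η r ≤ Λ)
    (hle : ∀ r, 0 < r → r ≤ a → |Real.log (distr μ t r) - (α + (d₁ + d₂) * Real.log r)| +
      |Real.log (distr μ s₁ r) - (α₁ + d₁ * Real.log r)| +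
      |Real.log (distr μ s₂ r) - (α₂ + d₂ * Real.log r)| ≤ η r) :
    ENNReal.ofReal |∫ w, pointEstimate φ (digamma k + β + Real.log ((m : ℝ) + 2)) a k t s₁ s₂ w
        ∂(Measure.pi fun _ : Fin (m + 1) => μ) - (α - α₁ - α₂ + β)| ≤
      ENNReal.ofReal (1 / ((m : ℝ) + 2) + (|digamma k| + Real.log ((m : ℝ) + 2) +
        |α - α₁ - α₂ + β| + 2) * τ + 4 * b + 4 * ε) +
      (m + 1) * ∫⁻ x, (if t x ≤ a then ENNReal.ofReal (η (t x)) else 0) ∂μ := by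
  set π := Measure.pi fun _ : Fin (m + 1) => μ with hπ
  set R : (Fin (m + 1) → E) → ℝ := fun w => kthSmallest k fun l => t (w l) with hR
  set N : ℝ := (m : ℝ) + 2 with hN
  set i := α - α₁ - α₂ + β with hi
  have hN0 : 0 < N := by positivity
  have hkm : k ≤ m + 1 := by omega
  have hRm : Measurable R := measurable_kthSmallest_comp ht hkm
  have hset : MeasurableSet {w | R w ≤ a} := measurableSet_le hRm measurable_const
  have hset' : MeasurableSet {w | a < R w} := measurableSet_lt measurable_const hRm
  set p : (Fin (m + 1) → E) → ℝ := fun w => distr μ t (R w) with hp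
  have hpm : Measurable p := (measurable_distr μ t).comp hRm
  obtain ⟨hlogi, hlogv⟩ := integral_log_distr_kthSmallest μ ht ht0 hat hk1 hkm
  have hpos : ∀ᵐ w ∂π, 0 < p w := by
    have h := measure_distr_kthSmallest_le μ ht ht0 hat hkm le_rfl one_pos
    rw [binTail_apply_zero _ hk1, measureReal_eq_zero_iff] at h
    rw [ae_iff]
    simpa using h
  have hz : distr μ t 0 = 0 := by
    rw [distr, measureReal_eq_zero_iff]
    refine le_antisymm ((measure_mono fun x hx => ?_).trans (hat 0).le) zero_le
    exact le_antisymm hx (ht0 x)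
  have hRpos : ∀ᵐ w ∂π, 0 < R w := hpos.mono fun w hw => by
    refine lt_of_le_of_ne (kthSmallest_nonneg _ _) fun h => hw.ne' ?_
    simp only [hp, ← h, hz]
  obtain ⟨hU₁i, hU₁⟩ := abs_integral_neighbours_sub_log_le μ hφ ht hs₁ ht0 hst₁ hat hk1 hk hb0 hb₁
    hε0 hε1 hε₁
  obtain ⟨hU₂i, hU₂⟩ := abs_integral_neighbours_sub_log_le μ hφ ht hs₂ ht0 hst₂ hat hk1 hk hb0 hb₂
    hε0 hε1 hε₂
  set U₁ : (Fin (m + 1) → E) → ℝ := fun w => if R w ≤ a then φ (neighbours t s₁ k w) -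
      Real.log (N * distr μ s₁ (R w)) else 0 with hU₁def
  set U₂ : (Fin (m + 1) → E) → ℝ := fun w => if R w ≤ a then φ (neighbours t s₂ k w) -
      Real.log (N * distr μ s₂ (R w)) else 0 with hU₂def
  -- the logarithm of the mass of the ball
  set V : (Fin (m + 1) → E) → ℝ := fun w => digamma k - Real.log N - Real.log (p w) with hV
  have hVi : Integrable V π := (integrable_const _).sub hlogi
  have hVv : |∫ w, V w ∂π| ≤ 1 / N := by
    have h1 : ∫ w, V w ∂π = digamma k - Real.log N - ((harmonic (k - 1) : ℝ) - harmonic (m + 1)) := by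
      rw [integral_sub (integrable_const _) hlogi, hlogv]; simp
    have h2 := abs_digamma_sub_log_sub_le hk1 (m + 1)
    have h3 : ((m + 1 : ℕ) : ℝ) + 1 = N := by rw [hN]; push_cast; ring
    rw [h3] at h2
    rwa [h1]
  set W : (Fin (m + 1) → E) → ℝ := Set.indicator {w | a < R w} V with hW
  have hWi : Integrable W π := hVi.indicator hset'
  have hWv : |∫ w, W w ∂π| ≤ (|digamma k| + Real.log N) * τ := by
    have hb : ∀ w, ‖W w‖ ≤ Set.indicator {w | a < R w} (fun _ => |digamma k| + Real.log N) w := by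
      intro w
      by_cases hw : a < R w
      · simp only [hW, Set.indicator, Set.mem_ofPred_eq, if_pos hw, hV, Real.norm_eq_abs]
        have h1 : distr μ t a ≤ p w := distr_mono μ t hw.le
        have h0 : 0 < p w := by
          refine lt_of_lt_of_le ?_ h1
          by_contra hc
          have := mul_nonpos_of_nonneg_of_nonpos hN0.le (not_lt.1 hc)
          linarith
        -- Truncated radii exceed `a`, so `hNa` keeps N p at least `1` and -log p at most log N.
        have h2 : 0 ≤ Real.log (N * p w) := Real.log_nonneg (hNa.trans (by gcongr))
        rw [Real.log_mul hN0.ne' h0.ne'] at h2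
        have h3 : Real.log (p w) ≤ 0 := Real.log_nonpos h0.le (distr_le_one μ t _)
        have h4 := neg_abs_le (digamma k)
        have h5 := le_abs_self (digamma k)
        rw [abs_le]
        constructor <;> linarith
      · simp [hW, Set.indicator, hw]
    have h1 : |∫ w, W w ∂π| ≤ ∫ w, Set.indicator {w | a < R w} (fun _ => |digamma k| + Real.log N) w ∂π :=
      norm_integral_le_of_norm_le ((integrable_const _).indicator hset')
        (Filter.Eventually.of_forall hb)
    rw [integral_indicator_const _ hset', smul_eq_mul, mul_comm] at h1
    refine h1.trans ?_
    have : 0 ≤ Real.log N := Real.log_nonneg (by rw [hN]; linarith [Nat.cast_nonneg (α := ℝ) m])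
    gcongr
  -- the deviation of the masses of balls from powers
  set δ : ℝ → ℝ := fun r => (Real.log (distr μ t r) - (α + (d₁ + d₂) * Real.log r)) -
      (Real.log (distr μ s₁ r) - (α₁ + d₁ * Real.log r)) -
      (Real.log (distr μ s₂ r) - (α₂ + d₂ * Real.log r)) with hδ
  have hlm : ∀ s : E → ℝ, Measurable fun r => Real.log (distr μ s r) := fun s =>
    Real.measurable_log.comp (measurable_distr μ s)
  have hδm : Measurable δ :=
    (((hlm t).sub (measurable_const.add (Real.measurable_log.const_mul _))).sub
      ((hlm s₁).sub (measurable_const.add (Real.measurable_log.const_mul _)))).sub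
      ((hlm s₂).sub (measurable_const.add (Real.measurable_log.const_mul _)))
  have hδle : ∀ r, 0 < r → r ≤ a → |δ r| ≤ η r := fun r h0 h1 => by
    refine le_trans ?_ (hle r h0 h1)
    exact (abs_sub _ _).trans (add_le_add (abs_sub _ _) le_rfl)
  set D : (Fin (m + 1) → E) → ℝ := Set.indicator {w | R w ≤ a} fun w => δ (R w) with hD
  have hDm : Measurable D := (hδm.comp hRm).indicator hset
  have hDle : ∀ᵐ w ∂π, |D w| ≤ if R w ≤ a then η (R w) else 0 := hRpos.mono fun w hw => by
    simp only [hD, Set.indicator, Set.mem_ofPred_eq]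
    split_ifs with h
    · exact hδle _ hw h
    · simp
  -- The bound `Λ` enters only through integrability; the size of the integral comes from `η`.
  have hDi : Integrable D π := by
    refine Integrable.of_bound hDm.aestronglyMeasurable (max Λ 0) ?_
    filter_upwards [hDle, hRpos] with w hw hw0
    refine hw.trans ?_
    split_ifs with h
    · exact (hηΛ _ hw0 h).trans (le_max_left _ _)
    · exact le_max_right _ _
  have hDv : ENNReal.ofReal |∫ w, D w ∂π| ≤
      (m + 1) * ∫⁻ x, (if t x ≤ a then ENNReal.ofReal (η (t x)) else 0) ∂μ := by
    have h1 : ENNReal.ofReal |∫ w, D w ∂π| ≤ ∫⁻ w, ENNReal.ofReal |D w| ∂π := by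
      have := enorm_integral_le_lintegral_enorm (μ := π) D
      simpa only [← ofReal_norm, Real.norm_eq_abs] using this
    refine h1.trans ?_
    have h2 := lintegral_kthSmallest_le μ ht ht0 hk1 hkm
      (h := fun r => if r ≤ a then ENNReal.ofReal (η r) else 0)
      (Measurable.ite measurableSet_Iic hη.ennreal_ofReal measurable_const)
    push_cast at h2
    refine (lintegral_mono_ae ?_).trans h2
    filter_upwards [hDle] with w hw
    refine (ENNReal.ofReal_le_ofReal hw).trans ?_
    split_ifs
    · exact le_rfl
    · simp
  -- assembling
  have hq0 : ∀ (s : E → ℝ), (∀ x, s x ≤ t x) → ∀ w, 0 < p w → 0 < distr μ s (R w) := fun s hst w hw =>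
    hw.trans_le (measureReal_mono fun x hx => (hst x).trans hx)
  have hind : Integrable (Set.indicator {w | a < R w} fun _ => i) π :=
    (integrable_const _).indicator hset'
  have hJ : ∀ᵐ w ∂π, pointEstimate φ (digamma k + β + Real.log N) a k t s₁ s₂ w =
      i - Set.indicator {w | a < R w} (fun _ => i) w + (V w - W w) + D w - U₁ w - U₂ w := by
    filter_upwards [hpos] with w hw
    have e₁ := Real.log_mul hN0.ne' (hq0 s₁ hst₁ w hw).ne'
    have e₂ := Real.log_mul hN0.ne' (hq0 s₂ hst₂ w hw).ne'
    by_cases h : R w ≤ a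
    · have h' : ¬ a < R w := not_lt.2 h
      simp only [pointEstimate, hW, hD, hU₁def, hU₂def, Set.indicator, Set.mem_ofPred_eq, hV, hδ, hp]
      rw [if_pos h, if_neg h', if_neg h', if_pos h, if_pos h, if_pos h, e₁, e₂, hi]
      ring
    · have h' : a < R w := not_le.1 h
      simp only [pointEstimate, hW, hD, hU₁def, hU₂def, Set.indicator, Set.mem_ofPred_eq]
      rw [if_neg h, if_pos h', if_pos h', if_neg h, if_neg h, if_neg h]
      ring
  have hJv : ∫ w, pointEstimate φ (digamma k + β + Real.log N) a k t s₁ s₂ w ∂π - i =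
      -(π.real {w | a < R w} * i) + (∫ w, V w ∂π - ∫ w, W w ∂π) + ∫ w, D w ∂π - ∫ w, U₁ w ∂π -
        ∫ w, U₂ w ∂π := by
    have i1 : Integrable (fun w => i - Set.indicator {w | a < R w} (fun _ => i) w) π :=
      (integrable_const _).sub hind
    have i2 : Integrable (fun w => V w - W w) π := hVi.sub hWi
    have i3 : Integrable (fun w => i - Set.indicator {w | a < R w} (fun _ => i) w + (V w - W w)) π :=
      i1.add i2
    have i4 : Integrable (fun w => i - Set.indicator {w | a < R w} (fun _ => i) w + (V w - W w) +
      D w) π := i3.add hDi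
    have i5 : Integrable (fun w => i - Set.indicator {w | a < R w} (fun _ => i) w + (V w - W w) +
      D w - U₁ w) π := i4.sub hU₁i
    rw [integral_congr_ae hJ, integral_sub i5 hU₂i, integral_sub i4 hU₁i, integral_add i3 hDi,
      integral_add i1 i2, integral_sub hVi hWi, integral_sub (integrable_const _) hind,
      integral_indicator_const _ hset']
    simp only [integral_const, probReal_univ, smul_eq_mul, one_mul]
    ring
  have hQ0 : 0 ≤ π.real {w | a < R w} := measureReal_nonneg
  have hiQ : |π.real {w | a < R w} * i| ≤ |i| * τ := by
    rw [abs_mul, abs_of_nonneg hQ0, mul_comm]; gcongr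
  have hfin : |∫ w, pointEstimate φ (digamma k + β + Real.log N) a k t s₁ s₂ w ∂π - i| ≤
      (1 / N + (|digamma k| + Real.log N + |i| + 2) * τ + 4 * b + 4 * ε) + |∫ w, D w ∂π| := by
    rw [hJv]
    rw [abs_le] at *
    have := neg_abs_le (∫ w, D w ∂π)
    have := le_abs_self (∫ w, D w ∂π)
    constructor <;> linarith [hVv.1, hVv.2, hWv.1, hWv.2, hU₁.1, hU₁.2, hU₂.1, hU₂.2, hiQ.1, hiQ.2]
  refine (ENNReal.ofReal_le_ofReal hfin).trans (ENNReal.ofReal_add_le.trans ?_)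
  gcongr

end LocalBias

/-! ### Variation of finite sequences with small second differences -/

section Sequences

variable {a : ℕ → ℝ} {B η : ℝ} {bad : ℕ → Prop}

lemma abs_sub_diff_le {p q : ℕ} (hη : 0 ≤ η)
    (h2 : ∀ j, p ≤ j → j + 1 < q → |(a (j + 2) - a (j + 1)) - (a (j + 1) - a j)| ≤ η) {i l : ℕ}
    (hi : p ≤ i) (hil : i ≤ l) (hl : l < q) :
    |(a (l + 1) - a l) - (a (i + 1) - a i)| ≤ ((q - p : ℕ) : ℝ) * η := by
  have : ∀ m, i + m < q → |(a (i + m + 1) - a (i + m)) - (a (i + 1) - a i)| ≤ m * η := by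
    intro m
    induction m with
    | zero => intro _; simp
    | succ m ih =>
      intro hm
      have h := h2 (i + m) (by omega) (by omega)
      have h' := ih (by omega)
      push_cast
      calc |(a (i + (m + 1) + 1) - a (i + (m + 1))) - (a (i + 1) - a i)|
          = |((a (i + m + 2) - a (i + m + 1)) - (a (i + m + 1) - a (i + m))) +
            ((a (i + m + 1) - a (i + m)) - (a (i + 1) - a i))| := by
              rw [show i + (m + 1) = i + m + 1 by omega]; congr 1; ring
        _ ≤ _ := (abs_add_le _ _).trans (by linarith)
  have h := this (l - i) (by omega)
  rw [show i + (l - i) = l by omega] at h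
  refine h.trans ?_
  gcongr

/-- If all increments have one sign the sum telescopes and is at most `B`. Otherwise there are
increments of both signs, and since increments vary by at most `(q - p) * η` along the run, each is
at most that in absolute value. -/
lemma sum_abs_diff_le_of_good {p q : ℕ} (hpq : p ≤ q) (hη : 0 ≤ η) (hB : ∀ j, 0 ≤ a j ∧ a j ≤ B)
    (h2 : ∀ j, p ≤ j → j + 1 < q → |(a (j + 2) - a (j + 1)) - (a (j + 1) - a j)| ≤ η) :
    ∑ j ∈ Finset.Ico p q, |a (j + 1) - a j| ≤ B + ((q - p : ℕ) : ℝ) ^ 2 * η := by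
  have hB0 : 0 ≤ B := (hB 0).1.trans (hB 0).2
  have hη' : 0 ≤ ((q - p : ℕ) : ℝ) ^ 2 * η := by positivity
  have htel : ∑ j ∈ Finset.Ico p q, (a (j + 1) - a j) = a q - a p := Finset.sum_Ico_sub a hpq
  by_cases hpos : ∀ j ∈ Finset.Ico p q, 0 ≤ a (j + 1) - a j
  · rw [Finset.sum_congr rfl fun j hj => abs_of_nonneg (hpos j hj), htel]
    linarith [(hB q).2, (hB p).1]
  by_cases hneg : ∀ j ∈ Finset.Ico p q, a (j + 1) - a j ≤ 0
  · rw [Finset.sum_congr rfl fun j hj => abs_of_nonpos (hneg j hj), Finset.sum_neg_distrib, htel]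
    linarith [(hB p).2, (hB q).1]
  push Not at hpos hneg
  obtain ⟨i, hi, hi'⟩ := hpos
  obtain ⟨l, hl, hl'⟩ := hneg
  rw [Finset.mem_Ico] at hi hl
  have key : ∀ u v, p ≤ u → u < q → p ≤ v → v < q →
      |(a (u + 1) - a u) - (a (v + 1) - a v)| ≤ ((q - p : ℕ) : ℝ) * η := by
    intro u v hu hu' hv hv'
    rcases le_total u v with h | h
    · rw [abs_sub_comm]; exact abs_sub_diff_le hη h2 hu h hv'
    · exact abs_sub_diff_le hη h2 hv h hu'
  have hb : ∀ j ∈ Finset.Ico p q, |a (j + 1) - a j| ≤ ((q - p : ℕ) : ℝ) * η := by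
    intro j hj
    rw [Finset.mem_Ico] at hj
    have k1 := abs_le.1 (key j i hj.1 hj.2 hi.1 hi.2)
    have k2 := abs_le.1 (key j l hj.1 hj.2 hl.1 hl.2)
    rw [abs_le]
    constructor <;> linarith [k1.1, k1.2, k2.1, k2.2]
  refine (Finset.sum_le_card_nsmul _ _ _ hb).trans ?_
  rw [Nat.card_Ico, nsmul_eq_mul, ← mul_assoc, ← sq]
  linarith

-- Cut at the bad steps: `c` bad steps leave at most `c + 1` good runs, and each piece has variation
-- at most `B + M² η`.
open Classical in
lemma sum_abs_diff_le {M : ℕ} (hη : 0 ≤ η) (hB : ∀ j, 0 ≤ a j ∧ a j ≤ B)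
    (h2 : ∀ j, j + 1 < M → ¬ bad j → ¬ bad (j + 1) →
      |(a (j + 2) - a (j + 1)) - (a (j + 1) - a j)| ≤ η) (c : ℕ) :
    ∀ p q, p ≤ q → q ≤ M → ((Finset.Ico p q).filter bad).card = c →
    ∑ j ∈ Finset.Ico p q, |a (j + 1) - a j| ≤ (1 + 2 * c) * (B + (M : ℝ) ^ 2 * η) := by
  have hB0 : 0 ≤ B := (hB 0).1.trans (hB 0).2
  have hrun : ∀ p q, p ≤ q → q ≤ M → (∀ j ∈ Finset.Ico p q, ¬ bad j) →
      ∑ j ∈ Finset.Ico p q, |a (j + 1) - a j| ≤ B + (M : ℝ) ^ 2 * η := by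
    intro p q hpq hq hgood
    refine (sum_abs_diff_le_of_good hpq hη hB fun j hj hj' => h2 j (by omega)
      (hgood j (by rw [Finset.mem_Ico]; omega)) (hgood _ (by rw [Finset.mem_Ico]; omega))).trans ?_
    gcongr
    omega
  induction c with
  | zero =>
    intro p q hpq hq hc
    rw [Finset.card_eq_zero, Finset.filter_eq_empty_iff] at hc
    simpa using hrun p q hpq hq fun j hj => hc hj
  | succ c ih =>
    intro p q hpq hq hc
    have hne : ((Finset.Ico p q).filter bad).Nonempty := Finset.card_pos.1 (by omega)
    set j := ((Finset.Ico p q).filter bad).min' hne with hj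
    have hjm := Finset.min'_mem _ hne
    rw [← hj] at hjm
    have hjm' := hjm
    rw [Finset.mem_filter, Finset.mem_Ico] at hjm'
    obtain ⟨⟨hpj, hjq⟩, hbj⟩ := hjm'
    have hlow : ∀ i ∈ Finset.Ico p j, ¬ bad i := by
      intro i hi hbi
      rw [Finset.mem_Ico] at hi
      have : j ≤ i :=
        Finset.min'_le _ i (Finset.mem_filter.2 ⟨Finset.mem_Ico.2 ⟨hi.1, by omega⟩, hbi⟩)
      omega
    have hcard : ((Finset.Ico (j + 1) q).filter bad).card = c := by
      have : (Finset.Ico (j + 1) q).filter bad = ((Finset.Ico p q).filter bad).erase j := by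
        ext i
        simp only [Finset.mem_filter, Finset.mem_Ico, Finset.mem_erase]
        constructor
        · rintro ⟨h, hb⟩; exact ⟨by omega, by omega, hb⟩
        · rintro ⟨hne, h, hb⟩
          refine ⟨⟨?_, h.2⟩, hb⟩
          by_contra hlt
          exact hlow i (by rw [Finset.mem_Ico]; omega) hb
      rw [this, Finset.card_erase_of_mem hjm, hc]; rfl
    have h1 := hrun p j hpj (by omega) hlow
    have h3 := ih (j + 1) q (by omega) hq hcard
    have h4 : |a (j + 1) - a j| ≤ B + (M : ℝ) ^ 2 * η := by
      have : 0 ≤ (M : ℝ) ^ 2 * η := by positivity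
      rw [abs_le]
      constructor <;> linarith [(hB j).1, (hB j).2, (hB (j + 1)).1, (hB (j + 1)).2]
    rw [← Finset.sum_Ico_consecutive _ hpj hjq.le, Finset.sum_eq_sum_Ico_succ_bot hjq]
    push_cast
    linarith

open Classical in
/-- The variation of a sequence is controlled by the number of its bad steps and, when there are
none, by the number of its nonzero terms. -/
lemma sum_abs_diff_le' {M : ℕ} (hM : 1 ≤ M) (hη : 0 ≤ η) (hB : ∀ j, 0 ≤ a j ∧ a j ≤ B)
    (h2 : ∀ j, j + 1 < M → ¬ bad j → ¬ bad (j + 1) →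
      |(a (j + 2) - a (j + 1)) - (a (j + 1) - a j)| ≤ η)
    (h0 : (∀ j < M, ¬ bad j) → (∀ j ≤ M, a j = 0) ∨ ∀ j ≤ M, 0 < a j) :
    ∑ j ∈ Finset.range M, |a (j + 1) - a j| ≤ (B + (M : ℝ) ^ 2 * η) *
      ∑ j ∈ Finset.range M, (3 * (if bad j then 1 else 0) + (M : ℝ)⁻¹ * if 0 < a j then 1 else 0) := by
  have hB0 : 0 ≤ B := (hB 0).1.trans (hB 0).2
  have hV : 0 ≤ B + (M : ℝ) ^ 2 * η := by positivity
  have hM0 : (0 : ℝ) < M := by exact_mod_cast hM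
  have h := sum_abs_diff_le (M := M) hη hB h2 _ 0 M (Nat.zero_le _) le_rfl rfl
  rw [← Finset.range_eq_Ico] at h
  have hbadsum : ∑ j ∈ Finset.range M, (if bad j then (1 : ℝ) else 0) =
      ((Finset.range M).filter bad).card := by simp
  have hpos0 : 0 ≤ ∑ j ∈ Finset.range M, (if 0 < a j then (1 : ℝ) else 0) :=
    Finset.sum_nonneg fun j _ => by split_ifs <;> norm_num
  rw [Finset.sum_add_distrib, ← Finset.mul_sum, ← Finset.mul_sum, hbadsum]
  -- With at least one bad step, 1 + 2c ≤ 3c. With none, the variation is zero or all terms are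
  -- positive, and then the normalised number of positive terms is `1`. Thus no constant remains
  -- that could not be integrated over the whole space.
  by_cases hc : ((Finset.range M).filter bad).card = 0
  · have hgood : ∀ j < M, ¬ bad j := fun j hj => by
      rw [Finset.card_eq_zero, Finset.filter_eq_empty_iff] at hc
      exact hc (Finset.mem_range.2 hj)
    rcases h0 hgood with hz | hp
    · rw [Finset.sum_eq_zero fun j hj => by
        rw [Finset.mem_range] at hj
        rw [hz (j + 1) (by omega), hz j hj.le]; simp]
      positivity
    · have : ∑ j ∈ Finset.range M, (if 0 < a j then (1 : ℝ) else 0) = M := by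
        rw [Finset.sum_congr rfl fun j hj => if_pos (hp j (Finset.mem_range.1 hj).le)]
        simp
      rw [this, inv_mul_cancel₀ hM0.ne']
      rw [hc] at h ⊢
      push_cast at h ⊢
      linarith
  · have hc1 : (1 : ℝ) ≤ ((Finset.range M).filter bad).card := by
      exact_mod_cast Nat.one_le_iff_ne_zero.2 hc
    refine h.trans ?_
    rw [mul_comm]
    refine mul_le_mul_of_nonneg_left ?_ hV
    have : 0 ≤ (M : ℝ)⁻¹ * ∑ j ∈ Finset.range M, (if 0 < a j then (1 : ℝ) else 0) := by positivity
    linarith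

end Sequences

/-! ### Sweeping a set of finite Hausdorff measure along a segment -/

section Sweep

variable {ι : Type*} [Fintype ι]

/-- The set of the points from which the segment with direction `h` meets `S`. -/
def sweep {V : Type*} [AddCommGroup V] [Module ℝ V] (h : V) (S : Set V) : Set V :=
  {x | ∃ t ∈ Set.Icc (0 : ℝ) 1, x + t • h ∈ S}

/-- A dimensional constant for the volume of swept sets. -/
def sweepConst (ι : Type*) [Fintype ι] : ℝ :=
  5 * 2 ^ Fintype.card ι * (volume (Metric.ball (0 : EuclideanSpace ℝ ι) 1)).toReal

lemma sweepConst_nonneg : 0 ≤ sweepConst ι := by unfold sweepConst; positivity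

/-- Place balls of radius `2 * δ` along the segment with spacing at most `δ`. About ‖h‖/δ of them
suffice, each of volume of order δ^(e+1). -/
lemma volume_sweep_le_of_subset_closedBall {e : ℕ} (hcard : Fintype.card ι = e + 1)
    {h u : EuclideanSpace ℝ ι} {U : Set (EuclideanSpace ℝ ι)} {δ : ℝ} (hδ : 0 < δ)
    (hδh : δ ≤ 2 * ‖h‖) (hU : U ⊆ Metric.closedBall u δ) :
    volume (sweep h U) ≤ ENNReal.ofReal (sweepConst ι * ‖h‖ * δ ^ e) := by
  set M := ⌈‖h‖ / δ⌉₊ with hM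
  have hh : 0 < ‖h‖ := by linarith
  have hM0 : 0 < M := Nat.ceil_pos.2 (by positivity)
  have hM0' : (0 : ℝ) < M := by exact_mod_cast hM0
  have hMle : ‖h‖ / M ≤ δ := by
    rw [div_le_iff₀ hM0', mul_comm, ← div_le_iff₀ hδ]; exact Nat.le_ceil _
  have hMlt : (M : ℝ) < ‖h‖ / δ + 1 := Nat.ceil_lt_add_one (by positivity)
  have hsub : sweep h U ⊆ ⋃ l ∈ Finset.range (M + 1),
      Metric.closedBall (u - ((l : ℝ) / M) • h) (2 * δ) := by
    rintro x ⟨t, ⟨ht0, ht1⟩, hx⟩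
    have hl : ⌊t * M⌋₊ ≤ M := by
      have h1 := Nat.floor_le (by positivity : 0 ≤ t * M)
      have : (⌊t * M⌋₊ : ℝ) ≤ M := h1.trans (by nlinarith)
      exact_mod_cast this
    simp only [Set.mem_iUnion, Finset.mem_range]
    refine ⟨⌊t * M⌋₊, by omega, ?_⟩
    rw [mem_closedBall_iff_norm]
    have hx' := hU hx
    rw [mem_closedBall_iff_norm] at hx'
    have e1 : x - (u - ((⌊t * M⌋₊ : ℝ) / M) • h) =
        (x + t • h - u) + ((⌊t * M⌋₊ : ℝ) / M - t) • h := by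
      rw [sub_smul]; abel
    have h2 : |(⌊t * M⌋₊ : ℝ) / M - t| ≤ 1 / M := by
      have h3 := Nat.floor_le (by positivity : 0 ≤ t * M)
      have h4 := Nat.lt_floor_add_one (t * M)
      rw [show (⌊t * M⌋₊ : ℝ) / M - t = ((⌊t * M⌋₊ : ℝ) - t * M) / M by field_simp, abs_div,
        abs_of_pos hM0']
      gcongr
      rw [abs_le]; constructor <;> linarith
    rw [e1]
    refine (norm_add_le _ _).trans ?_
    rw [norm_smul, Real.norm_eq_abs]
    have : |(⌊t * M⌋₊ : ℝ) / M - t| * ‖h‖ ≤ δ := by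
      calc _ ≤ 1 / M * ‖h‖ := by gcongr
        _ = ‖h‖ / M := by ring
        _ ≤ δ := hMle
    linarith
  have hfin : volume (Metric.ball (0 : EuclideanSpace ℝ ι) 1) ≠ ∞ := measure_ball_lt_top.ne
  calc volume (sweep h U) ≤ ∑ l ∈ Finset.range (M + 1),
        volume (Metric.closedBall (u - ((l : ℝ) / M) • h) (2 * δ)) :=
        (measure_mono hsub).trans (measure_biUnion_finset_le _ _)
    _ = (M + 1) * (ENNReal.ofReal ((2 * δ) ^ (e + 1)) *
        volume (Metric.ball (0 : EuclideanSpace ℝ ι) 1)) := by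
        simp only [Measure.addHaar_closedBall volume _ (by positivity : (0 : ℝ) ≤ 2 * δ),
          finrank_euclideanSpace, hcard]
        simp
    _ = ENNReal.ofReal (((M : ℝ) + 1) * ((2 * δ) ^ (e + 1) *
        (volume (Metric.ball (0 : EuclideanSpace ℝ ι) 1)).toReal)) := by
        rw [ENNReal.ofReal_mul (by positivity), ENNReal.ofReal_mul (by positivity),
          ENNReal.ofReal_toReal hfin, ENNReal.ofReal_add (by positivity) (by positivity)]
        simp
    _ ≤ _ := by
        refine ENNReal.ofReal_le_ofReal ?_
        -- It is at most ‖h‖ + 2δ, and `δ ≤ 2‖h‖`.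
        have h5 : ((M : ℝ) + 1) * δ ≤ 5 * ‖h‖ := by
          have : ((M : ℝ) + 1) * δ ≤ (‖h‖ / δ + 2) * δ :=
            mul_le_mul_of_nonneg_right (by linarith) hδ.le
          refine this.trans ?_
          rw [add_mul, div_mul_cancel₀ _ hδ.ne']
          linarith
        rw [sweepConst, hcard]
        have e2 : ((M : ℝ) + 1) * ((2 * δ) ^ (e + 1) *
            (volume (Metric.ball (0 : EuclideanSpace ℝ ι) 1)).toReal) = (((M : ℝ) + 1) * δ) *
            (2 ^ (e + 1) * δ ^ e * (volume (Metric.ball (0 : EuclideanSpace ℝ ι) 1)).toReal) := by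
          rw [mul_pow, pow_succ δ]; ring
        rw [e2]
        calc _ ≤ (5 * ‖h‖) *
            (2 ^ (e + 1) * δ ^ e * (volume (Metric.ball (0 : EuclideanSpace ℝ ι) 1)).toReal) := by
              gcongr
          _ = _ := by ring

/-- A set lies in a closed ball about any of its points with radius its diameter. Letting larger
radii decrease to the diameter includes sets of diameter zero, where the radius must stay positive.
-/
lemma volume_sweep_le_ediam {e : ℕ} (hcard : Fintype.card ι = e + 1)
    {h : EuclideanSpace ℝ ι} (hh : h ≠ 0) {U : Set (EuclideanSpace ℝ ι)} (hUne : U.Nonempty)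
    (hU : Metric.ediam U ≤ ENNReal.ofReal ‖h‖) :
    volume (sweep h U) ≤ ENNReal.ofReal (sweepConst ι * ‖h‖) * Metric.ediam U ^ (e : ℝ) := by
  obtain ⟨u, hu⟩ := hUne
  have hh' : 0 < ‖h‖ := norm_pos_iff.2 hh
  have hfin : Metric.ediam U ≠ ∞ := (hU.trans_lt ENNReal.ofReal_lt_top).ne
  set D := (Metric.ediam U).toReal with hD
  have hD0 : 0 ≤ D := ENNReal.toReal_nonneg
  have hDh : D ≤ ‖h‖ := ENNReal.toReal_le_of_le_ofReal hh'.le hU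
  have hUD : Metric.ediam U = ENNReal.ofReal D := (ENNReal.ofReal_toReal hfin).symm
  rw [ENNReal.rpow_natCast, hUD, ← ENNReal.ofReal_pow hD0, ← ENNReal.ofReal_mul
    (mul_nonneg sweepConst_nonneg hh'.le)]
  have hbound : ∀ᶠ δ in nhdsWithin D (Set.Ioi D),
      volume (sweep h U) ≤ ENNReal.ofReal (sweepConst ι * ‖h‖ * δ ^ e) := by
    have h1 : ∀ᶠ δ in nhdsWithin D (Set.Ioi D), δ < 2 * ‖h‖ :=
      nhdsWithin_le_nhds (gt_mem_nhds (by linarith))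
    filter_upwards [h1, self_mem_nhdsWithin] with δ hδ hDδ
    have hDδ' : D < δ := hDδ
    refine volume_sweep_le_of_subset_closedBall hcard (u := u) (by linarith) hδ.le fun y hy => ?_
    have h2 : edist y u ≤ ENNReal.ofReal D := hUD ▸ Metric.edist_le_ediam_of_mem hy hu
    rw [Metric.mem_closedBall, dist_edist]
    exact (ENNReal.toReal_le_of_le_ofReal hD0 h2).trans hDδ'.le
  refine ge_of_tendsto ?_ hbound
  have hc : Continuous fun δ : ℝ => ENNReal.ofReal (sweepConst ι * ‖h‖ * δ ^ e) :=
    ENNReal.continuous_ofReal.comp (by fun_prop)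
  exact hc.continuousAt.tendsto.mono_left nhdsWithin_le_nhds

/-- A segment sweeps each piece of a cover over a volume of order ‖h‖ times the `e`-th power of its
diameter; summing over covers by small pieces gives the Hausdorff measure in codimension one. The
set `S` need not be measurable. -/
lemma volume_sweep_le {e : ℕ} (hcard : Fintype.card ι = e + 1)
    {h : EuclideanSpace ℝ ι} (hh : h ≠ 0) (S : Set (EuclideanSpace ℝ ι)) :
    volume (sweep h S) ≤ ENNReal.ofReal (sweepConst ι * ‖h‖) * Measure.hausdorffMeasure (e : ℝ) S := by
  have hh' : 0 < ‖h‖ := norm_pos_iff.2 hh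
  by_cases hK : ENNReal.ofReal (sweepConst ι * ‖h‖) = 0
  · have hv : (0 : ℝ) < (volume (Metric.ball (0 : EuclideanSpace ℝ ι) 1)).toReal :=
      ENNReal.toReal_pos (Metric.measure_ball_pos _ _ one_pos).ne' measure_ball_lt_top.ne
    rw [ENNReal.ofReal_eq_zero] at hK
    have : 0 < sweepConst ι * ‖h‖ := by unfold sweepConst; positivity
    linarith
  rw [mul_comm, ← ENNReal.div_le_iff hK ENNReal.ofReal_ne_top, Measure.hausdorffMeasure_apply]
  -- Hausdorff measure is a supremum over mesh sizes; the single mesh ‖h‖ is enough.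
  refine le_trans ?_ (le_iSup₂ (α := ℝ≥0∞) (ENNReal.ofReal ‖h‖) (ENNReal.ofReal_pos.2 hh'))
  refine le_iInf fun t => le_iInf fun hts => le_iInf fun htd => ?_
  rw [ENNReal.div_le_iff hK ENNReal.ofReal_ne_top, mul_comm, ← ENNReal.tsum_mul_left]
  have hsub : sweep h S ⊆ ⋃ n, sweep h (t n) := by
    rintro x ⟨s, hs, hx⟩
    obtain ⟨n, hn⟩ := Set.mem_iUnion.1 (hts hx)
    exact Set.mem_iUnion.2 ⟨n, s, hs, hn⟩
  refine (measure_mono hsub).trans ((measure_iUnion_le _).trans (ENNReal.tsum_le_tsum fun n => ?_))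
  rcases (t n).eq_empty_or_nonempty with hn | hn
  · have : sweep h (t n) = ∅ := by
      rw [hn]; ext x; simp [sweep]
    rw [this, measure_empty]
    exact zero_le
  · simp only [hn, iSup_pos]
    exact volume_sweep_le_ediam hcard hh hn (htd n)

end Sweep

/-! ### The modulus of continuity in `L¹` -/

section Translation

variable {ι : Type*} [Fintype ι] {g : EuclideanSpace ℝ ι → ℝ} {D : ℝ}

lemma HessianBoundAt.differentiableAt {v : EuclideanSpace ℝ ι} (h : HessianBoundAt g D v) :
    DifferentiableAt ℝ g v :=
  h.1.differentiableAt (by norm_num)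

lemma HessianBoundAt.differentiableAt_fderiv {v : EuclideanSpace ℝ ι} (h : HessianBoundAt g D v) :
    DifferentiableAt ℝ (fderiv ℝ g) v :=
  (h.1.fderiv_right (m := 1) (by norm_num)).differentiableAt (by norm_num)

/-- Mean value inequality twice: once for the derivative along `h`, once for the function y ↦ g(y +
h) - g(y). All points used lie on the segment from `x` to `x + 2h`. -/
lemma abs_second_difference_le {x h : EuclideanSpace ℝ ι}
    (hgood : ∀ t ∈ Set.Icc (0 : ℝ) 2, HessianBoundAt g D (x + t • h)) :
    |(g (x + h + h) - g (x + h)) - (g (x + h) - g x)| ≤ D * ‖h‖ ^ 2 := by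
  have hseg : ∀ y ∈ segment ℝ x (x + h), ∃ t ∈ Set.Icc (0 : ℝ) 1, y = x + t • h := by
    intro y hy
    rw [segment_eq_image'] at hy
    obtain ⟨t, ht, rfl⟩ := hy
    exact ⟨t, ht, by simp⟩
  have h1 : ∀ y ∈ segment ℝ x (x + h), ∀ z ∈ segment ℝ y (y + h), HessianBoundAt g D z := by
    intro y hy z hz
    obtain ⟨t, ht, rfl⟩ := hseg y hy
    rw [segment_eq_image'] at hz
    obtain ⟨s, hs, rfl⟩ := hz
    have e1 : x + t • h + s • (x + t • h + h - (x + t • h)) = x + (t + s) • h := by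
      rw [add_sub_cancel_left, add_smul, add_assoc]
    simp only [e1]
    exact hgood _ ⟨by linarith [ht.1, hs.1], by linarith [ht.2, hs.2]⟩
  have hD : ∀ y ∈ segment ℝ x (x + h),
      ‖fderiv ℝ g (y + h) - fderiv ℝ g y‖ ≤ D * ‖h‖ := by
    intro y hy
    have := (convex_segment (𝕜 := ℝ) y (y + h)).norm_image_sub_le_of_norm_fderiv_le (𝕜 := ℝ)
      (f := fderiv ℝ g) (C := D)
      (fun z hz => (h1 y hy z hz).differentiableAt_fderiv) (fun z hz => (h1 y hy z hz).2.le)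
      (left_mem_segment ℝ _ _) (right_mem_segment ℝ _ _)
    simpa using this
  have hd : ∀ y ∈ segment ℝ x (x + h), HasFDerivAt (fun y => g (y + h) - g y)
      (fderiv ℝ g (y + h) - fderiv ℝ g y) y := by
    intro y hy
    have k1 := (h1 y hy _ (right_mem_segment ℝ _ _)).differentiableAt.hasFDerivAt
    have k2 := (h1 y hy _ (left_mem_segment ℝ _ _)).differentiableAt.hasFDerivAt
    have k3 : HasFDerivAt (fun y => g (y + h)) (fderiv ℝ g (y + h)) y :=
      (hasFDerivAt_comp_add_right h).2 k1
    exact k3.sub k2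
  have := (convex_segment (𝕜 := ℝ) x (x + h)).norm_image_sub_le_of_norm_hasFDerivWithin_le (𝕜 := ℝ)
    (C := D * ‖h‖) (fun y hy => (hd y hy).hasFDerivWithinAt) hD
    (left_mem_segment ℝ _ _) (right_mem_segment ℝ _ _)
  simp only [add_sub_cancel_left, Real.norm_eq_abs] at this
  rw [sq, ← mul_assoc]
  exact this

/-- The gap holds on a dense set and its complement of forbidden values is open, so continuity at a
point extends it to that point. -/
lemma eq_zero_or_le_of_continuousAt {c : ℝ} (hgap : ∀ᵐ x, g x = 0 ∨ c ≤ g x)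
    {x : EuclideanSpace ℝ ι} (hx : ContinuousAt g x) : g x = 0 ∨ c ≤ g x := by
  have hcl : IsClosed ({0} ∪ Set.Ici c : Set ℝ) := isClosed_singleton.union isClosed_Ici
  have hd := Measure.dense_of_ae hgap x
  have : g x ∈ closure ({0} ∪ Set.Ici c : Set ℝ) :=
    closure_mono (by rintro _ ⟨y, hy, rfl⟩; exact hy) (mem_closure_image hx hd)
  rw [hcl.closure_eq] at this
  exact this

/-- A continuous function on an interval cannot jump over the forbidden values between `0` and `c`.
-/
lemma forall_eq_zero_or_forall_pos {c : ℝ} (hc : 0 < c) (hgap : ∀ᵐ x, g x = 0 ∨ c ≤ g x)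
    {x h : EuclideanSpace ℝ ι} {M : ℕ}
    (hcont : ∀ t ∈ Set.Icc (0 : ℝ) M, ContinuousAt g (x + t • h)) :
    (∀ j ≤ M, g (x + (j : ℝ) • h) = 0) ∨ ∀ j ≤ M, 0 < g (x + (j : ℝ) • h) := by
  have hval : ∀ t ∈ Set.Icc (0 : ℝ) M, g (x + t • h) = 0 ∨ c ≤ g (x + t • h) := fun t ht =>
    eq_zero_or_le_of_continuousAt hgap (hcont t ht)
  have hmem : ∀ j ≤ M, (j : ℝ) ∈ Set.Icc (0 : ℝ) M := fun j hj =>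
    ⟨by positivity, by exact_mod_cast hj⟩
  by_contra! hcon
  obtain ⟨⟨i, hi, hi'⟩, j, hj, hj'⟩ := hcon
  have hi'' : c ≤ g (x + (i : ℝ) • h) := (hval _ (hmem i hi)).resolve_left hi'
  have hco : ContinuousOn (fun t : ℝ => g (x + t • h)) (Set.Icc 0 M) := fun t ht =>
    (ContinuousAt.comp (f := fun t : ℝ => x + t • h) (g := g) (hcont t ht)
      (by fun_prop)).continuousWithinAt
  obtain ⟨t, ht, hte⟩ := isPreconnected_Icc.intermediate_value (hmem j hj) (hmem i hi) hco
    (show c / 2 ∈ Set.Icc (g (x + (j : ℝ) • h)) (g (x + (i : ℝ) • h)) from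
      ⟨by linarith, by linarith⟩)
  have hte' : g (x + t • h) = c / 2 := hte
  rcases hval t ht with h1 | h1 <;> linarith

lemma volume_pos_le {c : ℝ} (hg : Measurable g) (hc : 0 < c)
    (hgap : ∀ᵐ x, g x = 0 ∨ c ≤ g x) (hint : ∫⁻ x, ENNReal.ofReal (g x) = 1) :
    volume {x | 0 < g x} ≤ ENNReal.ofReal (1 / c) := by
  have hle : volume {x | 0 < g x} ≤ volume {x | ENNReal.ofReal c ≤ ENNReal.ofReal (g x)} := by
    refine measure_mono_ae ?_
    filter_upwards [hgap] with x hx hpos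
    have hpos' : 0 < g x := hpos
    exact ENNReal.ofReal_le_ofReal (hx.resolve_left hpos'.ne')
  refine hle.trans ((meas_ge_le_lintegral_div (by fun_prop) (by simpa using hc)
    ENNReal.ofReal_ne_top).trans ?_)
  rw [hint, ENNReal.ofReal_div_of_pos hc, ENNReal.ofReal_one]

/-- The Lipschitz constant of translations in `L¹`. -/
def translConst (ι : Type*) [Fintype ι] (B D G c : ℝ) : ℝ :=
  2 + (B + D) * (3 * sweepConst ι * G + 2 / c)

lemma two_le_translConst {B D G c : ℝ} (hB : 0 ≤ B) (hD : 0 ≤ D) (hG : 0 ≤ G) (hc : 0 < c) :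
    2 ≤ translConst ι B D G c := by
  have := sweepConst_nonneg (ι := ι)
  unfold translConst
  have : 0 ≤ (B + D) * (3 * sweepConst ι * G + 2 / c) := by positivity
  linarith

/-- Follow `g` along `M` steps of length ‖h‖, a path of total length at most 1. The variation along
it is bounded by a constant times the number of steps meeting the bad set, plus the fraction of its
points in the support. Integrating over the starting point, translation invariance makes every step
contribute equally: the swept bad set has volume O(‖h‖), and the support has volume at most `1 / c`
and receives the weight 1/M. -/
theorem lintegral_abs_translate_sub_le {e : ℕ} (hcard : Fintype.card ι = e + 1) {B G c : ℝ}
    (hg : Measurable g) (hg0 : ∀ x, 0 ≤ g x) (hgB : ∀ᵐ x, g x ≤ B) (hc : 0 < c)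
    (hgap : ∀ᵐ x, g x = 0 ∨ c ≤ g x) (hint : ∫⁻ x, ENNReal.ofReal (g x) = 1)
    (hB : 0 ≤ B) (hD : 0 ≤ D) (hG : 0 ≤ G)
    (hS : Measure.hausdorffMeasure (e : ℝ) {v | ¬ HessianBoundAt g D v} ≤ ENNReal.ofReal G)
    (h : EuclideanSpace ℝ ι) :
    ∫⁻ x, ENNReal.ofReal |g (x + h) - g x| ≤ ENNReal.ofReal (translConst ι B D G c * ‖h‖) := by
  classical
  have hL := two_le_translConst (ι := ι) hB hD hG hc
  rcases eq_or_ne h 0 with rfl | hh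
  · simp
  have hh' : 0 < ‖h‖ := norm_pos_iff.2 hh
  -- Long translations are covered by the trivial bound `2`, the first summand of `translConst`.
  rcases lt_or_ge 1 ‖h‖ with h1 | h1
  · have hm : Measurable fun x => ENNReal.ofReal (g (x + h)) := by fun_prop
    calc ∫⁻ x, ENNReal.ofReal |g (x + h) - g x|
        ≤ ∫⁻ x, (ENNReal.ofReal (g (x + h)) + ENNReal.ofReal (g x)) := by
          refine lintegral_mono fun x => ?_
          rw [← ENNReal.ofReal_add (hg0 _) (hg0 _)]
          refine ENNReal.ofReal_le_ofReal ?_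
          rw [abs_le]; constructor <;> linarith [hg0 (x + h), hg0 x]
      _ = ENNReal.ofReal 2 := by
          rw [lintegral_add_left hm, lintegral_add_right_eq_self (fun x => ENNReal.ofReal (g x)),
            hint]
          norm_num
      _ ≤ _ := ENNReal.ofReal_le_ofReal (by nlinarith)
  set S := {v | ¬ HessianBoundAt g D v} with hSdef
  -- The swept set may fail to be measurable; its measurable hull has the same volume.
  set T := toMeasurable volume (sweep h S) with hT
  have hTm : MeasurableSet T := measurableSet_toMeasurable _ _
  have hTvol : volume T ≤ ENNReal.ofReal (sweepConst ι * ‖h‖ * G) := by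
    rw [hT, measure_toMeasurable, ENNReal.ofReal_mul (mul_nonneg sweepConst_nonneg hh'.le)]
    exact (volume_sweep_le hcard hh S).trans (mul_le_mul_right hS _)
  have hgoodT : ∀ x, x ∉ T → ∀ t ∈ Set.Icc (0 : ℝ) 1, HessianBoundAt g D (x + t • h) := by
    intro x hx t ht
    by_contra hcon
    exact hx (subset_toMeasurable _ _ ⟨t, ht, hcon⟩)
  -- This choice balances both errors: M²‖h‖² ≤ 1 keeps the second differences harmless, and 1/M ≤
  -- 2‖h‖ makes the support term linear in ‖h‖.
  set M := ⌊1 / ‖h‖⌋₊ with hM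
  have hM1 : 1 ≤ M := Nat.le_floor (by rw [Nat.cast_one, le_div_iff₀ hh']; linarith)
  have hM0 : (0 : ℝ) < M := by exact_mod_cast hM1
  have hMh : (M : ℝ) * ‖h‖ ≤ 1 := by
    rw [← le_div_iff₀ hh']; exact Nat.floor_le (by positivity)
  have hMh' : (M : ℝ)⁻¹ ≤ 2 * ‖h‖ := by
    have h2 : 1 / ‖h‖ < M + 1 := Nat.lt_floor_add_one _
    rw [div_lt_iff₀ hh'] at h2
    have h3 : (1 : ℝ) ≤ M := by exact_mod_cast hM1
    rw [inv_le_iff_one_le_mul₀ hM0]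
    nlinarith
  have hstep : ∀ x : EuclideanSpace ℝ ι, ∀ j : ℕ,
      x + ((j + 1 : ℕ) : ℝ) • h = x + (j : ℝ) • h + h := by
    intro x j; push_cast; rw [add_smul, one_smul, add_assoc]
  have hae : ∀ᵐ x, ∀ j : ℕ, g (x + (j : ℝ) • h) ≤ B := by
    rw [ae_all_iff]
    intro j
    exact (measurePreserving_add_right volume ((j : ℝ) • h)).quasiMeasurePreserving.ae hgB
  set V := B + D with hV
  have hV0 : 0 ≤ V := add_nonneg hB hD
  have hpt : ∀ᵐ x, ∑ j ∈ Finset.range M,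
      ENNReal.ofReal |g (x + (j : ℝ) • h + h) - g (x + (j : ℝ) • h)| ≤
      ENNReal.ofReal V * ∑ j ∈ Finset.range M, (3 * T.indicator 1 (x + (j : ℝ) • h) +
        ENNReal.ofReal (M : ℝ)⁻¹ * {x | 0 < g x}.indicator 1 (x + (j : ℝ) • h)) := by
    filter_upwards [hae] with x hx
    have hseq := sum_abs_diff_le' (a := fun j : ℕ => g (x + (j : ℝ) • h)) (B := B)
      (η := D * ‖h‖ ^ 2) (bad := fun j : ℕ => x + (j : ℝ) • h ∈ T) hM1 (by positivity)
      (fun j => ⟨hg0 _, hx j⟩)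
      (by
        intro j _ hj hj'
        have k1 := hgoodT _ hj
        have k2 := hgoodT _ hj'
        have e1 : x + ((j + 2 : ℕ) : ℝ) • h = x + (j : ℝ) • h + h + h := by
          rw [hstep x (j + 1), hstep x j]
        simp only [e1, hstep x j]
        refine abs_second_difference_le fun t ht => ?_
        rcases le_total t 1 with h | h
        · exact k1 t ⟨ht.1, h⟩
        · have := k2 (t - 1) ⟨by linarith, by linarith [ht.2]⟩
          rw [hstep] at this
          convert this using 1
          rw [sub_smul, one_smul]; abel)
      (by
        intro hgood
        refine forall_eq_zero_or_forall_pos hc hgap fun t ht => ?_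
        have hex : ∃ j < M, (j : ℝ) ≤ t ∧ t ≤ j + 1 := by
          rcases eq_or_lt_of_le ht.2 with h | h
          · refine ⟨M - 1, by omega, ?_⟩
            rw [h, Nat.cast_sub hM1]
            constructor <;> simp
          · exact ⟨⌊t⌋₊, (Nat.floor_lt ht.1).2 h, Nat.floor_le ht.1, (Nat.lt_floor_add_one t).le⟩
        obtain ⟨j, hj, hjt, htj⟩ := hex
        have := hgoodT _ (hgood j hj) (t - j) ⟨by linarith, by linarith⟩
        have e1 : x + (j : ℝ) • h + (t - j) • h = x + t • h := by
          rw [add_assoc, ← add_smul]; congr 2; ring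
        rw [e1] at this
        exact this.differentiableAt.continuousAt)
    simp only [hstep] at hseq
    have hV' : B + (M : ℝ) ^ 2 * (D * ‖h‖ ^ 2) ≤ V := by
      have : (M : ℝ) ^ 2 * (D * ‖h‖ ^ 2) = D * ((M : ℝ) * ‖h‖) ^ 2 := by ring
      rw [this]
      have : ((M : ℝ) * ‖h‖) ^ 2 ≤ 1 := pow_le_one₀ (by positivity) hMh
      nlinarith
    have hs0 : ∀ j ∈ Finset.range M, (0 : ℝ) ≤ 3 * (if x + (j : ℝ) • h ∈ T then 1 else 0) +
        (M : ℝ)⁻¹ * if 0 < g (x + (j : ℝ) • h) then 1 else 0 := by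
      intro j _
      split_ifs <;> positivity
    have hseq' := ENNReal.ofReal_le_ofReal (hseq.trans (mul_le_mul_of_nonneg_right hV'
      (Finset.sum_nonneg hs0)))
    rw [ENNReal.ofReal_sum_of_nonneg fun j _ => abs_nonneg _, ENNReal.ofReal_mul hV0,
      ENNReal.ofReal_sum_of_nonneg hs0] at hseq'
    refine hseq'.trans (le_of_eq ?_)
    congr 1
    refine Finset.sum_congr rfl fun j _ => ?_
    simp only [Set.indicator_apply, Set.mem_ofPred_eq, Pi.one_apply]
    split_ifs <;> simp [ENNReal.ofReal_add]
  have hposm : MeasurableSet {x | 0 < g x} := measurableSet_lt measurable_const hg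
  have hI := lintegral_mono_ae hpt
  have hm1 : ∀ j ∈ Finset.range M, Measurable fun x : EuclideanSpace ℝ ι =>
      ENNReal.ofReal |g (x + (j : ℝ) • h + h) - g (x + (j : ℝ) • h)| := fun j _ => by fun_prop
  have hmT : Measurable (T.indicator (1 : EuclideanSpace ℝ ι → ℝ≥0∞)) :=
    measurable_one.indicator hTm
  have hmP : Measurable ({x | 0 < g x}.indicator (1 : EuclideanSpace ℝ ι → ℝ≥0∞)) :=
    measurable_one.indicator hposm
  have hm2 : ∀ j : ℕ, Measurable fun x : EuclideanSpace ℝ ι =>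
      3 * T.indicator (1 : EuclideanSpace ℝ ι → ℝ≥0∞) (x + (j : ℝ) • h) := fun j =>
    (hmT.comp (measurable_add_const _)).const_mul _
  have hm3 : ∀ j : ℕ, Measurable fun x : EuclideanSpace ℝ ι => ENNReal.ofReal (M : ℝ)⁻¹ *
      {x | 0 < g x}.indicator (1 : EuclideanSpace ℝ ι → ℝ≥0∞) (x + (j : ℝ) • h) := fun j =>
    (hmP.comp (measurable_add_const _)).const_mul _
  have hm4 : ∀ j ∈ Finset.range M, Measurable fun x : EuclideanSpace ℝ ι =>
      3 * T.indicator (1 : EuclideanSpace ℝ ι → ℝ≥0∞) (x + (j : ℝ) • h) +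
        ENNReal.ofReal (M : ℝ)⁻¹ *
        {x | 0 < g x}.indicator (1 : EuclideanSpace ℝ ι → ℝ≥0∞) (x + (j : ℝ) • h) := fun j _ =>
    (hm2 j).add (hm3 j)
  rw [lintegral_finsetSum _ hm1, lintegral_const_mul _ (Finset.measurable_sum _ hm4),
    lintegral_finsetSum _ hm4] at hI
  have hl : ∀ j ∈ Finset.range M,
      ∫⁻ x : EuclideanSpace ℝ ι, ENNReal.ofReal |g (x + (j : ℝ) • h + h) - g (x + (j : ℝ) • h)| =
      ∫⁻ x, ENNReal.ofReal |g (x + h) - g x| := fun j _ =>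
    lintegral_add_right_eq_self (fun x => ENNReal.ofReal |g (x + h) - g x|) _
  have hr : ∀ j ∈ Finset.range M, ∫⁻ x : EuclideanSpace ℝ ι,
      (3 * T.indicator (1 : EuclideanSpace ℝ ι → ℝ≥0∞) (x + (j : ℝ) • h) +
        ENNReal.ofReal (M : ℝ)⁻¹ *
        {x | 0 < g x}.indicator (1 : EuclideanSpace ℝ ι → ℝ≥0∞) (x + (j : ℝ) • h)) =
      3 * volume T + ENNReal.ofReal (M : ℝ)⁻¹ * volume {x | 0 < g x} := fun j _ => by
    have k1 : Measurable fun x : EuclideanSpace ℝ ι =>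
        T.indicator (1 : EuclideanSpace ℝ ι → ℝ≥0∞) (x + (j : ℝ) • h) :=
      hmT.comp (measurable_add_const _)
    have k2 : Measurable fun x : EuclideanSpace ℝ ι =>
        {x | 0 < g x}.indicator (1 : EuclideanSpace ℝ ι → ℝ≥0∞) (x + (j : ℝ) • h) :=
      hmP.comp (measurable_add_const _)
    rw [lintegral_add_left (hm2 j), lintegral_const_mul _ k1, lintegral_const_mul _ k2,
      lintegral_add_right_eq_self (T.indicator (1 : EuclideanSpace ℝ ι → ℝ≥0∞)),
      lintegral_add_right_eq_self ({x | 0 < g x}.indicator (1 : EuclideanSpace ℝ ι → ℝ≥0∞)),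
      lintegral_indicator_one hTm, lintegral_indicator_one hposm]
  rw [Finset.sum_congr rfl hl, Finset.sum_congr rfl hr, Finset.sum_const, Finset.sum_const,
    Finset.card_range, nsmul_eq_mul, nsmul_eq_mul, mul_left_comm] at hI
  -- Both sides carry a factor `M` from the sum over steps, and it cancels.
  rw [ENNReal.mul_le_mul_iff_right (by simp; omega) (by simp)] at hI
  refine hI.trans ?_
  have hP := volume_pos_le hg hc hgap hint
  have hsw := sweepConst_nonneg (ι := ι)
  calc ENNReal.ofReal V * (3 * volume T + ENNReal.ofReal (M : ℝ)⁻¹ * volume {x | 0 < g x})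
      ≤ ENNReal.ofReal V * (3 * ENNReal.ofReal (sweepConst ι * ‖h‖ * G) +
        ENNReal.ofReal (2 * ‖h‖) * ENNReal.ofReal (1 / c)) := by gcongr
    _ = ENNReal.ofReal (V * (3 * (sweepConst ι * ‖h‖ * G) + (2 * ‖h‖) * (1 / c))) := by
        rw [ENNReal.ofReal_mul hV0,
          ENNReal.ofReal_add (by positivity : 0 ≤ 3 * (sweepConst ι * ‖h‖ * G)) (by positivity),
          ENNReal.ofReal_mul (by norm_num : (0 : ℝ) ≤ 3),
          ENNReal.ofReal_mul (by positivity : 0 ≤ 2 * ‖h‖), ENNReal.ofReal_ofNat]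
    _ ≤ _ := by
        refine ENNReal.ofReal_le_ofReal ?_
        unfold translConst
        have : V * (3 * (sweepConst ι * ‖h‖ * G) + (2 * ‖h‖) * (1 / c)) =
          ((B + D) * (3 * sweepConst ι * G + 2 / c)) * ‖h‖ := by rw [hV]; ring
        rw [this]
        nlinarith

end Translation

set_option linter.unusedSectionVars false

/-! ### Averages over the balls of a gauge -/

lemma abs_log_sub_log_le {x y m : ℝ} (hm : 0 < m) (hx : m ≤ x) (hy : m ≤ y) :
    |Real.log x - Real.log y| ≤ m⁻¹ * |x - y| := by
  have key : ∀ x y : ℝ, m ≤ x → m ≤ y → Real.log x - Real.log y ≤ m⁻¹ * |x - y| := by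
    intro x y hx hy
    have hx0 : 0 < x := hm.trans_le hx
    have hy0 : 0 < y := hm.trans_le hy
    rw [← Real.log_div hx0.ne' hy0.ne']
    refine (Real.log_le_sub_one_of_pos (by positivity)).trans ?_
    calc x / y - 1 = y⁻¹ * (x - y) := by field_simp
      _ ≤ y⁻¹ * |x - y| := by gcongr; exact le_abs_self _
      _ ≤ m⁻¹ * |x - y| := by gcongr
  rw [abs_le]
  constructor
  · have := key y x hy hx
    rw [abs_sub_comm] at this
    linarith
  · exact key x y hx hy

section Gauge

variable {F : Type*} [MeasureSpace F] [AddCommGroup F]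

/-- A nonnegative function whose sublevel sets have the volumes of balls of dimension `d`. -/
structure IsGauge (ν : F → ℝ) (c : ℝ) (d : ℕ) : Prop where
  measurable : Measurable ν
  nonneg : ∀ u, 0 ≤ ν u
  const_pos : 0 < c
  dim_pos : 0 < d
  volume_le : ∀ r, 0 ≤ r → volume {u | ν u ≤ r} = ENNReal.ofReal (c * r ^ d)

variable {ν : F → ℝ} {c : ℝ} {d : ℕ}

lemma IsGauge.volume_eq (h : IsGauge ν c d) (r : ℝ) : volume {u | ν u = r} = 0 := by
  rcases lt_trichotomy r 0 with hr | rfl | hr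
  · rw [show {u | ν u = r} = ∅ from Set.eq_empty_of_forall_notMem fun u hu => by
      have : ν u = r := hu
      linarith [h.nonneg u]]
    exact measure_empty
  · refine le_antisymm ((measure_mono fun u hu => le_of_eq hu).trans (h.volume_le 0 le_rfl).le) ?_ |>.trans ?_
    all_goals simp [h.dim_pos.ne']
  · have hlt : ∀ᶠ s in nhdsWithin r (Set.Iio r),
        volume {u | ν u = r} ≤ ENNReal.ofReal (c * r ^ d) - ENNReal.ofReal (c * s ^ d) := by
      have h0 : ∀ᶠ s in nhdsWithin r (Set.Iio r), 0 < s := nhdsWithin_le_nhds (lt_mem_nhds hr)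
      filter_upwards [h0, self_mem_nhdsWithin] with s hs hsr
      have hsr' : s < r := hsr
      rw [← h.volume_le r hr.le, ← h.volume_le s hs.le]
      have hsub : {u | ν u = r} ⊆ {u | ν u ≤ r} \ {u | ν u ≤ s} := fun u hu => by
        have hu' : ν u = r := hu
        exact ⟨hu'.le, fun hcon => by
          have : ν u ≤ s := hcon
          linarith⟩
      refine (measure_mono hsub).trans (le_of_eq ?_)
      refine measure_sdiff (fun u hu => ?_) (h.measurable measurableSet_Iic).nullMeasurableSet ?_
      · exact le_trans (show ν u ≤ s from hu) hsr'.le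
      · rw [h.volume_le s hs.le]; exact ENNReal.ofReal_ne_top
    refine le_antisymm (ge_of_tendsto ?_ hlt) zero_le
    have hcont : Continuous fun s : ℝ => ENNReal.ofReal (c * r ^ d - c * s ^ d) :=
      ENNReal.continuous_ofReal.comp (by fun_prop)
    have ht := hcont.tendsto r
    simp only [sub_self, ENNReal.ofReal_zero] at ht
    refine (ht.mono_left nhdsWithin_le_nhds).congr' ?_
    have h0 : ∀ᶠ s in nhdsWithin r (Set.Iio r), 0 < s := nhdsWithin_le_nhds (lt_mem_nhds hr)
    filter_upwards [h0] with s hs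
    rw [ENNReal.ofReal_sub _ (mul_nonneg h.const_pos.le (pow_nonneg hs.le d))]

/-- Decompose into dyadic shells. On each the integrand varies by at most `2 ^ e`, and since `e < d`
the contributions are dominated by a geometric series, whose sum supplies the remaining factor `2`.
-/
lemma IsGauge.lintegral_inv_pow_le (h : IsGauge ν c d) {e : ℕ} (he : e < d) {a : ℝ} (ha : 0 < a) :
    ∫⁻ u, (if ν u ≤ a then (ENNReal.ofReal (ν u ^ e))⁻¹ else 0) ≤
      ENNReal.ofReal (2 ^ (e + 1) * c * a ^ (d - e)) := by
  have hc := h.const_pos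
  have hae : ∀ᵐ u, ν u ≠ 0 := by
    rw [ae_iff]; simpa using h.volume_eq 0
  have hm : ∀ j : ℕ, Measurable fun u => {u | ν u ≤ a * (1 / 2) ^ j}.indicator
      (fun _ => ENNReal.ofReal ((2 ^ (j + 1) / a) ^ e)) u := fun j =>
    measurable_const.indicator (h.measurable measurableSet_Iic)
  calc ∫⁻ u, (if ν u ≤ a then (ENNReal.ofReal (ν u ^ e))⁻¹ else 0)
      ≤ ∫⁻ u, ∑' j : ℕ, {u | ν u ≤ a * (1 / 2) ^ j}.indicator
          (fun _ => ENNReal.ofReal ((2 ^ (j + 1) / a) ^ e)) u := by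
        refine lintegral_mono_ae ?_
        filter_upwards [hae] with u hu
        have hu0 : 0 < ν u := lt_of_le_of_ne (h.nonneg u) hu.symm
        split_ifs with hua
        · obtain ⟨j, hj1, hj2⟩ := exists_nat_pow_near_of_lt_one (x := ν u / a) (y := (1 / 2 : ℝ))
            (by positivity) (by rw [div_le_one ha]; exact hua) (by norm_num) (by norm_num)
          refine le_trans ?_ (ENNReal.le_tsum j)
          have hmem : u ∈ {u | ν u ≤ a * (1 / 2) ^ j} := by
            rw [div_le_iff₀ ha] at hj2
            have : ν u ≤ a * (1 / 2) ^ j := by linarith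
            exact this
          rw [Set.indicator_of_mem hmem, ← ENNReal.ofReal_inv_of_pos (by positivity), ← inv_pow]
          refine ENNReal.ofReal_le_ofReal (pow_le_pow_left₀ (by positivity) ?_ e)
          rw [lt_div_iff₀ ha] at hj1
          rw [inv_le_comm₀ hu0 (by positivity), inv_div]
          calc a / 2 ^ (j + 1) = (1 / 2) ^ (j + 1) * a := by rw [one_div, inv_pow]; ring
            _ ≤ ν u := hj1.le
        · exact zero_le
    _ = ∑' j : ℕ, ENNReal.ofReal ((2 ^ (j + 1) / a) ^ e) * ENNReal.ofReal (c * (a * (1 / 2) ^ j) ^ d) := by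
        rw [lintegral_tsum fun j => (hm j).aemeasurable]
        refine tsum_congr fun j => ?_
        have hs : MeasurableSet {u | ν u ≤ a * (1 / 2) ^ j} := h.measurable measurableSet_Iic
        rw [lintegral_indicator_const hs, h.volume_le _ (by positivity)]
    _ ≤ ∑' j : ℕ, ENNReal.ofReal (2 ^ e * c * a ^ (d - e) * (1 / 2) ^ j) := by
        refine ENNReal.tsum_le_tsum fun j => ?_
        rw [← ENNReal.ofReal_mul (by positivity)]
        refine ENNReal.ofReal_le_ofReal ?_
        obtain ⟨l, rfl⟩ : ∃ l, d = e + (l + 1) := ⟨d - e - 1, by omega⟩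
        rw [show e + (l + 1) - e = l + 1 by omega]
        have e1 : (2 ^ (j + 1) / a) ^ e * (c * (a * (1 / 2) ^ j) ^ (e + (l + 1))) =
            2 ^ e * c * a ^ (l + 1) * (((1 / 2) ^ j) ^ (l + 1)) *
            ((2 ^ j) ^ e * ((1 / 2) ^ j) ^ e) := by
          rw [div_pow, mul_pow a, pow_succ (2 : ℝ) j, mul_pow, pow_add, pow_add ((1 / 2 : ℝ) ^ j)]
          field_simp
        have e2 : ((2 : ℝ) ^ j) ^ e * ((1 / 2) ^ j) ^ e = 1 := by
          rw [← mul_pow, ← mul_pow]; norm_num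
        rw [e1, e2, mul_one]
        gcongr
        rw [pow_succ]
        exact mul_le_of_le_one_left (by positivity) (pow_le_one₀ (by positivity)
          (pow_le_one₀ (by norm_num) (by norm_num)))
    _ = _ := by
        rw [← ENNReal.ofReal_tsum_of_nonneg (fun j => by positivity)
          (summable_geometric_two.mul_left _), tsum_mul_left, tsum_geometric_two]
        congr 1; ring

variable [MeasurableAdd₂ F] [MeasurableSub₂ F] [MeasurableNeg F] [SFinite (volume : Measure F)]
  [(volume : Measure F).IsAddLeftInvariant] {μ : Measure F}

lemma IsGauge.measurable_sub (h : IsGauge ν c d) (ζ : F) : Measurable fun x => ν (x - ζ) :=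
  h.measurable.comp (measurable_id.sub_const ζ)

lemma IsGauge.volume_sub_le (h : IsGauge ν c d) (ζ : F) {r : ℝ} (hr : 0 ≤ r) :
    volume {x | ν (x - ζ) ≤ r} = ENNReal.ofReal (c * r ^ d) := by
  rw [← h.volume_le r hr]
  have := measure_preimage_add_right (volume : Measure F) (-ζ) {u | ν u ≤ r}
  simpa [Set.preimage, sub_eq_add_neg] using this

lemma IsGauge.volume_sub_eq (h : IsGauge ν c d) (ζ : F) (r : ℝ) :
    volume {x | ν (x - ζ) = r} = 0 := by
  have := measure_preimage_add_right (volume : Measure F) (-ζ) {u | ν u = r}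
  rw [h.volume_eq] at this
  simpa [Set.preimage, sub_eq_add_neg] using this

lemma IsGauge.distr_le (h : IsGauge ν c d) {B : ℝ} (hB : 0 ≤ B)
    (hμ : μ ≤ ENNReal.ofReal B • volume) (ζ : F) {r : ℝ} (hr : 0 ≤ r) :
    distr μ (fun x => ν (x - ζ)) r ≤ B * (c * r ^ d) := by
  have hc := h.const_pos
  rw [distr, measureReal_def]
  refine ENNReal.toReal_le_of_le_ofReal (by positivity) ((hμ _).trans ?_)
  rw [Measure.smul_apply, smul_eq_mul, h.volume_sub_le ζ hr, ENNReal.ofReal_mul hB]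

lemma IsGauge.measurable_distr_prod (h : IsGauge ν c d) [SFinite μ] :
    Measurable fun q : F × ℝ => distr μ (fun x => ν (x - q.1)) q.2 := by
  have hset : MeasurableSet {w : (F × ℝ) × F | ν (w.2 - w.1.1) ≤ w.1.2} :=
    measurableSet_le (h.measurable.comp (measurable_snd.sub (measurable_fst.comp measurable_fst)))
      (measurable_snd.comp measurable_fst)
  exact (measurable_measure_prodMk_left hset).ennreal_toReal

lemma IsGauge.measurable_distr_left (h : IsGauge ν c d) [SFinite μ] (r : ℝ) :
    Measurable fun ζ => distr μ (fun x => ν (x - ζ)) r :=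
  (h.measurable_distr_prod (μ := μ)).comp (measurable_id.prodMk measurable_const)

lemma withDensity_le_smul {g : F → ℝ} {B : ℝ} (hgB : ∀ᵐ x, g x ≤ B) :
    volume.withDensity (fun x => ENNReal.ofReal (g x)) ≤
      ENNReal.ofReal B • (volume : Measure F) := by
  rw [← withDensity_const]
  exact withDensity_mono (hgB.mono fun x hx => ENNReal.ofReal_le_ofReal hx)

/-! ### Ball averages controlled by the `L¹` modulus of continuity -/

section Average

variable {g : F → ℝ} {L : ℝ}

/-- The ball mass about `ζ` is the integral of g(ζ + u) over the ball about zero. Subtracting `g ζ`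
inside and exchanging integrals leaves translations by `u` with `ν u ≤ r`. -/
lemma IsGauge.lintegral_abs_distr_sub_le (h : IsGauge ν c d) (hg : Measurable g)
    (hg0 : ∀ x, 0 ≤ g x) (hgi : Integrable g)
    (hμ : μ = volume.withDensity fun x => ENNReal.ofReal (g x))
    (hL : ∀ u, ∫⁻ x, ENNReal.ofReal |g (x + u) - g x| ≤ ENNReal.ofReal (L * ν u)) (hL0 : 0 ≤ L)
    {r : ℝ} (hr : 0 ≤ r) :
    ∫⁻ ζ, ENNReal.ofReal |distr μ (fun x => ν (x - ζ)) r - c * r ^ d * g ζ| ≤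
      ENNReal.ofReal (c * r ^ d * (L * r)) := by
  have hc := h.const_pos
  set B := {u | ν u ≤ r} with hBdef
  have hBm : MeasurableSet B := h.measurable measurableSet_Iic
  have hBv : volume B = ENNReal.ofReal (c * r ^ d) := h.volume_le r hr
  have hBfin : volume B ≠ ∞ := hBv ▸ ENNReal.ofReal_ne_top
  have hpt : ∀ ζ, ENNReal.ofReal |distr μ (fun x => ν (x - ζ)) r - c * r ^ d * g ζ| ≤
      ∫⁻ u in B, ENNReal.ofReal |g (ζ + u) - g ζ| := by
    intro ζ
    have hi : Integrable fun u => g (ζ + u) := hgi.comp_add_left ζ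
    have hBζ : MeasurableSet {x | ν (x - ζ) ≤ r} := h.measurable_sub ζ measurableSet_Iic
    have e1 : distr μ (fun x => ν (x - ζ)) r = ∫ u in B, g (ζ + u) := by
      rw [integral_eq_lintegral_of_nonneg_ae (Filter.Eventually.of_forall fun u => hg0 _)
        hi.aestronglyMeasurable.restrict, distr, measureReal_def, hμ,
        withDensity_apply _ hBζ]
      congr 1
      rw [← lintegral_indicator hBm, ← lintegral_indicator hBζ,
        ← lintegral_add_left_eq_self _ ζ]
      refine lintegral_congr fun u => ?_
      simp only [Set.indicator_apply, hBdef, Set.mem_ofPred_eq, add_sub_cancel_left]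
    have e2 : c * r ^ d * g ζ = ∫ _u in B, g ζ := by
      rw [setIntegral_const, measureReal_def, hBv, ENNReal.toReal_ofReal (by positivity), smul_eq_mul]
    rw [e1, e2, ← integral_sub hi.integrableOn (integrableOn_const hBfin), ← Real.norm_eq_abs,
      ofReal_norm]
    refine (enorm_integral_le_lintegral_enorm _).trans (le_of_eq ?_)
    refine lintegral_congr fun u => ?_
    rw [← ofReal_norm, Real.norm_eq_abs]
  have hmeas : Measurable (Function.uncurry fun ζ u => ENNReal.ofReal |g (ζ + u) - g ζ|) := by
    simp only [Function.uncurry_def]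
    fun_prop
  calc _ ≤ ∫⁻ ζ, ∫⁻ u in B, ENNReal.ofReal |g (ζ + u) - g ζ| := lintegral_mono hpt
    _ = ∫⁻ u in B, ∫⁻ ζ, ENNReal.ofReal |g (ζ + u) - g ζ| :=
        lintegral_lintegral_swap hmeas.aemeasurable
    _ ≤ ∫⁻ _u in B, ENNReal.ofReal (L * r) := by
        refine setLIntegral_mono' hBm fun u hu => (hL u).trans (ENNReal.ofReal_le_ofReal ?_)
        exact mul_le_mul_of_nonneg_left hu hL0
    _ = _ := by
        rw [setLIntegral_const, hBv, ← ENNReal.ofReal_mul (by positivity)]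
        congr 1; ring

lemma IsGauge.lintegral_abs_average_sub_le (h : IsGauge ν c d) (hg : Measurable g)
    (hg0 : ∀ x, 0 ≤ g x) (hgi : Integrable g)
    (hμ : μ = volume.withDensity fun x => ENNReal.ofReal (g x)) {B : ℝ} (hB : 0 ≤ B)
    (hgB : ∀ᵐ x, g x ≤ B)
    (hL : ∀ u, ∫⁻ x, ENNReal.ofReal |g (x + u) - g x| ≤ ENNReal.ofReal (L * ν u)) (hL0 : 0 ≤ L)
    {r : ℝ} (hr : 0 < r) :
    ∫⁻ ζ, ENNReal.ofReal |distr μ (fun x => ν (x - ζ)) r / (c * r ^ d) - g ζ| ∂μ ≤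
      ENNReal.ofReal (B * (L * r)) := by
  have hc := h.const_pos
  have hμB : μ ≤ ENNReal.ofReal B • volume := hμ ▸ withDensity_le_smul hgB
  have hs : ∀ ζ, ENNReal.ofReal |distr μ (fun x => ν (x - ζ)) r / (c * r ^ d) - g ζ| =
      ENNReal.ofReal (c * r ^ d)⁻¹ *
        ENNReal.ofReal |distr μ (fun x => ν (x - ζ)) r - c * r ^ d * g ζ| := by
    intro ζ
    rw [← ENNReal.ofReal_mul (by positivity)]
    congr 1
    have h0 : 0 < c * r ^ d := by positivity
    rw [show distr μ (fun x => ν (x - ζ)) r / (c * r ^ d) - g ζ =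
      (c * r ^ d)⁻¹ * (distr μ (fun x => ν (x - ζ)) r - c * r ^ d * g ζ) by field_simp,
      abs_mul, abs_of_pos (inv_pos.2 h0)]
  calc _ ≤ ∫⁻ ζ, ENNReal.ofReal |distr μ (fun x => ν (x - ζ)) r / (c * r ^ d) - g ζ|
        ∂(ENNReal.ofReal B • volume) := lintegral_mono' hμB le_rfl
    _ = ENNReal.ofReal B * (ENNReal.ofReal (c * r ^ d)⁻¹ *
        ∫⁻ ζ, ENNReal.ofReal |distr μ (fun x => ν (x - ζ)) r - c * r ^ d * g ζ|) := by
        rw [lintegral_smul_measure, smul_eq_mul, lintegral_congr hs,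
          lintegral_const_mul' _ _ ENNReal.ofReal_ne_top]
    _ ≤ ENNReal.ofReal B * (ENNReal.ofReal (c * r ^ d)⁻¹ *
        ENNReal.ofReal (c * r ^ d * (L * r))) := by
        gcongr
        exact h.lintegral_abs_distr_sub_le hg hg0 hgi hμ hL hL0 hr.le
    _ = _ := by
        rw [← ENNReal.ofReal_mul (by positivity), ← ENNReal.ofReal_mul hB]
        congr 1
        field_simp

/-- The points where some dyadic average at a scale below `a` is far from the density. -/
def irregular (ν : F → ℝ) (c : ℝ) (d : ℕ) (μ : Measure F) (g : F → ℝ) (κ a : ℝ) : Set F :=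
  ⋃ j : ℕ, {ζ | c * (a * (1 / 2) ^ (j + 1)) ^ d * κ ≤
    |distr μ (fun x => ν (x - ζ)) (a * (1 / 2) ^ (j + 1)) - c * (a * (1 / 2) ^ (j + 1)) ^ d * g ζ|}

lemma IsGauge.measurableSet_irregular (h : IsGauge ν c d) [SFinite μ] (hg : Measurable g) (κ a : ℝ) :
    MeasurableSet (irregular ν c d μ g κ a) := by
  refine MeasurableSet.iUnion fun j => measurableSet_le measurable_const ?_
  have := h.measurable_distr_left (μ := μ) (a * (1 / 2) ^ (j + 1))
  fun_prop

/-- Markov's inequality at each dyadic scale gives a volume of order the scale, and the scales below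
`a` sum geometrically. Restricting to dyadic scales is what makes this union bound possible. -/
lemma IsGauge.volume_irregular_le (h : IsGauge ν c d) (hg : Measurable g)
    (hg0 : ∀ x, 0 ≤ g x) (hgi : Integrable g)
    (hμ : μ = volume.withDensity fun x => ENNReal.ofReal (g x)) [SFinite μ]
    (hL : ∀ u, ∫⁻ x, ENNReal.ofReal |g (x + u) - g x| ≤ ENNReal.ofReal (L * ν u)) (hL0 : 0 ≤ L)
    {κ a : ℝ} (hκ : 0 < κ) (ha : 0 < a) :
    volume (irregular ν c d μ g κ a) ≤ ENNReal.ofReal (L / κ * a) := by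
  have hc := h.const_pos
  refine (measure_iUnion_le _).trans ?_
  calc _ ≤ ∑' j : ℕ, ENNReal.ofReal (L / κ * a * (1 / 2) * (1 / 2) ^ j) := by
        refine ENNReal.tsum_le_tsum fun j => ?_
        set r := a * (1 / 2) ^ (j + 1) with hr
        have hr0 : 0 < r := by positivity
        have hm : Measurable fun ζ => ENNReal.ofReal
            |distr μ (fun x => ν (x - ζ)) r - c * r ^ d * g ζ| := by
          have := h.measurable_distr_left (μ := μ) r
          fun_prop
        have hsub : {ζ | c * r ^ d * κ ≤ |distr μ (fun x => ν (x - ζ)) r - c * r ^ d * g ζ|} ⊆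
            {ζ | ENNReal.ofReal (c * r ^ d * κ) ≤ ENNReal.ofReal
              |distr μ (fun x => ν (x - ζ)) r - c * r ^ d * g ζ|} := fun ζ hζ =>
          ENNReal.ofReal_le_ofReal hζ
        refine (measure_mono hsub).trans ((meas_ge_le_lintegral_div hm.aemeasurable
          (by simpa using by positivity) ENNReal.ofReal_ne_top).trans ?_)
        refine (ENNReal.div_le_div_right
          (h.lintegral_abs_distr_sub_le hg hg0 hgi hμ hL hL0 hr0.le) _).trans (le_of_eq ?_)
        rw [← ENNReal.ofReal_div_of_pos (by positivity)]
        congr 1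
        have : L / κ * a * (1 / 2) * (1 / 2) ^ j = L / κ * r := by rw [hr, pow_succ]; ring
        rw [this]
        field_simp
    _ = _ := by
        rw [← ENNReal.ofReal_tsum_of_nonneg (fun j => by positivity)
          (summable_geometric_two.mul_left _), tsum_mul_left, tsum_geometric_two]
        congr 1; ring

/-- For any `r ≤ a` some dyadic scale lies between r/2 and r; monotonicity of ball masses passes the
bound up to `r` at the cost of `2 ^ d`. -/
lemma IsGauge.le_distr_of_notMem_irregular (h : IsGauge ν c d) [IsProbabilityMeasure μ] {κ a : ℝ}
    (ha : 0 < a) {ζ : F} (hκ : 0 < κ) (hζ : ζ ∉ irregular ν c d μ g κ a)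
    (hgζ : 2 * κ ≤ g ζ) {r : ℝ} (hr : 0 < r) (hra : r ≤ a) :
    κ / 2 ^ d * (c * r ^ d) ≤ distr μ (fun x => ν (x - ζ)) r := by
  have hc := h.const_pos
  obtain ⟨j, hj1, hj2⟩ := exists_nat_pow_near_of_lt_one (x := r / a) (y := (1 / 2 : ℝ))
    (by positivity) (by rw [div_le_one ha]; exact hra) (by norm_num) (by norm_num)
  rw [lt_div_iff₀ ha] at hj1
  rw [div_le_iff₀ ha] at hj2
  set s := a * (1 / 2) ^ (j + 1) with hs
  have hs0 : 0 < s := by positivity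
  have hsr : s ≤ r := by rw [hs, mul_comm]; exact hj1.le
  have hrs : r / 2 ≤ s := by rw [hs, pow_succ]; linarith
  have hnot : ¬ c * s ^ d * κ ≤ |distr μ (fun x => ν (x - ζ)) s - c * s ^ d * g ζ| := fun hcon =>
    hζ (Set.mem_iUnion.2 ⟨j, hcon⟩)
  push Not at hnot
  have h1 := (abs_lt.1 hnot).1
  have hcs : 0 < c * s ^ d := by positivity
  have h2 : c * s ^ d * κ ≤ distr μ (fun x => ν (x - ζ)) s := by nlinarith
  refine le_trans ?_ (h2.trans (distr_mono μ _ hsr))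
  have h3 : r ^ d / 2 ^ d ≤ s ^ d := by
    rw [← div_pow]; exact pow_le_pow_left₀ (by positivity) hrs d
  calc κ / 2 ^ d * (c * r ^ d) = c * (r ^ d / 2 ^ d) * κ := by ring
    _ ≤ c * s ^ d * κ := by gcongr

lemma IsGauge.abs_log_distr_sub_le (h : IsGauge ν c d) {κ : ℝ} {ζ : F} (hκ : 0 < κ)
    (hgζ : 2 * κ ≤ g ζ) {r : ℝ} (hr : 0 < r)
    (hp : κ / 2 ^ d * (c * r ^ d) ≤ distr μ (fun x => ν (x - ζ)) r) :
    |Real.log (distr μ (fun x => ν (x - ζ)) r) - (Real.log (g ζ * c) + d * Real.log r)| ≤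
      (κ / 2 ^ d)⁻¹ * |distr μ (fun x => ν (x - ζ)) r / (c * r ^ d) - g ζ| := by
  have hc := h.const_pos
  have hg : 0 < g ζ := by linarith
  have hcr : 0 < c * r ^ d := by positivity
  have hp0 : 0 < distr μ (fun x => ν (x - ζ)) r := lt_of_lt_of_le (by positivity) hp
  have hκ2 : κ / 2 ^ d ≤ κ := div_le_self hκ.le (one_le_pow₀ (by norm_num))
  have e1 : Real.log (distr μ (fun x => ν (x - ζ)) r) - (Real.log (g ζ * c) + d * Real.log r) =
      Real.log (distr μ (fun x => ν (x - ζ)) r / (c * r ^ d)) - Real.log (g ζ) := by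
    rw [Real.log_div hp0.ne' hcr.ne', Real.log_mul hg.ne' hc.ne',
      Real.log_mul hc.ne' (pow_pos hr d).ne', Real.log_pow]
    ring
  rw [e1]
  exact abs_log_sub_log_le (by positivity) (by rwa [le_div_iff₀ hcr]) (by linarith)

end Average

end Gauge

/-! ### The `ℓ_p` norms as gauges -/

section CoordNorm

variable {ι : Type*} [Fintype ι]

/-- The `ℓ_p` norm of a real vector. -/
def coordNorm (p : ℝ≥0∞) (v : ι → ℝ) : ℝ := ‖(WithLp.toLp p v : PiLp p (fun _ : ι => ℝ))‖

lemma lpDist_eq_coordNorm (p : ℝ≥0∞) (v w : ι → ℝ) : lpDist p v w = coordNorm p (v - w) := rfl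

/-- The volume of the unit ball of the `ℓ_p` norm. -/
def ballVol (p : ℝ≥0∞) (ι : Type*) [Fintype ι] : ℝ :=
  (volume {v : ι → ℝ | coordNorm p v ≤ 1}).toReal

variable (p : ℝ≥0∞) [Fact (1 ≤ p)]

lemma coordNorm_nonneg (v : ι → ℝ) : 0 ≤ coordNorm p v := norm_nonneg _

lemma norm_le_coordNorm (v : ι → ℝ) : ‖v‖ ≤ coordNorm p v :=
  (pi_norm_le_iff_of_nonneg (coordNorm_nonneg p v)).2 fun i =>
    PiLp.norm_apply_le (WithLp.toLp p v : PiLp p (fun _ : ι => ℝ)) i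

lemma continuous_coordNorm : Continuous (coordNorm p : (ι → ℝ) → ℝ) :=
  (PiLp.continuous_toLp p _).norm

lemma coordNorm_smul (r : ℝ) (v : ι → ℝ) : coordNorm p (r • v) = |r| * coordNorm p v := by
  simp only [coordNorm, WithLp.toLp_smul, norm_smul, Real.norm_eq_abs]

lemma volume_coordNorm_le_one_lt_top : volume {v : ι → ℝ | coordNorm p v ≤ 1} < ∞ := by
  refine (measure_mono fun v hv => ?_).trans_lt
    (measure_closedBall_lt_top (x := (0 : ι → ℝ)) (r := 1))
  rw [mem_closedBall_zero_iff]
  exact (norm_le_coordNorm p v).trans hv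

open scoped Pointwise in
lemma isGauge_coordNorm [Nonempty ι] :
    IsGauge (coordNorm p : (ι → ℝ) → ℝ) (ballVol p ι) (Fintype.card ι) where
  measurable := (continuous_coordNorm p).measurable
  nonneg := coordNorm_nonneg p
  const_pos := by
    refine ENNReal.toReal_pos ?_ (volume_coordNorm_le_one_lt_top p).ne
    have ho : IsOpen {v : ι → ℝ | coordNorm p v < 1} :=
      isOpen_lt (continuous_coordNorm p) continuous_const
    have hne : {v : ι → ℝ | coordNorm p v < 1}.Nonempty := ⟨0, by
      simp [coordNorm]⟩
    have hsub : {v : ι → ℝ | coordNorm p v < 1} ⊆ {v : ι → ℝ | coordNorm p v ≤ 1} :=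
      fun v hv => show coordNorm p v ≤ 1 from le_of_lt hv
    exact ((ho.measure_pos volume hne).trans_le (measure_mono hsub)).ne'
  dim_pos := Fintype.card_pos
  volume_le := by
    intro r hr
    rcases hr.eq_or_lt with rfl | hr
    · have hsub : {v : ι → ℝ | coordNorm p v ≤ 0} ⊆ {0} := fun v hv =>
        norm_le_zero_iff.1 ((norm_le_coordNorm p v).trans hv)
      rw [zero_pow Fintype.card_ne_zero, mul_zero, ENNReal.ofReal_zero]
      exact le_antisymm ((measure_mono hsub).trans (by simp)) zero_le
    · have hset : {v : ι → ℝ | coordNorm p v ≤ r} = r • {v : ι → ℝ | coordNorm p v ≤ 1} := by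
        ext v
        rw [Set.mem_smul_set_iff_inv_smul_mem₀ hr.ne']
        simp only [Set.mem_ofPred_eq, coordNorm_smul, abs_of_pos (inv_pos.2 hr)]
        rw [inv_mul_le_iff₀ hr, mul_one]
      rw [hset, Measure.addHaar_smul_of_nonneg _ hr.le, Module.finrank_fintype_fun_eq_card,
        mul_comm (ballVol p ι), ENNReal.ofReal_mul (by positivity), ballVol,
        ENNReal.ofReal_toReal (volume_coordNorm_le_one_lt_top p).ne]

lemma ballVol_top : ballVol ∞ ι = 2 ^ Fintype.card ι := by
  have hset : {v : ι → ℝ | coordNorm ∞ v ≤ 1} = Metric.closedBall 0 1 := by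
    ext v
    rw [mem_closedBall_zero_iff, Set.mem_ofPred_eq, coordNorm, PiLp.norm_toLp]
  rw [ballVol, hset, Real.volume_pi_closedBall _ zero_le_one, ENNReal.toReal_ofReal (by positivity)]
  norm_num

lemma ballVol_two [Nonempty ι] : ballVol 2 ι = unitBallVol (Fintype.card ι) := by
  have hset : {v : ι → ℝ | coordNorm 2 v ≤ 1} =
      (WithLp.toLp 2) ⁻¹' Metric.closedBall (0 : EuclideanSpace ℝ ι) 1 := by
    ext v
    rw [Set.mem_preimage, mem_closedBall_zero_iff]
    rfl
  rw [ballVol, hset, (PiLp.volume_preserving_toLp ι).measure_preimage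
    measurableSet_closedBall.nullMeasurableSet, EuclideanSpace.volume_closedBall, unitBallVol]
  rw [ENNReal.ofReal_one, one_pow, one_mul, ENNReal.toReal_ofReal (div_nonneg (by positivity)
    (Real.Gamma_nonneg_of_nonneg (by positivity)))]
  congr 1
  rw [Real.sqrt_eq_rpow, ← Real.rpow_natCast, ← Real.rpow_mul Real.pi_pos.le]
  congr 1; ring

lemma coordNorm_two_le (v : ι → ℝ) : coordNorm 2 v ≤ Fintype.card ι * ‖v‖ := by
  rw [coordNorm, EuclideanSpace.norm_eq]
  refine Real.sqrt_le_iff.2 ⟨by positivity, ?_⟩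
  calc ∑ i, ‖v i‖ ^ 2 ≤ ∑ _i : ι, ‖v‖ ^ 2 := by
        gcongr with i; exact norm_le_pi_norm v i
    _ = Fintype.card ι * ‖v‖ ^ 2 := by simp
    _ ≤ (Fintype.card ι * ‖v‖) ^ 2 := by
        rw [mul_pow]
        gcongr
        rcases Nat.eq_zero_or_pos (Fintype.card ι) with h | h
        · simp [h]
        · exact_mod_cast Nat.le_self_pow (by norm_num) _

variable {dx dy : ℕ}

lemma coordNorm_comp_inl_le {ι κ : Type*} [Fintype ι] [Fintype κ] (v : ι ⊕ κ → ℝ) :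
    coordNorm p (v ∘ Sum.inl) ≤ coordNorm p v := by
  rcases eq_or_ne p ∞ with rfl | hp
  · rw [coordNorm, coordNorm, PiLp.norm_toLp, PiLp.norm_toLp]
    exact (pi_norm_le_iff_of_nonneg (norm_nonneg _)).2 fun i => norm_le_pi_norm v _
  · have hp0 : 0 < p.toReal := ENNReal.toReal_pos
      (zero_lt_one.trans_le (Fact.out : (1 : ℝ≥0∞) ≤ p)).ne' hp
    rw [coordNorm, coordNorm, PiLp.norm_eq_sum hp0, PiLp.norm_eq_sum hp0]
    refine Real.rpow_le_rpow (by positivity) ?_ (by positivity)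
    simp only [Fintype.sum_sum_type, Function.comp_apply]
    exact le_add_of_nonneg_right (by positivity)

lemma coordNorm_comp_inr_le {ι κ : Type*} [Fintype ι] [Fintype κ] (v : ι ⊕ κ → ℝ) :
    coordNorm p (v ∘ Sum.inr) ≤ coordNorm p v := by
  rcases eq_or_ne p ∞ with rfl | hp
  · rw [coordNorm, coordNorm, PiLp.norm_toLp, PiLp.norm_toLp]
    exact (pi_norm_le_iff_of_nonneg (norm_nonneg _)).2 fun i => norm_le_pi_norm v _
  · have hp0 : 0 < p.toReal := ENNReal.toReal_pos
      (zero_lt_one.trans_le (Fact.out : (1 : ℝ≥0∞) ≤ p)).ne' hp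
    rw [coordNorm, coordNorm, PiLp.norm_eq_sum hp0, PiLp.norm_eq_sum hp0]
    refine Real.rpow_le_rpow (by positivity) ?_ (by positivity)
    simp only [Fintype.sum_sum_type, Function.comp_apply]
    exact le_add_of_nonneg_left (by positivity)

lemma coordNorm_fst_le (z : (Fin dx → ℝ) × (Fin dy → ℝ)) :
    coordNorm p z.1 ≤ coordNorm p (joint z) := coordNorm_comp_inl_le p (joint z)

lemma coordNorm_snd_le (z : (Fin dx → ℝ) × (Fin dy → ℝ)) :
    coordNorm p z.2 ≤ coordNorm p (joint z) := coordNorm_comp_inr_le p (joint z)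

lemma joint_sub (z w : (Fin dx → ℝ) × (Fin dy → ℝ)) : joint (z - w) = joint z - joint w := by
  funext i; cases i <;> rfl

lemma norm_joint (z : (Fin dx → ℝ) × (Fin dy → ℝ)) : ‖joint z‖ = ‖z‖ := by
  refine le_antisymm ((pi_norm_le_iff_of_nonneg (norm_nonneg _)).2 ?_) ?_
  · rintro (i | i)
    · exact (norm_le_pi_norm z.1 i).trans (norm_fst_le z)
    · exact (norm_le_pi_norm z.2 i).trans (norm_snd_le z)
  · refine norm_prod_le_iff.2 ⟨?_, ?_⟩
    · exact (pi_norm_le_iff_of_nonneg (norm_nonneg _)).2 fun i => norm_le_pi_norm (joint z) (Sum.inl i)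
    · exact (pi_norm_le_iff_of_nonneg (norm_nonneg _)).2 fun i => norm_le_pi_norm (joint z) (Sum.inr i)

lemma measurePreserving_joint :
    MeasurePreserving (joint : (Fin dx → ℝ) × (Fin dy → ℝ) → Fin dx ⊕ Fin dy → ℝ) := by
  have h := (volume_measurePreserving_sumPiEquivProdPi fun _ : Fin dx ⊕ Fin dy => ℝ).symm
  have e : (joint : (Fin dx → ℝ) × (Fin dy → ℝ) → Fin dx ⊕ Fin dy → ℝ) =
      (MeasurableEquiv.sumPiEquivProdPi fun _ : Fin dx ⊕ Fin dy => ℝ).symm := by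
    funext z i
    cases i <;> rfl
  rw [e]
  exact h

lemma isGauge_coordNorm_joint (hdx : 1 ≤ dx) :
    IsGauge (fun z : (Fin dx → ℝ) × (Fin dy → ℝ) => coordNorm p (joint z))
      (ballVol p (Fin dx ⊕ Fin dy)) (dx + dy) := by
  have : Nonempty (Fin dx ⊕ Fin dy) := ⟨Sum.inl ⟨0, by omega⟩⟩
  have h := isGauge_coordNorm (ι := Fin dx ⊕ Fin dy) p
  simp only [Fintype.card_sum, Fintype.card_fin] at h
  refine ⟨h.measurable.comp measurePreserving_joint.measurable, fun z => h.nonneg _, h.const_pos,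
    h.dim_pos, fun r hr => ?_⟩
  have hs : MeasurableSet {v : Fin dx ⊕ Fin dy → ℝ | coordNorm p v ≤ r} :=
    h.measurable measurableSet_Iic
  rw [← h.volume_le r hr, ← measurePreserving_joint.measure_preimage hs.nullMeasurableSet]
  rfl

lemma isGauge_coordNorm_fin {m : ℕ} (hm : 1 ≤ m) :
    IsGauge (coordNorm p : (Fin m → ℝ) → ℝ) (ballVol p (Fin m)) m := by
  have : Nonempty (Fin m) := ⟨⟨0, by omega⟩⟩
  simpa using isGauge_coordNorm (ι := Fin m) p

end CoordNorm

/-! ### Marginals of a density on a product -/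

section Marginal

variable {α β : Type*} [MeasureSpace α] [MeasureSpace β] [SFinite (volume : Measure α)]
  [SFinite (volume : Measure β)] {f : α × β → ℝ}

lemma ae_ofReal_integral_fst (hf0 : ∀ z, 0 ≤ f z) (hfi : Integrable f) :
    ∀ᵐ x, ENNReal.ofReal (∫ y, f (x, y)) = ∫⁻ y, ENNReal.ofReal (f (x, y)) := by
  filter_upwards [hfi.prod_right_ae] with x hx
  exact ofReal_integral_eq_lintegral_ofReal hx (Filter.Eventually.of_forall fun y => hf0 _)

lemma ae_ofReal_integral_snd (hf0 : ∀ z, 0 ≤ f z) (hfi : Integrable f) :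
    ∀ᵐ y, ENNReal.ofReal (∫ x, f (x, y)) = ∫⁻ x, ENNReal.ofReal (f (x, y)) := by
  filter_upwards [hfi.prod_left_ae] with y hy
  exact ofReal_integral_eq_lintegral_ofReal hy (Filter.Eventually.of_forall fun x => hf0 _)

lemma map_fst_withDensity (hf : Measurable f) (hf0 : ∀ z, 0 ≤ f z) (hfi : Integrable f) :
    (volume.withDensity fun z => ENNReal.ofReal (f z)).map Prod.fst =
      volume.withDensity fun x => ENNReal.ofReal (∫ y, f (x, y)) := by
  ext s hs
  rw [Measure.map_apply measurable_fst hs, withDensity_apply _ (measurable_fst hs),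
    withDensity_apply _ hs, ← lintegral_indicator (measurable_fst hs),
    ← lintegral_indicator hs, Measure.volume_eq_prod, lintegral_prod _
      ((hf.ennreal_ofReal.indicator (measurable_fst hs)).aemeasurable)]
  refine lintegral_congr_ae ?_
  filter_upwards [ae_ofReal_integral_fst hf0 hfi] with x hx
  by_cases hxs : x ∈ s
  · simp [hxs, hx]
  · simp [hxs]

lemma map_snd_withDensity (hf : Measurable f) (hf0 : ∀ z, 0 ≤ f z) (hfi : Integrable f) :
    (volume.withDensity fun z => ENNReal.ofReal (f z)).map Prod.snd =
      volume.withDensity fun y => ENNReal.ofReal (∫ x, f (x, y)) := by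
  ext s hs
  rw [Measure.map_apply measurable_snd hs, withDensity_apply _ (measurable_snd hs),
    withDensity_apply _ hs, ← lintegral_indicator (measurable_snd hs),
    ← lintegral_indicator hs, Measure.volume_eq_prod, lintegral_prod_symm _
      ((hf.ennreal_ofReal.indicator (measurable_snd hs)).aemeasurable)]
  refine lintegral_congr_ae ?_
  filter_upwards [ae_ofReal_integral_snd hf0 hfi] with x hx
  by_cases hxs : x ∈ s
  · simp [hxs, hx]
  · simp [hxs]

/-- Integrating out a variable contracts `L¹` distances, so marginals inherit the modulus of the
joint density without any smoothness of their own. -/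
lemma lintegral_abs_integral_fst_translate_le [AddGroup α] [AddGroup β] [MeasurableAdd α]
    [(volume : Measure α).IsAddRightInvariant] [MeasurableAdd (α × β)]
    (hf : Measurable f) (hfi : Integrable f) (h : α) :
    ∫⁻ x, ENNReal.ofReal |(∫ y, f (x + h, y)) - ∫ y, f (x, y)| ≤
      ∫⁻ z, ENNReal.ofReal |f (z + (h, 0)) - f z| := by
  have hm : Measurable fun z => ENNReal.ofReal |f (z + (h, 0)) - f z| := by fun_prop
  rw [Measure.volume_eq_prod, lintegral_prod _ hm.aemeasurable]
  have h1 : ∀ᵐ x, Integrable fun y => f (x, y) := hfi.prod_right_ae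
  have h2 : ∀ᵐ x, Integrable fun y => f (x + h, y) :=
    (measurePreserving_add_right volume h).quasiMeasurePreserving.ae h1
  refine lintegral_mono_ae ?_
  filter_upwards [h1, h2] with x hx1 hx2
  rw [← integral_sub hx2 hx1, ← Real.norm_eq_abs, ofReal_norm]
  refine (enorm_integral_le_lintegral_enorm _).trans (le_of_eq (lintegral_congr fun y => ?_))
  rw [← ofReal_norm, Real.norm_eq_abs, Prod.mk_add_mk, add_zero]

lemma lintegral_abs_integral_snd_translate_le [AddGroup α] [AddGroup β] [MeasurableAdd β]
    [(volume : Measure β).IsAddRightInvariant] [MeasurableAdd (α × β)]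
    (hf : Measurable f) (hfi : Integrable f) (h : β) :
    ∫⁻ y, ENNReal.ofReal |(∫ x, f (x, y + h)) - ∫ x, f (x, y)| ≤
      ∫⁻ z, ENNReal.ofReal |f (z + (0, h)) - f z| := by
  have hm : Measurable fun z => ENNReal.ofReal |f (z + (0, h)) - f z| := by fun_prop
  rw [Measure.volume_eq_prod, lintegral_prod_symm _ hm.aemeasurable]
  have h1 : ∀ᵐ y, Integrable fun x => f (x, y) := hfi.prod_left_ae
  have h2 : ∀ᵐ y, Integrable fun x => f (x, y + h) :=
    (measurePreserving_add_right volume h).quasiMeasurePreserving.ae h1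
  refine lintegral_mono_ae ?_
  filter_upwards [h1, h2] with x hx1 hx2
  rw [← integral_sub hx2 hx1, ← Real.norm_eq_abs, ofReal_norm]
  refine (enorm_integral_le_lintegral_enorm _).trans (le_of_eq (lintegral_congr fun y => ?_))
  rw [← ofReal_norm, Real.norm_eq_abs, Prod.mk_add_mk, add_zero]

end Marginal

/-! ### Consequences of the regularity conditions -/

/-- On the set where 0 < g ≤ c - ε, the exponential is at least exp(-b(c - ε)). The tail bound
therefore makes the mass of that set at most C exp(-εb) for every `b > 1`, hence zero. -/
lemma ae_eq_zero_or_ge_of_tail {α : Type*} [MeasureSpace α] {g : α → ℝ} (hg : Measurable g)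
    (hg0 : ∀ x, 0 ≤ g x) (hgi : Integrable g) {c C : ℝ}
    (h : ∀ b : ℝ, 1 < b → ∫ x, g x * Real.exp (-b * g x) ≤ C * Real.exp (-c * b)) :
    ∀ᵐ x, g x = 0 ∨ c ≤ g x := by
  have hA : ∀ n : ℕ, ∀ᵐ x, ¬ (0 < g x ∧ g x ≤ c - 1 / ((n : ℝ) + 1)) := by
    intro n
    set ε : ℝ := 1 / ((n : ℝ) + 1) with hε
    have hε0 : 0 < ε := by positivity
    set A := {x | 0 < g x ∧ g x ≤ c - ε} with hAdef
    have hAm : MeasurableSet A :=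
      (measurableSet_lt measurable_const hg).inter (measurableSet_le hg measurable_const)
    have hle : ∀ b : ℝ, 1 < b → ∫ x in A, g x ≤ C * Real.exp (-(ε * b)) := by
      intro b hb
      have hint : Integrable fun x => g x * Real.exp (-b * g x) := by
        refine hgi.mono' (by fun_prop) (Filter.Eventually.of_forall fun x => ?_)
        rw [Real.norm_of_nonneg (mul_nonneg (hg0 x) (Real.exp_pos _).le)]
        refine mul_le_of_le_one_right (hg0 x) (Real.exp_le_one_iff.2 ?_)
        nlinarith [hg0 x]
      have h1 : ∫ x in A, g x * Real.exp (-b * (c - ε)) ≤ ∫ x, g x * Real.exp (-b * g x) := by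
        refine le_trans ?_ (setIntegral_le_integral hint (s := A)
          (Filter.Eventually.of_forall fun x => mul_nonneg (hg0 x) (Real.exp_pos _).le))
        refine setIntegral_mono_on (hgi.mul_const _).integrableOn hint.integrableOn hAm ?_
        intro x hx
        refine mul_le_mul_of_nonneg_left (Real.exp_le_exp.2 ?_) (hg0 x)
        have := hx.2
        nlinarith
      rw [integral_mul_const] at h1
      have h2 := h1.trans (h b hb)
      have h3 : ∫ x in A, g x ≤ C * Real.exp (-c * b) * Real.exp (b * (c - ε)) := by
        calc ∫ x in A, g x = (∫ x in A, g x) * Real.exp (-b * (c - ε)) * Real.exp (b * (c - ε)) := by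
              rw [mul_assoc, ← Real.exp_add]; simp
          _ ≤ _ := mul_le_mul_of_nonneg_right h2 (Real.exp_pos _).le
      refine h3.trans (le_of_eq ?_)
      rw [mul_assoc, ← Real.exp_add]
      congr 2; ring
    have hlim : Filter.Tendsto (fun b : ℝ => C * Real.exp (-(ε * b))) Filter.atTop (nhds 0) := by
      have : Filter.Tendsto (fun b : ℝ => ε * b) Filter.atTop Filter.atTop :=
        Filter.tendsto_id.const_mul_atTop hε0
      simpa using (Real.tendsto_exp_neg_atTop_nhds_zero.comp this).const_mul C
    have hzero : ∫ x in A, g x = 0 := by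
      refine le_antisymm (ge_of_tendsto hlim ?_) (integral_nonneg hg0)
      filter_upwards [Filter.eventually_gt_atTop 1] with b hb using hle b hb
    rw [setIntegral_eq_zero_iff_of_nonneg_ae (Filter.Eventually.of_forall hg0)
      hgi.integrableOn] at hzero
    have hzero' := (ae_restrict_iff' hAm).1 hzero
    filter_upwards [hzero'] with x hx hxA
    exact hxA.1.ne' (hx hxA)
  filter_upwards [ae_all_iff.2 hA] with x hx
  by_contra! hcon
  have hpos : 0 < g x := lt_of_le_of_ne (hg0 x) hcon.1.symm
  obtain ⟨n, hn⟩ := exists_nat_one_div_lt (sub_pos.2 hcon.2)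
  exact hx n ⟨hpos, by linarith⟩

lemma HessianBoundAt.mono {ι : Type*} [Fintype ι] {g : EuclideanSpace ℝ ι → ℝ} {C C' : ℝ}
    {v : EuclideanSpace ℝ ι} (h : HessianBoundAt g C v) (hC : C ≤ C') : HessianBoundAt g C' v :=
  ⟨h.1, h.2.trans_le hC⟩

/-! ### From the assumptions on the joint density to uniform constants -/

section Joint

variable {dx dy : ℕ} {f : (Fin dx → ℝ) × (Fin dy → ℝ) → ℝ}

/-- The distribution with density `f`. -/
def law (f : (Fin dx → ℝ) × (Fin dy → ℝ) → ℝ) : Measure ((Fin dx → ℝ) × (Fin dy → ℝ)) :=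
  volume.withDensity fun z => ENNReal.ofReal (f z)

/-- The distribution of the first component. -/
def lawX (f : (Fin dx → ℝ) × (Fin dy → ℝ) → ℝ) : Measure (Fin dx → ℝ) :=
  volume.withDensity fun x => ENNReal.ofReal (margX f x)

/-- The distribution of the second component. -/
def lawY (f : (Fin dx → ℝ) × (Fin dy → ℝ) → ℝ) : Measure (Fin dy → ℝ) :=
  volume.withDensity fun y => ENNReal.ofReal (margY f y)

lemma IsDensity.isProbabilityMeasure (h : IsDensity f) : IsProbabilityMeasure (law f) :=
  ⟨by rw [law, withDensity_apply _ MeasurableSet.univ, Measure.restrict_univ, h.lintegral_eq_one]⟩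

lemma IsDensity.integrable (h : IsDensity f) : Integrable f := by
  refine ⟨h.measurable.aestronglyMeasurable, ?_⟩
  rw [hasFiniteIntegral_iff_ofReal (Filter.Eventually.of_forall h.nonneg), h.lintegral_eq_one]
  exact ENNReal.one_lt_top

lemma IsDensity.measurable_margX (h : IsDensity f) : Measurable (margX f) :=
  h.measurable.stronglyMeasurable.integral_prod_right'.measurable

lemma IsDensity.measurable_margY (h : IsDensity f) : Measurable (margY f) :=
  h.measurable.stronglyMeasurable.integral_prod_left'.measurable

lemma IsDensity.margX_nonneg (h : IsDensity f) (x : Fin dx → ℝ) : 0 ≤ margX f x :=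
  integral_nonneg fun _ => h.nonneg _

lemma IsDensity.margY_nonneg (h : IsDensity f) (y : Fin dy → ℝ) : 0 ≤ margY f y :=
  integral_nonneg fun _ => h.nonneg _

lemma IsDensity.map_fst_law (h : IsDensity f) :
    (law f).map Prod.fst = lawX f :=
  map_fst_withDensity h.measurable h.nonneg h.integrable

lemma IsDensity.map_snd_law (h : IsDensity f) :
    (law f).map Prod.snd = lawY f :=
  map_snd_withDensity h.measurable h.nonneg h.integrable

lemma IsDensity.integrable_margX (h : IsDensity f) : Integrable (margX f) :=
  h.integrable.integral_prod_left

lemma IsDensity.integrable_margY (h : IsDensity f) : Integrable (margY f) :=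
  h.integrable.integral_prod_right

/-- The point of the product space with the coordinates of a point of the Euclidean space. -/
def splitCoord (v : EuclideanSpace ℝ (Fin dx ⊕ Fin dy)) : (Fin dx → ℝ) × (Fin dy → ℝ) :=
  (fun i => v (Sum.inl i), fun j => v (Sum.inr j))

lemma measurePreserving_splitCoord :
    MeasurePreserving (splitCoord : EuclideanSpace ℝ (Fin dx ⊕ Fin dy) → _) :=
  (volume_measurePreserving_sumPiEquivProdPi fun _ : Fin dx ⊕ Fin dy => ℝ).comp
    (PiLp.volume_preserving_ofLp (Fin dx ⊕ Fin dy))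

/-- The properties of a density and of its marginals that determine the rate of the bias. -/
structure IsRegular (f : (Fin dx → ℝ) × (Fin dy → ℝ) → ℝ) (c B L : ℝ) : Prop where
  density : IsDensity f
  le_bound : ∀ᵐ z, f z ≤ B
  margX_le : ∀ᵐ x, margX f x ≤ B
  margY_le : ∀ᵐ y, margY f y ≤ B
  ge_bound : ∀ᵐ z ∂law f, c ≤ f z
  margX_ge : ∀ᵐ z ∂law f, c ≤ margX f z.1
  margY_ge : ∀ᵐ z ∂law f, c ≤ margY f z.2
  translate : ∀ u, ∫⁻ z, ENNReal.ofReal |f (z + u) - f z| ≤ ENNReal.ofReal (L * ‖u‖)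

lemma IsRegular.translateX {c B L : ℝ} (h : IsRegular f c B L) (u : Fin dx → ℝ) :
    ∫⁻ x, ENNReal.ofReal |margX f (x + u) - margX f x| ≤ ENNReal.ofReal (L * ‖u‖) := by
  refine (lintegral_abs_integral_fst_translate_le h.density.measurable h.density.integrable u).trans
    ((h.translate (u, 0)).trans (le_of_eq ?_))
  rw [Prod.norm_mk, norm_zero, max_eq_left (norm_nonneg _)]

lemma IsRegular.translateY {c B L : ℝ} (h : IsRegular f c B L) (u : Fin dy → ℝ) :
    ∫⁻ y, ENNReal.ofReal |margY f (y + u) - margY f y| ≤ ENNReal.ofReal (L * ‖u‖) := by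
  refine (lintegral_abs_integral_snd_translate_le h.density.measurable h.density.integrable u).trans
    ((h.translate (0, u)).trans (le_of_eq ?_))
  rw [Prod.norm_mk, norm_zero, max_eq_right (norm_nonneg _)]

lemma IsDensity.ae_margX_pos (h : IsDensity f) : ∀ᵐ z ∂law f, 0 < margX f z.1 := by
  refine ae_of_ae_map (p := fun x => 0 < margX f x) measurable_fst.aemeasurable ?_
  rw [h.map_fst_law, lawX, ae_withDensity_iff h.measurable_margX.ennreal_ofReal]
  exact Filter.Eventually.of_forall fun x hx => by simpa using hx

lemma IsDensity.ae_margY_pos (h : IsDensity f) : ∀ᵐ z ∂law f, 0 < margY f z.2 := by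
  refine ae_of_ae_map (p := fun x => 0 < margY f x) measurable_snd.aemeasurable ?_
  rw [h.map_snd_law, lawY, ae_withDensity_iff h.measurable_margY.ennreal_ofReal]
  exact Filter.Eventually.of_forall fun x hx => by simpa using hx

/-- The gap gives `f ≥ C0` at almost every sample point, and there a conditional density below `E`
forces each marginal to be at least `C0 / E`. The constant `L` comes from the translation estimate
on Euclidean space. -/
theorem exists_isRegular (hdx : 1 ≤ dx) (Ca Cb Cc Cd Ce Cf Cg Ch C0 : ℝ) :
    ∃ c B L : ℝ, 0 < c ∧ c ≤ B ∧ 0 ≤ L ∧ ∀ f : (Fin dx → ℝ) × (Fin dy → ℝ) → ℝ,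
      IsDensity f → RateAssumption f Ca Cb Cc Cd Ce Cf Cg Ch C0 → IsRegular f c B L := by
  -- The constants are chosen before `f`; for nonpositive `C0` no density qualifies, and any values
  -- serve.
  rcases le_or_gt C0 0 with hC0 | hC0
  · exact ⟨1, 1, 0, one_pos, le_rfl, le_rfl, fun f _ h => absurd h.C0_pos (not_lt.2 hC0)⟩
  obtain ⟨e, he⟩ : ∃ e, dx + dy = e + 1 := ⟨dx + dy - 1, by omega⟩
  have hcard : Fintype.card (Fin dx ⊕ Fin dy) = e + 1 := by simpa using he
  set E := max Ce 1 with hE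
  have hE1 : 1 ≤ E := le_max_right _ _
  have hE0 : 0 < E := by linarith
  set c := C0 / E with hc
  have hc0 : 0 < c := by positivity
  have hcC : c ≤ C0 := div_le_self hC0.le hE1
  set B := max (max Ca Cf) c with hB
  have hBa : Ca ≤ B := (le_max_left _ _).trans (le_max_left _ _)
  have hBf : Cf ≤ B := (le_max_right _ _).trans (le_max_left _ _)
  have hB0 : 0 ≤ B := hc0.le.trans (le_max_right _ _)
  set K := translConst (Fin dx ⊕ Fin dy) B (max Cd 0) (max Cg 0) C0 with hK
  have hK0 : 0 ≤ K := by
    linarith [two_le_translConst (ι := Fin dx ⊕ Fin dy) hB0 (le_max_right Cd 0)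
      (le_max_right Cg 0) hC0]
  -- The extra dimension factor converts the Euclidean norm into the supremum norm.
  refine ⟨c, B, K * ((dx + dy : ℕ) : ℝ), hc0, le_max_right _ _, by positivity, fun f hf h => ?_⟩
  have hgap := ae_eq_zero_or_ge_of_tail hf.measurable hf.nonneg hf.integrable h.tail
  have hac : law f ≪ volume := withDensity_absolutelyContinuous _ _
  have hge : ∀ᵐ z ∂law f, C0 ≤ f z := by
    rw [law, ae_withDensity_iff hf.measurable.ennreal_ofReal]
    filter_upwards [hgap] with z hz hz0
    exact hz.resolve_left fun hcon => hz0 (by simp [hcon])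
  refine ⟨hf, h.bounded.mono fun z hz => hz.trans hBa, h.boundedX.mono fun x hx => hx.le.trans hBf,
    h.boundedY.mono fun x hx => hx.le.trans hBf, hge.mono fun z hz => hcC.trans hz, ?_, ?_, ?_⟩
  · filter_upwards [hge, hf.ae_margX_pos, hac.ae_le h.condY] with z h1 h2 h3
    have h4 := (h3 h2).trans_le (le_max_left Ce 1)
    rw [div_lt_iff₀ h2] at h4
    rw [hc, div_le_iff₀ hE0, mul_comm]
    exact h1.trans h4.le
  · filter_upwards [hge, hf.ae_margY_pos, hac.ae_le h.condX] with z h1 h2 h3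
    have h4 := (h3 h2).trans_le (le_max_left Ce 1)
    rw [div_lt_iff₀ h2] at h4
    rw [hc, div_le_iff₀ hE0, mul_comm]
    exact h1.trans h4.le
  · intro u
    have hq := (measurePreserving_splitCoord (dx := dx) (dy := dy)).quasiMeasurePreserving
    have hcomp : onJoint f = f ∘ splitCoord := rfl
    have hS : Measure.hausdorffMeasure (e : ℝ) {v | ¬ HessianBoundAt (onJoint f) (max Cd 0) v} ≤
        ENNReal.ofReal (max Cg 0) := by
      have he' : ((dx : ℝ) + dy - 1) = e := by
        have : ((dx + dy : ℕ) : ℝ) = ((e + 1 : ℕ) : ℝ) := by rw [he]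
        push_cast at this
        linarith
      have hb := h.boundary
      rw [he'] at hb
      refine (measure_mono fun v hv => ?_).trans
        (hb.trans (ENNReal.ofReal_le_ofReal (le_max_left _ _)))
      exact fun hcon => hv (hcon.mono (le_max_left _ _))
    have hint : ∫⁻ v, ENNReal.ofReal (onJoint f v) = 1 := by
      rw [← hf.lintegral_eq_one, hcomp]
      exact measurePreserving_splitCoord.lintegral_comp hf.measurable.ennreal_ofReal
    have hL := lintegral_abs_translate_sub_le hcard (g := onJoint f) (D := max Cd 0) (B := B)
      (G := max Cg 0) (c := C0) (hf.measurable.comp measurePreserving_splitCoord.measurable)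
      (fun v => hf.nonneg _) (hq.ae (h.bounded.mono fun z hz => hz.trans hBa)) hC0 (hq.ae hgap) hint
      hB0 (le_max_right _ _) (le_max_right _ _) hS (WithLp.toLp 2 (joint u))
    have hm : Measurable fun z => ENNReal.ofReal |f (z + u) - f z| := by
      have := hf.measurable
      fun_prop
    calc ∫⁻ z, ENNReal.ofReal |f (z + u) - f z|
        = ∫⁻ v, ENNReal.ofReal |f (splitCoord v + u) - f (splitCoord v)| :=
          (measurePreserving_splitCoord.lintegral_comp hm).symm
      _ ≤ _ := hL
      _ ≤ _ := by
          refine ENNReal.ofReal_le_ofReal ?_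
          rw [mul_assoc]
          refine mul_le_mul_of_nonneg_left ?_ hK0
          have := coordNorm_two_le (joint u)
          rw [norm_joint] at this
          simpa [coordNorm] using this

end Joint

set_option linter.unusedSectionVars false

/-! ### The bias of a local estimate at a regular point -/

lemma distr_map {α β : Type*} [MeasurableSpace α] [MeasurableSpace β] (μ : Measure α) {T : α → β}
    (hT : Measurable T) {s : β → ℝ} (hs : Measurable s) (r : ℝ) :
    distr (μ.map T) s r = distr μ (fun x => s (T x)) r := by
  have hm : MeasurableSet {y | s y ≤ r} := hs measurableSet_Iic
  rw [distr, measureReal_def, Measure.map_apply hT hm]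
  rfl

/-! ### Joint balls compared with balls of lower-dimensional mass growth -/

section Gauge

variable {F : Type*} [MeasureSpace F] [AddCommGroup F] {ν : F → ℝ} {c : ℝ} {d : ℕ}
  [MeasurableAdd₂ F] [MeasurableSub₂ F] [MeasurableNeg F] [SFinite (volume : Measure F)]
  [(volume : Measure F).IsAddLeftInvariant] {μ : Measure F} [IsProbabilityMeasure μ]
  {B a κ : ℝ} {e : ℕ} {s : F → ℝ}

/-- With mass growing at least like r^e for some `e < d`, the reciprocal mass has an integrable
singularity in dimension `d`. Its integral up to radius `a` is of order a^(d-e) ≤ a, the gain that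
makes the counts nearly unbiased. -/
lemma IsGauge.lintegral_inv_le (h : IsGauge ν c d) (hB : 0 ≤ B)
    (hμ : μ ≤ ENNReal.ofReal B • volume) (ζ : F) (he : e < d) (ha : 0 < a) (ha1 : a ≤ 1)
    (hκ : 0 < κ) (hs : ∀ r, 0 < r → r ≤ a → κ * r ^ e ≤ distr μ s r) :
    ∫⁻ x, (if ν (x - ζ) ≤ a then (μ {y | s y ≤ ν (x - ζ)})⁻¹ else 0) ∂μ ≤
      ENNReal.ofReal (B / κ * (2 ^ (e + 1) * c) * a) := by
  have hc := h.const_pos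
  have hae : ∀ᵐ x ∂μ, ν (x - ζ) ≠ 0 := by
    have hac : μ ≪ volume := Measure.absolutelyContinuous_of_le_smul hμ
    have h0 : ∀ᵐ x, ν (x - ζ) ≠ 0 := by
      rw [ae_iff]; simpa using h.volume_sub_eq ζ 0
    exact hac.ae_le h0
  set q : F → ℝ≥0∞ := fun u => if ν u ≤ a then (ENNReal.ofReal (ν u ^ e))⁻¹ else 0 with hq
  calc ∫⁻ x, (if ν (x - ζ) ≤ a then (μ {y | s y ≤ ν (x - ζ)})⁻¹ else 0) ∂μ
      ≤ ∫⁻ x, ENNReal.ofReal κ⁻¹ * q (x - ζ) ∂μ := by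
        refine lintegral_mono_ae ?_
        filter_upwards [hae] with x hx
        simp only [hq]
        split_ifs with hxa
        · have h0 : 0 < ν (x - ζ) := lt_of_le_of_ne (h.nonneg _) hx.symm
          have h1 := hs _ h0 hxa
          rw [ENNReal.ofReal_inv_of_pos hκ, ← ENNReal.mul_inv (Or.inr ENNReal.ofReal_ne_top)
            (Or.inl ENNReal.ofReal_ne_top), ← ENNReal.ofReal_mul hκ.le]
          refine ENNReal.inv_le_inv.2 ?_
          exact (ENNReal.ofReal_le_iff_le_toReal (measure_ne_top _ _)).2 h1
        · exact zero_le
    _ ≤ ∫⁻ x, ENNReal.ofReal κ⁻¹ * q (x - ζ) ∂(ENNReal.ofReal B • volume) :=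
        lintegral_mono' hμ le_rfl
    _ = ENNReal.ofReal B * (ENNReal.ofReal κ⁻¹ * ∫⁻ u, q u) := by
        rw [lintegral_smul_measure, smul_eq_mul, lintegral_const_mul' _ _ ENNReal.ofReal_ne_top,
          lintegral_sub_right_eq_self q]
    _ ≤ ENNReal.ofReal B * (ENNReal.ofReal κ⁻¹ * ENNReal.ofReal (2 ^ (e + 1) * c * a ^ (d - e))) := by
        gcongr
        exact h.lintegral_inv_pow_le he ha
    _ ≤ _ := by
        rw [← ENNReal.ofReal_mul (by positivity), ← ENNReal.ofReal_mul hB]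
        refine ENNReal.ofReal_le_ofReal ?_
        have hpow : a ^ (d - e) ≤ a := pow_le_of_le_one ha.le ha1 (by omega)
        calc B * (κ⁻¹ * (2 ^ (e + 1) * c * a ^ (d - e)))
            = B / κ * (2 ^ (e + 1) * c) * a ^ (d - e) := by rw [div_eq_mul_inv]; ring
          _ ≤ _ := by gcongr

/-- A joint ball is thinner than the corresponding marginal ball by a factor of order r^(d-e) ≤ a.
The power `2 ^ (e + 1)` is inserted so that the constant agrees with that of
`IsGauge.lintegral_inv_le`. -/
lemma IsGauge.distr_le_mul_distr (h : IsGauge ν c d) (hB : 0 ≤ B)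
    (hμ : μ ≤ ENNReal.ofReal B • volume) (ζ : F) (he : e < d) (ha : 0 < a) (ha1 : a ≤ 1)
    (hκ : 0 < κ) (hs : ∀ r, 0 < r → r ≤ a → κ * r ^ e ≤ distr μ s r) {r : ℝ} (hra : r ≤ a) :
    distr μ (fun x => ν (x - ζ)) r ≤ B / κ * (2 ^ (e + 1) * c) * a * distr μ s r := by
  have hc := h.const_pos
  have h0 := distr_nonneg μ s r
  rcases le_or_gt r 0 with hr | hr
  · have := (distr_mono μ (fun x => ν (x - ζ)) hr).trans (h.distr_le hB hμ ζ le_rfl)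
    rw [zero_pow h.dim_pos.ne', mul_zero, mul_zero] at this
    exact this.trans (by positivity)
  · obtain ⟨l, rfl⟩ : ∃ l, d = e + (l + 1) := ⟨d - e - 1, by omega⟩
    have hpow : r ^ (l + 1) ≤ a :=
      (pow_le_of_le_one hr.le (hra.trans ha1) (by omega)).trans hra
    have h2 : (1 : ℝ) ≤ 2 ^ (e + 1) := one_le_pow₀ (by norm_num)
    calc distr μ (fun x => ν (x - ζ)) r ≤ B * (c * r ^ (e + (l + 1))) := h.distr_le hB hμ ζ hr.le
      _ = B / κ * (1 * c) * r ^ (l + 1) * (κ * r ^ e) := by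
          rw [pow_add]; field_simp
      _ ≤ B / κ * (2 ^ (e + 1) * c) * a * distr μ s r := by
          have := hs r hr hra
          gcongr

/-- Substituting `u = x - ζ` makes the radius independent of `ζ`. After exchanging integrals, the
mean over `ζ` at a fixed radius is all that is needed, and this is what the `L¹` estimates provide.
-/
lemma IsGauge.lintegral_lintegral_ball_le (h : IsGauge ν c d)
    (hμ : μ ≤ ENNReal.ofReal B • volume) (ha : 0 ≤ a) {H : F → ℝ → ℝ≥0∞}
    (hH : Measurable (Function.uncurry H)) {M : ℝ≥0∞}
    (hM : ∀ r, 0 < r → r ≤ a → ∫⁻ ζ, H ζ r ∂μ ≤ M) :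
    ∫⁻ ζ, ∫⁻ x, (if ν (x - ζ) ≤ a then H ζ (ν (x - ζ)) else 0) ∂μ ∂μ ≤
      ENNReal.ofReal B * (M * ENNReal.ofReal (c * a ^ d)) := by
  set q : F → F → ℝ≥0∞ := fun ζ u => if ν u ≤ a then H ζ (ν u) else 0 with hq
  have hqm : Measurable (Function.uncurry q) := by
    refine Measurable.ite (h.measurable.comp measurable_snd measurableSet_Iic) ?_ measurable_const
    exact hH.comp (measurable_fst.prodMk (h.measurable.comp measurable_snd))
  have hae : ∀ᵐ u : F, ν u ≠ 0 := by
    rw [ae_iff]; simpa using h.volume_eq 0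
  calc ∫⁻ ζ, ∫⁻ x, (if ν (x - ζ) ≤ a then H ζ (ν (x - ζ)) else 0) ∂μ ∂μ
      ≤ ∫⁻ ζ, ENNReal.ofReal B * (∫⁻ u, q ζ u) ∂μ := by
        refine lintegral_mono fun ζ => ?_
        calc _ = ∫⁻ x, q ζ (x - ζ) ∂μ := rfl
          _ ≤ ∫⁻ x, q ζ (x - ζ) ∂(ENNReal.ofReal B • volume) := lintegral_mono' hμ le_rfl
          _ = _ := by
            rw [lintegral_smul_measure, smul_eq_mul, lintegral_sub_right_eq_self (q ζ)]
    _ = ENNReal.ofReal B * ∫⁻ u, ∫⁻ ζ, q ζ u ∂μ := by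
        rw [lintegral_const_mul' _ _ ENNReal.ofReal_ne_top,
          lintegral_lintegral_swap hqm.aemeasurable]
    _ ≤ ENNReal.ofReal B * ∫⁻ u, {u | ν u ≤ a}.indicator (fun _ => M) u := by
        gcongr ENNReal.ofReal B * ?_
        refine lintegral_mono_ae ?_
        filter_upwards [hae] with u hu
        have h0 : 0 < ν u := lt_of_le_of_ne (h.nonneg _) hu.symm
        simp only [hq, Set.indicator_apply, Set.mem_ofPred_eq]
        split_ifs with hua
        · exact hM _ h0 hua
        · simp
    _ = _ := by
        have hs : MeasurableSet {u | ν u ≤ a} := h.measurable measurableSet_Iic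
        rw [lintegral_indicator_const hs, h.volume_le a ha]

end Gauge

/-! ### Good sample points and the bias of a local estimate at them -/

section Joint

instance {m n : ℕ} : (volume : Measure ((Fin m → ℝ) × (Fin n → ℝ))).IsAddLeftInvariant :=
  inferInstanceAs ((volume : Measure (Fin m → ℝ)).prod
    (volume : Measure (Fin n → ℝ))).IsAddLeftInvariant

variable {dx dy : ℕ} (p : ℝ≥0∞) (f : (Fin dx → ℝ) × (Fin dy → ℝ) → ℝ)

/-- The logarithm of the ratio of the density to the product of the marginal densities. -/
def infoDensity (f : (Fin dx → ℝ) × (Fin dy → ℝ) → ℝ) (ζ : (Fin dx → ℝ) × (Fin dy → ℝ)) : ℝ :=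
  Real.log (f ζ) - Real.log (margX f ζ.1) - Real.log (margY f ζ.2)

/-- The points where the averages of `f` or of a marginal over small balls are not reliable. -/
def exceptional (κ a : ℝ) : Set ((Fin dx → ℝ) × (Fin dy → ℝ)) :=
  irregular (fun z => coordNorm p (joint z)) (ballVol p (Fin dx ⊕ Fin dy)) (dx + dy) (law f) f κ a ∪
  (Prod.fst ⁻¹' irregular (coordNorm p) (ballVol p (Fin dx)) dx (lawX f)
    (margX f) κ a ∪
  Prod.snd ⁻¹' irregular (coordNorm p) (ballVol p (Fin dy)) dy (lawY f)
    (margY f) κ a)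

/-- The total deviation of the ball averages at scale `r` from the densities. -/
def deviation (κ : ℝ) (ζ : (Fin dx → ℝ) × (Fin dy → ℝ)) (r : ℝ) : ℝ :=
  (κ / 2 ^ (dx + dy))⁻¹ * |distr (law f) (fun x => coordNorm p (joint (x - ζ))) r /
    (ballVol p (Fin dx ⊕ Fin dy) * r ^ (dx + dy)) - f ζ| +
  (κ / 2 ^ dx)⁻¹ * |distr (lawX f) (fun x => coordNorm p (x - ζ.1)) r /
    (ballVol p (Fin dx) * r ^ dx) - margX f ζ.1| +
  (κ / 2 ^ dy)⁻¹ * |distr (lawY f) (fun x => coordNorm p (x - ζ.2)) r /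
    (ballVol p (Fin dy) * r ^ dy) - margY f ζ.2|

/-- The constant in the bounds for the neighbour counts in the marginal spaces. -/
def countConst (p : ℝ≥0∞) (dx dy : ℕ) (B κ : ℝ) : ℝ :=
  B / (κ / 2 ^ dx * ballVol p (Fin dx)) * (2 ^ (dx + 1) * ballVol p (Fin dx ⊕ Fin dy)) +
  B / (κ / 2 ^ dy * ballVol p (Fin dy)) * (2 ^ (dy + 1) * ballVol p (Fin dx ⊕ Fin dy))

variable {p f} [Fact (1 ≤ p)] {c B L : ℝ}

lemma IsRegular.law_le (h : IsRegular f c B L) : law f ≤ ENNReal.ofReal B • volume :=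
  withDensity_le_smul h.le_bound

lemma IsRegular.lawX_le (h : IsRegular f c B L) :
    lawX f ≤ ENNReal.ofReal B • volume :=
  withDensity_le_smul h.margX_le

lemma IsRegular.lawY_le (h : IsRegular f c B L) :
    lawY f ≤ ENNReal.ofReal B • volume :=
  withDensity_le_smul h.margY_le

lemma IsDensity.isProbabilityMeasure_fst (h : IsDensity f) :
    IsProbabilityMeasure (lawX f) := by
  have := h.isProbabilityMeasure
  rw [← h.map_fst_law]
  exact Measure.isProbabilityMeasure_map measurable_fst.aemeasurable

lemma IsDensity.isProbabilityMeasure_snd (h : IsDensity f) :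
    IsProbabilityMeasure (lawY f) := by
  have := h.isProbabilityMeasure
  rw [← h.map_snd_law]
  exact Measure.isProbabilityMeasure_map measurable_snd.aemeasurable

lemma IsRegular.translate_le (h : IsRegular f c B L) (hL : 0 ≤ L) (u : (Fin dx → ℝ) × (Fin dy → ℝ)) :
    ∫⁻ z, ENNReal.ofReal |f (z + u) - f z| ≤ ENNReal.ofReal (L * coordNorm p (joint u)) := by
  refine (h.translate u).trans (ENNReal.ofReal_le_ofReal (mul_le_mul_of_nonneg_left ?_ hL))
  rw [← norm_joint]
  exact norm_le_coordNorm p _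

lemma IsRegular.translateX_le (h : IsRegular f c B L) (hL : 0 ≤ L) (u : Fin dx → ℝ) :
    ∫⁻ x, ENNReal.ofReal |margX f (x + u) - margX f x| ≤ ENNReal.ofReal (L * coordNorm p u) :=
  (h.translateX u).trans
    (ENNReal.ofReal_le_ofReal (mul_le_mul_of_nonneg_left (norm_le_coordNorm p _) hL))

lemma IsRegular.translateY_le (h : IsRegular f c B L) (hL : 0 ≤ L) (u : Fin dy → ℝ) :
    ∫⁻ x, ENNReal.ofReal |margY f (x + u) - margY f x| ≤ ENNReal.ofReal (L * coordNorm p u) :=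
  (h.translateY u).trans
    (ENNReal.ofReal_le_ofReal (mul_le_mul_of_nonneg_left (norm_le_coordNorm p _) hL))

variable (hdx : 1 ≤ dx) (hdy : 1 ≤ dy)

include hdx hdy

lemma IsDensity.measurableSet_exceptional (h : IsDensity f) (κ a : ℝ) :
    MeasurableSet (exceptional p f κ a) := by
  have := h.isProbabilityMeasure
  have := h.isProbabilityMeasure_fst
  have := h.isProbabilityMeasure_snd
  refine ((isGauge_coordNorm_joint p hdx).measurableSet_irregular h.measurable κ a).union ?_
  exact (measurable_fst ((isGauge_coordNorm_fin p hdx).measurableSet_irregular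
    h.measurable_margX κ a)).union (measurable_snd
    ((isGauge_coordNorm_fin p hdy).measurableSet_irregular h.measurable_margY κ a))

lemma IsRegular.law_exceptional_le (h : IsRegular f c B L) (hB : 0 ≤ B) (hL : 0 ≤ L) {κ a : ℝ}
    (hκ : 0 < κ) (ha : 0 < a) :
    law f (exceptional p f κ a) ≤ ENNReal.ofReal (3 * (B * (L / κ * a))) := by
  have hf := h.density
  have := hf.isProbabilityMeasure
  have := hf.isProbabilityMeasure_fst
  have := hf.isProbabilityMeasure_snd
  have e0 : ∀ q : ℝ, 0 ≤ q → ENNReal.ofReal q + (ENNReal.ofReal q + ENNReal.ofReal q) =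
      ENNReal.ofReal (3 * q) := fun q hq => by
    rw [← ENNReal.ofReal_add hq hq, ← ENNReal.ofReal_add hq (by positivity)]
    congr 1; ring
  have hgx := isGauge_coordNorm_fin p hdx
  have hgy := isGauge_coordNorm_fin p hdy
  rw [← e0 _ (by positivity), ENNReal.ofReal_mul hB]
  refine (measure_union_le _ _).trans (add_le_add ?_
    ((measure_union_le _ _).trans (add_le_add ?_ ?_)))
  · refine (h.law_le _).trans ?_
    rw [Measure.smul_apply, smul_eq_mul]
    gcongr
    exact (isGauge_coordNorm_joint p hdx).volume_irregular_le hf.measurable hf.nonneg hf.integrable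
      rfl (h.translate_le hL) hL hκ ha
  · rw [← Measure.map_apply measurable_fst
      (hgx.measurableSet_irregular hf.measurable_margX κ a), hf.map_fst_law]
    refine (h.lawX_le _).trans ?_
    rw [Measure.smul_apply, smul_eq_mul]
    gcongr
    exact hgx.volume_irregular_le hf.measurable_margX hf.margX_nonneg hf.integrable_margX
      rfl (h.translateX_le hL) hL hκ ha
  · rw [← Measure.map_apply measurable_snd
      (hgy.measurableSet_irregular hf.measurable_margY κ a), hf.map_snd_law]
    refine (h.lawY_le _).trans ?_
    rw [Measure.smul_apply, smul_eq_mul]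
    gcongr
    exact hgy.volume_irregular_le hf.measurable_margY hf.margY_nonneg hf.integrable_margY
      rfl (h.translateY_le hL) hL hκ ha

lemma IsDensity.measurable_deviation (h : IsDensity f) (κ : ℝ) :
    Measurable (Function.uncurry (deviation p f κ)) := by
  have := h.isProbabilityMeasure
  have := h.isProbabilityMeasure_fst
  have := h.isProbabilityMeasure_snd
  have hT₁ : Measurable fun q : ((Fin dx → ℝ) × (Fin dy → ℝ)) × ℝ => (q.1.1, q.2) :=
    (measurable_fst.comp measurable_fst).prodMk measurable_snd
  have hT₂ : Measurable fun q : ((Fin dx → ℝ) × (Fin dy → ℝ)) × ℝ => (q.1.2, q.2) :=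
    (measurable_snd.comp measurable_fst).prodMk measurable_snd
  have h1 := (isGauge_coordNorm_joint (dy := dy) p hdx).measurable_distr_prod (μ := law f)
  have h2 := (isGauge_coordNorm_fin p hdx).measurable_distr_prod (μ := lawX f)
  have h3 := (isGauge_coordNorm_fin p hdy).measurable_distr_prod (μ := lawY f)
  replace h2 := h2.comp hT₁
  replace h3 := h3.comp hT₂
  have h4 := h.measurable
  have h5 := h.measurable_margX
  have h6 := h.measurable_margY
  have m1 : Measurable fun q : ((Fin dx → ℝ) × (Fin dy → ℝ)) × ℝ => f q.1 := h4.comp measurable_fst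
  have m2 : Measurable fun q : ((Fin dx → ℝ) × (Fin dy → ℝ)) × ℝ => margX f q.1.1 :=
    h5.comp (measurable_fst.comp measurable_fst)
  have m3 : Measurable fun q : ((Fin dx → ℝ) × (Fin dy → ℝ)) × ℝ => margY f q.1.2 :=
    h6.comp (measurable_snd.comp measurable_fst)
  have key : ∀ {u v : ((Fin dx → ℝ) × (Fin dy → ℝ)) × ℝ → ℝ} (x y : ℝ) (e : ℕ), Measurable u →
      Measurable v → Measurable fun q => x * |u q / (y * q.2 ^ e) - v q| := fun x y e hu hv =>
    (((hu.div ((measurable_snd.pow_const e).const_mul y)).sub hv).abs).const_mul x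
  exact ((key _ _ _ h1 m1).add (key _ _ _ h2 m2)).add (key _ _ _ h3 m3)

lemma IsRegular.lintegral_deviation_le (h : IsRegular f c B L) (hB : 0 ≤ B) (hL : 0 ≤ L) {κ r : ℝ}
    (hκ : 0 < κ) (hr : 0 < r) :
    ∫⁻ ζ, ENNReal.ofReal (deviation p f κ ζ r) ∂law f ≤ ENNReal.ofReal
      (((κ / 2 ^ (dx + dy))⁻¹ + (κ / 2 ^ dx)⁻¹ + (κ / 2 ^ dy)⁻¹) * (B * (L * r))) := by
  have hf := h.density
  have := hf.isProbabilityMeasure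
  have := hf.isProbabilityMeasure_fst
  have := hf.isProbabilityMeasure_snd
  have hgx := isGauge_coordNorm_fin p hdx
  have hgy := isGauge_coordNorm_fin p hdy
  have hg := isGauge_coordNorm_joint (dy := dy) p hdx
  have k1 := hg.lintegral_abs_average_sub_le (μ := law f) hf.measurable hf.nonneg hf.integrable rfl hB h.le_bound
    (h.translate_le hL) hL hr
  have k2 := hgx.lintegral_abs_average_sub_le (μ := lawX f) hf.measurable_margX hf.margX_nonneg
    hf.integrable_margX rfl hB h.margX_le (h.translateX_le hL) hL hr
  have k3 := hgy.lintegral_abs_average_sub_le (μ := lawY f) hf.measurable_margY hf.margY_nonneg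
    hf.integrable_margY rfl hB h.margY_le (h.translateY_le hL) hL hr
  have m1 := hg.measurable_distr_left (μ := law f) r
  have m2 := hgx.measurable_distr_left (μ := lawX f) r
  have m3 := hgy.measurable_distr_left (μ := lawY f) r
  have m4 := hf.measurable
  have m5 := hf.measurable_margX
  have m6 := hf.measurable_margY
  set A1 : (Fin dx → ℝ) × (Fin dy → ℝ) → ℝ≥0∞ := fun ζ => ENNReal.ofReal
    |distr (law f) (fun x => coordNorm p (joint (x - ζ))) r /
    (ballVol p (Fin dx ⊕ Fin dy) * r ^ (dx + dy)) - f ζ| with hA1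
  set A2 : (Fin dx → ℝ) → ℝ≥0∞ := fun ζ => ENNReal.ofReal
    |distr (lawX f) (fun x => coordNorm p (x - ζ)) r /
    (ballVol p (Fin dx) * r ^ dx) - margX f ζ| with hA2
  set A3 : (Fin dy → ℝ) → ℝ≥0∞ := fun ζ => ENNReal.ofReal
    |distr (lawY f) (fun x => coordNorm p (x - ζ)) r /
    (ballVol p (Fin dy) * r ^ dy) - margY f ζ| with hA3
  have hA1m : Measurable A1 := by fun_prop
  have hA2m : Measurable A2 := by fun_prop
  have hA3m : Measurable A3 := by fun_prop
  have k2' : ∫⁻ ζ, A2 ζ.1 ∂law f ≤ ENNReal.ofReal (B * (L * r)) := by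
    rwa [← hf.map_fst_law, lintegral_map hA2m measurable_fst] at k2
  have k3' : ∫⁻ ζ, A3 ζ.2 ∂law f ≤ ENNReal.ofReal (B * (L * r)) := by
    rwa [← hf.map_snd_law, lintegral_map hA3m measurable_snd] at k3
  have hpt : ∀ ζ, ENNReal.ofReal (deviation p f κ ζ r) =
      ENNReal.ofReal (κ / 2 ^ (dx + dy))⁻¹ * A1 ζ + ENNReal.ofReal (κ / 2 ^ dx)⁻¹ * A2 ζ.1 +
        ENNReal.ofReal (κ / 2 ^ dy)⁻¹ * A3 ζ.2 := fun ζ => by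
    rw [deviation, ENNReal.ofReal_add (by positivity) (by positivity),
      ENNReal.ofReal_add (by positivity) (by positivity), ENNReal.ofReal_mul (by positivity),
      ENNReal.ofReal_mul (by positivity), ENNReal.ofReal_mul (by positivity)]
  have n1 : Measurable fun ζ => ENNReal.ofReal (κ / 2 ^ (dx + dy))⁻¹ * A1 ζ := by fun_prop
  have n2 : Measurable fun ζ : (Fin dx → ℝ) × (Fin dy → ℝ) =>
    ENNReal.ofReal (κ / 2 ^ dx)⁻¹ * A2 ζ.1 := by fun_prop
  have n12 : Measurable fun ζ : (Fin dx → ℝ) × (Fin dy → ℝ) =>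
    ENNReal.ofReal (κ / 2 ^ (dx + dy))⁻¹ * A1 ζ + ENNReal.ofReal (κ / 2 ^ dx)⁻¹ * A2 ζ.1 :=
    n1.add n2
  rw [lintegral_congr hpt, lintegral_add_left n12, lintegral_add_left n1,
    lintegral_const_mul' _ _ ENNReal.ofReal_ne_top, lintegral_const_mul' _ _ ENNReal.ofReal_ne_top,
    lintegral_const_mul' _ _ ENNReal.ofReal_ne_top, ENNReal.ofReal_mul (by positivity),
    ENNReal.ofReal_add (by positivity) (by positivity),
    ENNReal.ofReal_add (by positivity) (by positivity), add_mul, add_mul]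
  gcongr

/-- Off the exceptional set, with the densities at least `c = 2 * (c / 2)`, the three ball masses
are bounded below by powers of the radius. This supplies every hypothesis of the abstract estimate,
and the power laws to compare with are density times ball volume. -/
lemma IsRegular.ofReal_abs_integral_pointEstimate_sub_le (h : IsRegular f c B L) (hc : 0 < c)
    (hB : 0 ≤ B) {φ : ℕ → ℝ} (hφ : LogLike φ) {m k : ℕ} (hk1 : 1 ≤ k) (hk : k ≤ m) {a : ℝ}
    (ha : 0 < a) (ha1 : a ≤ 1) {ζ : (Fin dx → ℝ) × (Fin dy → ℝ)}
    (hζ : ζ ∉ exceptional p f (c / 2) a) (hfζ : c ≤ f ζ) (hXζ : c ≤ margX f ζ.1)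
    (hYζ : c ≤ margY f ζ.2) (hba : countConst p dx dy B (c / 2) * a ≤ 1 / 2)
    (hNa : 1 ≤ ((m : ℝ) + 2) *
      (c / 2 / 2 ^ (dx + dy) * (ballVol p (Fin dx ⊕ Fin dy) * a ^ (dx + dy)))) :
    ENNReal.ofReal |∫ w, pointEstimate φ (digamma k + Real.log (ballVol p (Fin dx) *
        ballVol p (Fin dy) / ballVol p (Fin dx ⊕ Fin dy)) + Real.log ((m : ℝ) + 2)) a k
        (fun x => coordNorm p (joint (x - ζ))) (fun x => coordNorm p (x.1 - ζ.1))
        (fun x => coordNorm p (x.2 - ζ.2)) w ∂(Measure.pi fun _ : Fin (m + 1) => law f) -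
        infoDensity f ζ| ≤
      ENNReal.ofReal (1 / ((m : ℝ) + 2) + (|digamma k| + Real.log ((m : ℝ) + 2) +
        |infoDensity f ζ| + 2) * (2 ^ k * Real.exp (-(((m : ℝ) + 1) * (c / 2 / 2 ^ (dx + dy) *
          (ballVol p (Fin dx ⊕ Fin dy) * a ^ (dx + dy))) / 2))) +
        8 * (countConst p dx dy B (c / 2) * a)) +
      (m + 1) * ∫⁻ x, (if coordNorm p (joint (x - ζ)) ≤ a then
        ENNReal.ofReal (deviation p f (c / 2) ζ (coordNorm p (joint (x - ζ)))) else 0) ∂law f := by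
  have hf := h.density
  have := hf.isProbabilityMeasure
  have := hf.isProbabilityMeasure_fst
  have := hf.isProbabilityMeasure_snd
  have hgx := isGauge_coordNorm_fin p hdx
  have hgy := isGauge_coordNorm_fin p hdy
  have hg := isGauge_coordNorm_joint (dy := dy) p hdx
  have hvx := hgx.const_pos
  have hvy := hgy.const_pos
  have hv := hg.const_pos
  set κ := c / 2 with hκ
  have hκ0 : 0 < κ := by positivity
  set t : (Fin dx → ℝ) × (Fin dy → ℝ) → ℝ := fun x => coordNorm p (joint (x - ζ)) with ht
  set s₁ : (Fin dx → ℝ) × (Fin dy → ℝ) → ℝ := fun x => coordNorm p (x.1 - ζ.1) with hs₁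
  set s₂ : (Fin dx → ℝ) × (Fin dy → ℝ) → ℝ := fun x => coordNorm p (x.2 - ζ.2) with hs₂
  have htm : Measurable t := hg.measurable_sub ζ
  have hsX := hgx.measurable_sub ζ.1
  have hsY := hgy.measurable_sub ζ.2
  have hsm₁ : Measurable s₁ := hsX.comp measurable_fst
  have hsm₂ : Measurable s₂ := hsY.comp measurable_snd
  have hdev := (hf.measurable_deviation (p := p) hdx hdy κ).comp (measurable_prodMk_left (x := ζ))
  have e₁ : ∀ r, distr (lawX f) (fun x => coordNorm p (x - ζ.1)) r =
      distr (law f) s₁ r := by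
    rw [← hf.map_fst_law]; exact distr_map _ measurable_fst hsX
  have e₂ : ∀ r, distr (lawY f) (fun x => coordNorm p (x - ζ.2)) r =
      distr (law f) s₂ r := by
    rw [← hf.map_snd_law]; exact distr_map _ measurable_snd hsY
  simp only [exceptional, Set.mem_union, not_or, Set.mem_preimage] at hζ
  obtain ⟨hζ0, hζ1, hζ2⟩ := hζ
  have hlow : ∀ r, 0 < r → r ≤ a → κ / 2 ^ (dx + dy) *
      (ballVol p (Fin dx ⊕ Fin dy) * r ^ (dx + dy)) ≤ distr (law f) t r := fun r hr hra =>
    hg.le_distr_of_notMem_irregular ha hκ0 hζ0 (by linarith) hr hra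
  have hlow₁ : ∀ r, 0 < r → r ≤ a → κ / 2 ^ dx * (ballVol p (Fin dx) * r ^ dx) ≤
      distr (law f) s₁ r := fun r hr hra => by
    rw [← e₁]
    exact hgx.le_distr_of_notMem_irregular ha hκ0 hζ1 (by linarith) hr hra
  have hlow₂ : ∀ r, 0 < r → r ≤ a → κ / 2 ^ dy * (ballVol p (Fin dy) * r ^ dy) ≤
      distr (law f) s₂ r := fun r hr hra => by
    rw [← e₂]
    exact hgy.le_distr_of_notMem_irregular ha hκ0 hζ2 (by linarith) hr hra
  have hlow₁' : ∀ r, 0 < r → r ≤ a → κ / 2 ^ dx * ballVol p (Fin dx) * r ^ dx ≤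
      distr (law f) s₁ r := fun r hr hra => by
    rw [mul_assoc]; exact hlow₁ r hr hra
  have hlow₂' : ∀ r, 0 < r → r ≤ a → κ / 2 ^ dy * ballVol p (Fin dy) * r ^ dy ≤
      distr (law f) s₂ r := fun r hr hra => by
    rw [mul_assoc]; exact hlow₂ r hr hra
  have hκ₁ : 0 < κ / 2 ^ dx * ballVol p (Fin dx) := by positivity
  have hκ₂ : 0 < κ / 2 ^ dy * ballVol p (Fin dy) := by positivity
  -- One number bounds both the integrals of reciprocal masses and the mass ratios, for both
  -- marginals, so the errors `4 * b` and `4 * ε` merge into the factor `8`.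
  set b := countConst p dx dy B κ * a with hb
  have hb₁le : B / (κ / 2 ^ dx * ballVol p (Fin dx)) *
      (2 ^ (dx + 1) * ballVol p (Fin dx ⊕ Fin dy)) * a ≤ b := by
    rw [hb, countConst, add_mul]
    exact le_add_of_nonneg_right (by positivity)
  have hb₂le : B / (κ / 2 ^ dy * ballVol p (Fin dy)) *
      (2 ^ (dy + 1) * ballVol p (Fin dx ⊕ Fin dy)) * a ≤ b := by
    rw [hb, countConst, add_mul]
    exact le_add_of_nonneg_left (by positivity)
  have hb0 : 0 ≤ b := le_trans (by positivity) hb₁le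
  have hat : ∀ r, law f {x | t x = r} = 0 := fun r =>
    (withDensity_absolutelyContinuous _ _ : law f ≪ volume) (hg.volume_sub_eq ζ r)
  have hτ : (Measure.pi fun _ : Fin (m + 1) => law f).real
      {w | a < kthSmallest k fun l => t (w l)} ≤ 2 ^ k * Real.exp (-(((m : ℝ) + 1) *
        (κ / 2 ^ (dx + dy) * (ballVol p (Fin dx ⊕ Fin dy) * a ^ (dx + dy))) / 2)) := by
    refine (measure_lt_kthSmallest_le (law f) htm (n := m + 1) ha.le).trans ?_
    have := hlow a ha le_rfl
    push_cast
    gcongr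
  have hmain := KSG.ofReal_abs_integral_pointEstimate_sub_le (law f) hφ htm hsm₁ hsm₂
    (fun x => coordNorm_nonneg p _) (fun x => coordNorm_fst_le p (x - ζ))
    (fun x => coordNorm_snd_le p (x - ζ)) hat hk1 hk hb0
    ((hg.lintegral_inv_le hB h.law_le ζ (by omega) ha ha1 hκ₁ hlow₁').trans
      (ENNReal.ofReal_le_ofReal hb₁le))
    ((hg.lintegral_inv_le hB h.law_le ζ (by omega) ha ha1 hκ₂ hlow₂').trans
      (ENNReal.ofReal_le_ofReal hb₂le))
    hb0 hba
    (fun r hra => (hg.distr_le_mul_distr hB h.law_le ζ (by omega) ha ha1 hκ₁ hlow₁' hra).trans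
      (mul_le_mul_of_nonneg_right hb₁le (distr_nonneg _ _ _)))
    (fun r hra => (hg.distr_le_mul_distr hB h.law_le ζ (by omega) ha ha1 hκ₂ hlow₂' hra).trans
      (mul_le_mul_of_nonneg_right hb₂le (distr_nonneg _ _ _)))
    hτ (hNa.trans (mul_le_mul_of_nonneg_left (hlow a ha le_rfl) (by positivity)))
    -- Logarithms of density times unit ball volume; `β` cancels the volumes, which is how the
    -- additive constant of the estimator arises.
    (α := Real.log (f ζ * ballVol p (Fin dx ⊕ Fin dy)))
    (α₁ := Real.log (margX f ζ.1 * ballVol p (Fin dx)))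
    (α₂ := Real.log (margY f ζ.2 * ballVol p (Fin dy)))
    (β := Real.log (ballVol p (Fin dx) * ballVol p (Fin dy) / ballVol p (Fin dx ⊕ Fin dy)))
    (d₁ := dx) (d₂ := dy) (η := deviation p f κ ζ)
    (Λ := (κ / 2 ^ (dx + dy))⁻¹ * (B + f ζ) + (κ / 2 ^ dx)⁻¹ * (B + margX f ζ.1) +
      (κ / 2 ^ dy)⁻¹ * (B + margY f ζ.2))
    hdev
    (by
      intro r hr _
      have hgen : ∀ {q v y : ℝ}, 0 ≤ q → 0 < v → q ≤ B * v → 0 ≤ y → |q / v - y| ≤ B + y := by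
        intro q v y hq hv hqv hy
        have h1 : q / v ≤ B := (div_le_iff₀ hv).2 hqv
        have h2 : 0 ≤ q / v := by positivity
        rw [abs_le]; constructor <;> linarith
      unfold deviation
      gcongr
      · exact hgen (distr_nonneg _ _ _) (by positivity)
          (hg.distr_le hB h.law_le ζ hr.le) (hf.nonneg _)
      · exact hgen (distr_nonneg _ _ _) (by positivity)
          (hgx.distr_le hB h.lawX_le ζ.1 hr.le) (hf.margX_nonneg _)
      · exact hgen (distr_nonneg _ _ _) (by positivity)
          (hgy.distr_le hB h.lawY_le ζ.2 hr.le) (hf.margY_nonneg _))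
    (by
      intro r hr hra
      have k0 := hg.abs_log_distr_sub_le (μ := law f) (g := f) hκ0 (by linarith) hr (hlow r hr hra)
      have k1 := hgx.abs_log_distr_sub_le (μ := lawX f) (g := margX f) (ζ := ζ.1)
        hκ0 (by linarith) hr (by rw [e₁]; exact hlow₁ r hr hra)
      have k2 := hgy.abs_log_distr_sub_le (μ := lawY f) (g := margY f) (ζ := ζ.2)
        hκ0 (by linarith) hr (by rw [e₂]; exact hlow₂ r hr hra)
      rw [e₁] at k1
      rw [e₂] at k2
      rw [deviation, e₁, e₂]
      push_cast at k0
      exact add_le_add (add_le_add k0 k1) k2)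
  have hinfo : Real.log (f ζ * ballVol p (Fin dx ⊕ Fin dy)) -
      Real.log (margX f ζ.1 * ballVol p (Fin dx)) - Real.log (margY f ζ.2 * ballVol p (Fin dy)) +
      Real.log (ballVol p (Fin dx) * ballVol p (Fin dy) / ballVol p (Fin dx ⊕ Fin dy)) =
      infoDensity f ζ := by
    have h0 : 0 < f ζ := hc.trans_le hfζ
    have h1 : 0 < margX f ζ.1 := hc.trans_le hXζ
    have h2 : 0 < margY f ζ.2 := hc.trans_le hYζ
    rw [Real.log_mul h0.ne' hv.ne', Real.log_mul h1.ne' hvx.ne', Real.log_mul h2.ne' hvy.ne',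
      Real.log_div (mul_pos hvx hvy).ne' hv.ne', Real.log_mul hvx.ne' hvy.ne', infoDensity]
    ring
  rw [hinfo] at hmain
  refine hmain.trans (le_of_eq ?_)
  congr 2
  rw [hb]; ring

end Joint

/-! ### The bias of the estimator -/

section Bias

variable {dx dy : ℕ} {p : ℝ≥0∞} {f : (Fin dx → ℝ) × (Fin dy → ℝ) → ℝ} {φ : ℕ → ℝ}

lemma localEstimate_insertNth {n k : ℕ} (A a : ℝ) (i : Fin (n + 1))
    (ζ : (Fin dx → ℝ) × (Fin dy → ℝ)) (w : Fin n → (Fin dx → ℝ) × (Fin dy → ℝ)) :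
    localEstimate p φ A a k (i.insertNth (α := fun _ => (Fin dx → ℝ) × (Fin dy → ℝ)) ζ w) i =
      pointEstimate φ (A + Real.log ((n : ℝ) + 1)) a k
        (fun x => coordNorm p (joint (x - ζ))) (fun x => coordNorm p (x.1 - ζ.1))
        (fun x => coordNorm p (x.2 - ζ.2)) w := by
  simp only [localEstimate, pointEstimate, nX_eq_countLE, nY_eq_countLE, knnDist_eq_kthSmallest,
    neighbours, Fin.insertNth_apply_same, Fin.insertNth_apply_succAbove, lpDist_eq_coordNorm,
    joint_sub]
  push_cast
  rfl

variable [Fact (1 ≤ p)]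

lemma measurable_localEstimate (φ : ℕ → ℝ) {n k : ℕ} (hk : k ≤ n) (A a : ℝ) (i : Fin (n + 1)) :
    Measurable fun z : Fin (n + 1) → (Fin dx → ℝ) × (Fin dy → ℝ) =>
      localEstimate p φ A a k z i := by
  have hpi : ∀ l : Fin (n + 1),
      Measurable fun z : Fin (n + 1) → (Fin dx → ℝ) × (Fin dy → ℝ) => z l := measurable_pi_apply
  have hJ : Measurable (joint : (Fin dx → ℝ) × (Fin dy → ℝ) → Fin dx ⊕ Fin dy → ℝ) :=
    measurePreserving_joint.measurable
  have h1 : ∀ l : Fin n, Measurable fun z : Fin (n + 1) → (Fin dx → ℝ) × (Fin dy → ℝ) =>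
      lpDist p (joint (z (i.succAbove l))) (joint (z i)) := fun l =>
    (continuous_coordNorm p).measurable.comp ((hJ.comp (hpi _)).sub (hJ.comp (hpi _)))
  have h2 : ∀ l : Fin n, Measurable fun z : Fin (n + 1) → (Fin dx → ℝ) × (Fin dy → ℝ) =>
      lpDist p (z (i.succAbove l)).1 (z i).1 := fun l =>
    (continuous_coordNorm p).measurable.comp ((hpi _).fst.sub (hpi _).fst)
  have h3 : ∀ l : Fin n, Measurable fun z : Fin (n + 1) → (Fin dx → ℝ) × (Fin dy → ℝ) =>
      lpDist p (z (i.succAbove l)).2 (z i).2 := fun l =>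
    (continuous_coordNorm p).measurable.comp ((hpi _).snd.sub (hpi _).snd)
  have hR := measurable_kthSmallest (k := k) (by simpa using hk) h1
  have hX := measurable_countLE h2 hR
  have hY := measurable_countLE h3 hR
  have hφ : Measurable φ := measurable_of_countable φ
  simp only [localEstimate, nX_eq_countLE, nY_eq_countLE, knnDist_eq_kthSmallest]
  exact Measurable.ite (measurableSet_le hR measurable_const)
    ((measurable_const.sub (hφ.comp hX)).sub (hφ.comp hY)) measurable_const

lemma measurable_estimator (φ : ℕ → ℝ) {n k : ℕ} (hk : k ≤ n) (A a : ℝ) :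
    Measurable fun z : Fin (n + 1) → (Fin dx → ℝ) × (Fin dy → ℝ) => estimator p φ A a k z := by
  unfold estimator
  exact (Finset.measurable_sum _ fun i _ => measurable_localEstimate φ hk A a i).const_mul _

omit [Fact (1 ≤ p)] in
lemma abs_estimator_le (hφ : LogLike φ) {n k : ℕ} (A a : ℝ)
    (z : Fin (n + 1) → (Fin dx → ℝ) × (Fin dy → ℝ)) :
    |estimator p φ A a k z| ≤ (|A| + 3) * (1 + Real.log ((n : ℝ) + 1)) := by
  have hn : (0 : ℝ) < ((n + 1 : ℕ) : ℝ) := by positivity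
  rw [estimator, abs_mul, abs_of_pos (by positivity), one_div, inv_mul_le_iff₀ hn]
  refine (Finset.abs_sum_le_sum_abs _ _).trans ((Finset.sum_le_card_nsmul _ _ _ fun i _ =>
    abs_localEstimate_le p k z i hφ A a).trans (le_of_eq ?_))
  simp

/-- The expectation of a local estimate, given the location of the sample point. -/
def localMean (p : ℝ≥0∞) (f : (Fin dx → ℝ) × (Fin dy → ℝ) → ℝ) (φ : ℕ → ℝ) (A a : ℝ) (n k : ℕ)
    (ζ : (Fin dx → ℝ) × (Fin dy → ℝ)) : ℝ :=
  ∫ w, pointEstimate φ (A + Real.log ((n : ℝ) + 1)) a k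
    (fun x => coordNorm p (joint (x - ζ))) (fun x => coordNorm p (x.1 - ζ.1))
    (fun x => coordNorm p (x.2 - ζ.2)) w ∂(Measure.pi fun _ : Fin n => law f)

/-- By exchangeability all local estimates have the same mean, so the average is that of a single
one, conditioned on its location. -/
lemma IsDensity.integral_estimator (h : IsDensity f) (hφ : LogLike φ) {n k : ℕ} (hk : k ≤ n)
    (A a : ℝ) : Integrable (localMean p f φ A a n k) (law f) ∧
    ∫ z, estimator p φ A a k z ∂(Measure.pi fun _ : Fin (n + 1) => law f) =
      ∫ ζ, localMean p f φ A a n k ζ ∂law f := by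
  have := h.isProbabilityMeasure
  have hi : ∀ i : Fin (n + 1), Integrable (fun z => localEstimate p φ A a k z i)
      (Measure.pi fun _ : Fin (n + 1) => law f) := fun i =>
    integrable_of_abs_le (measurable_localEstimate φ hk A a i) fun z =>
      abs_localEstimate_le p k z i hφ A a
  have hprod : ∀ i : Fin (n + 1), Integrable (fun q : ((Fin dx → ℝ) × (Fin dy → ℝ)) ×
      (Fin n → (Fin dx → ℝ) × (Fin dy → ℝ)) => localEstimate p φ A a k
        (i.insertNth (α := fun _ => (Fin dx → ℝ) × (Fin dy → ℝ)) q.1 q.2) i)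
      ((law f).prod (Measure.pi fun _ : Fin n => law f)) := fun i =>
    integrable_of_abs_le ((measurable_localEstimate φ hk A a i).comp (measurable_insertNth i))
      fun q => abs_localEstimate_le p k _ i hφ A a
  have hloc : ∀ i : Fin (n + 1), Integrable (localMean p f φ A a n k) (law f) ∧
      ∫ z, localEstimate p φ A a k z i ∂(Measure.pi fun _ : Fin (n + 1) => law f) =
        ∫ ζ, localMean p f φ A a n k ζ ∂law f := fun i => by
    have h1 := (hprod i).integral_prod_left
    have h2 := integral_prod _ (hprod i)
    simp only [localEstimate_insertNth] at h1 h2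
    refine ⟨h1, ?_⟩
    rw [integral_pi_insertNth (law f) i]
    simp only [localEstimate_insertNth]
    exact h2
  refine ⟨(hloc 0).1, ?_⟩
  simp only [estimator]
  rw [integral_const_mul, integral_finsetSum _ fun i _ => hi i,
    Finset.sum_congr rfl fun i _ => (hloc i).2]
  simp only [Finset.sum_const, Finset.card_univ, Fintype.card_fin, nsmul_eq_mul]
  rw [← mul_assoc, one_div, inv_mul_cancel₀ (by positivity), one_mul]

omit [Fact (1 ≤ p)] in
lemma abs_localMean_le (h : IsDensity f) (hφ : LogLike φ) {n k : ℕ} (A a : ℝ)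
    (ζ : (Fin dx → ℝ) × (Fin dy → ℝ)) :
    |localMean p f φ A a n k ζ| ≤ (|A| + 3) * (1 + Real.log ((n : ℝ) + 1)) := by
  have := h.isProbabilityMeasure
  have hb := norm_integral_le_of_norm_le_const (μ := Measure.pi fun _ : Fin n => law f)
    (f := fun w => localEstimate p φ A a k
      ((0 : Fin (n + 1)).insertNth (α := fun _ => (Fin dx → ℝ) × (Fin dy → ℝ)) ζ w) 0)
    (Filter.Eventually.of_forall fun w => abs_localEstimate_le p k _ 0 hφ A a)
  simp only [localEstimate_insertNth] at hb
  simpa [localMean] using hb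

variable {c B L : ℝ}

omit [Fact (1 ≤ p)] in
lemma abs_log_le_of_mem {c B x : ℝ} (hc : 0 < c) (hx : c ≤ x) (hxB : x ≤ B) :
    |Real.log x| ≤ |Real.log c| + |Real.log B| := by
  have h1 := Real.log_le_log hc hx
  have h2 := Real.log_le_log (hc.trans_le hx) hxB
  have h3 := neg_abs_le (Real.log c)
  have h4 := le_abs_self (Real.log B)
  have h5 := abs_nonneg (Real.log c)
  have h6 := abs_nonneg (Real.log B)
  rw [abs_le]; constructor <;> linarith

omit [Fact (1 ≤ p)] in
lemma IsRegular.ae_bounds (h : IsRegular f c B L) : ∀ᵐ ζ ∂law f,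
    (c ≤ f ζ ∧ f ζ ≤ B) ∧ (c ≤ margX f ζ.1 ∧ margX f ζ.1 ≤ B) ∧
      (c ≤ margY f ζ.2 ∧ margY f ζ.2 ≤ B) := by
  have hac : law f ≪ volume := withDensity_absolutelyContinuous _ _
  have hX : ∀ᵐ ζ ∂law f, margX f ζ.1 ≤ B := by
    refine ae_of_ae_map (p := fun x => margX f x ≤ B) measurable_fst.aemeasurable ?_
    rw [h.density.map_fst_law]
    exact (withDensity_absolutelyContinuous _ _ : lawX f ≪ volume).ae_le h.margX_le
  have hY : ∀ᵐ ζ ∂law f, margY f ζ.2 ≤ B := by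
    refine ae_of_ae_map (p := fun x => margY f x ≤ B) measurable_snd.aemeasurable ?_
    rw [h.density.map_snd_law]
    exact (withDensity_absolutelyContinuous _ _ : lawY f ≪ volume).ae_le h.margY_le
  filter_upwards [hac.ae_le h.le_bound, hX, hY, h.ge_bound, h.margX_ge, h.margY_ge] with
    ζ h1 h2 h3 h4 h5 h6 using ⟨⟨h4, h1⟩, ⟨h5, h2⟩, ⟨h6, h3⟩⟩

omit [Fact (1 ≤ p)] in
lemma IsRegular.ae_abs_infoDensity_le (h : IsRegular f c B L) (hc : 0 < c) : ∀ᵐ ζ ∂law f,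
    |infoDensity f ζ| ≤ 3 * (|Real.log c| + |Real.log B|) := by
  filter_upwards [h.ae_bounds] with ζ hζ
  have h1 := abs_le.1 (abs_log_le_of_mem hc hζ.1.1 hζ.1.2)
  have h2 := abs_le.1 (abs_log_le_of_mem hc hζ.2.1.1 hζ.2.1.2)
  have h3 := abs_le.1 (abs_log_le_of_mem hc hζ.2.2.1 hζ.2.2.2)
  rw [infoDensity, abs_le]
  constructor <;> linarith [h1.1, h1.2, h2.1, h2.2, h3.1, h3.2]

omit [Fact (1 ≤ p)] in
lemma integral_mul_log_eq {α : Type*} [MeasureSpace α] {g : α → ℝ} (hg : Measurable g)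
    (hg0 : ∀ x, 0 ≤ g x) : ∫ x, g x * Real.log (g x) =
      ∫ x, Real.log (g x) ∂(volume.withDensity fun x => ENNReal.ofReal (g x)) := by
  rw [integral_withDensity_eq_integral_toReal_smul hg.ennreal_ofReal
    (Filter.Eventually.of_forall fun x => ENNReal.ofReal_lt_top)]
  refine integral_congr_ae (Filter.Eventually.of_forall fun x => ?_)
  simp only [ENNReal.toReal_ofReal (hg0 x), smul_eq_mul]

omit [Fact (1 ≤ p)] in
lemma IsRegular.mutualInfo_eq (h : IsRegular f c B L) (hc : 0 < c) :
    Integrable (infoDensity f) (law f) ∧ mutualInfo f = ∫ ζ, infoDensity f ζ ∂law f := by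
  have hf := h.density
  have := hf.isProbabilityMeasure
  have hm := hf.measurable
  have hmX := hf.measurable_margX
  have hmY := hf.measurable_margY
  have i1 : Integrable (fun ζ => Real.log (f ζ)) (law f) :=
    Integrable.of_bound hm.log.aestronglyMeasurable _ (h.ae_bounds.mono fun ζ hζ =>
      abs_log_le_of_mem hc hζ.1.1 hζ.1.2)
  have i2 : Integrable (fun ζ => Real.log (margX f ζ.1)) (law f) :=
    Integrable.of_bound (hmX.comp measurable_fst).log.aestronglyMeasurable _
      (h.ae_bounds.mono fun ζ hζ => abs_log_le_of_mem hc hζ.2.1.1 hζ.2.1.2)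
  have i3 : Integrable (fun ζ => Real.log (margY f ζ.2)) (law f) :=
    Integrable.of_bound (hmY.comp measurable_snd).log.aestronglyMeasurable _
      (h.ae_bounds.mono fun ζ hζ => abs_log_le_of_mem hc hζ.2.2.1 hζ.2.2.2)
  have i12 : Integrable (fun ζ => Real.log (f ζ) - Real.log (margX f ζ.1)) (law f) := i1.sub i2
  have e2 : ∫ x, margX f x * Real.log (margX f x) = ∫ ζ, Real.log (margX f ζ.1) ∂law f := by
    rw [integral_mul_log_eq hmX hf.margX_nonneg]
    change ∫ x, Real.log (margX f x) ∂lawX f = _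
    rw [← hf.map_fst_law, integral_map measurable_fst.aemeasurable hmX.log.aestronglyMeasurable]
  have e3 : ∫ x, margY f x * Real.log (margY f x) = ∫ ζ, Real.log (margY f ζ.2) ∂law f := by
    rw [integral_mul_log_eq hmY hf.margY_nonneg]
    change ∫ x, Real.log (margY f x) ∂lawY f = _
    rw [← hf.map_snd_law, integral_map measurable_snd.aemeasurable hmY.log.aestronglyMeasurable]
  have e1 : ∫ x, f x * Real.log (f x) = ∫ ζ, Real.log (f ζ) ∂law f :=
    integral_mul_log_eq hm hf.nonneg
  refine ⟨i12.sub i3, ?_⟩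
  simp only [infoDensity]
  rw [integral_sub i12 i3, integral_sub i1 i2, mutualInfo, diffEntropy, diffEntropy, diffEntropy,
    e1, e2, e3]
  ring

/-- The constant in the bound for the average of the deviations. -/
def deviationConst (dx dy : ℕ) (κ : ℝ) : ℝ :=
  (κ / 2 ^ (dx + dy))⁻¹ + (κ / 2 ^ dx)⁻¹ + (κ / 2 ^ dy)⁻¹

/-- The three lines of the bound are: a crude logarithmic bound times the probability of the
exceptional set; the errors uniform over good points; and the deviation of ball averages, which is
small only in mean over the location and is summed over the `m + 1` other samples. -/
theorem IsRegular.abs_integral_estimator_sub_le (h : IsRegular f c B L) (hdx : 1 ≤ dx)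
    (hdy : 1 ≤ dy) (hc : 0 < c) (hcB : c ≤ B) (hL : 0 ≤ L) (hφ : LogLike φ) {m k : ℕ} (hk1 : 1 ≤ k)
    (hk : k ≤ m) {a A : ℝ} (ha : 0 < a) (ha1 : a ≤ 1)
    (hA : A = digamma k + Real.log (ballVol p (Fin dx) *
        ballVol p (Fin dy) / ballVol p (Fin dx ⊕ Fin dy)))
    (hba : countConst p dx dy B (c / 2) * a ≤ 1 / 2)
    (hNa : 1 ≤ ((m : ℝ) + 2) *
      (c / 2 / 2 ^ (dx + dy) * (ballVol p (Fin dx ⊕ Fin dy) * a ^ (dx + dy)))) :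
    |∫ z, estimator p φ A a k z ∂(Measure.pi fun _ : Fin (m + 2) => law f) - mutualInfo f| ≤
      ((|A| + 3) * (1 + Real.log ((m : ℝ) + 2)) + 3 * (|Real.log c| + |Real.log B|)) *
        (3 * (B * (L / (c / 2) * a))) +
      (1 / ((m : ℝ) + 2) + (|digamma k| + Real.log ((m : ℝ) + 2) +
        3 * (|Real.log c| + |Real.log B|) + 2) *
          (2 ^ k * Real.exp (-(((m : ℝ) + 1) * (c / 2 / 2 ^ (dx + dy) *
            (ballVol p (Fin dx ⊕ Fin dy) * a ^ (dx + dy))) / 2))) +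
        8 * (countConst p dx dy B (c / 2) * a)) +
      ((m : ℝ) + 1) * (B * (deviationConst dx dy (c / 2) * (B * (L * a)) *
        (ballVol p (Fin dx ⊕ Fin dy) * a ^ (dx + dy)))) := by
  have hf := h.density
  have := hf.isProbabilityMeasure
  have hB : 0 ≤ B := hc.le.trans hcB
  have hg := isGauge_coordNorm_joint (dy := dy) p hdx
  have hv := hg.const_pos
  have hvx := (isGauge_coordNorm_fin p hdx).const_pos
  have hvy := (isGauge_coordNorm_fin p hdy).const_pos
  have hlog : 0 ≤ Real.log ((m : ℝ) + 2) := Real.log_nonneg (by linarith [m.cast_nonneg (α := ℝ)])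
  have hcast : ((m + 1 : ℕ) : ℝ) + 1 = (m : ℝ) + 2 := by push_cast; ring
  set κ := c / 2 with hκ
  have hκ0 : 0 < κ := by positivity
  have hcc : 0 ≤ countConst p dx dy B κ := by unfold countConst; positivity
  have hdc : 0 ≤ deviationConst dx dy κ := by unfold deviationConst; positivity
  set Λ := 3 * (|Real.log c| + |Real.log B|) with hΛ
  have hΛ0 : 0 ≤ Λ := by positivity
  set crude := (|A| + 3) * (1 + Real.log ((m : ℝ) + 2)) + Λ with hcrude
  have hcrude0 : 0 ≤ crude := by positivity
  set τ := 2 ^ k * Real.exp (-(((m : ℝ) + 1) * (κ / 2 ^ (dx + dy) *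
            (ballVol p (Fin dx ⊕ Fin dy) * a ^ (dx + dy))) / 2)) with hτ
  have hτ0 : 0 ≤ τ := by positivity
  set loc := 1 / ((m : ℝ) + 2) + (|digamma k| + Real.log ((m : ℝ) + 2) + Λ + 2) * τ +
        8 * (countConst p dx dy B κ * a) with hloc
  have hloc0 : 0 ≤ loc := by positivity
  obtain ⟨hGi, hGe⟩ := hf.integral_estimator (p := p) hφ (n := m + 1) (k := k) (by omega) A a
  obtain ⟨hIi, hIe⟩ := h.mutualInfo_eq hc
  rw [hGe, hIe, ← integral_sub hGi hIi]
  set J : (Fin dx → ℝ) × (Fin dy → ℝ) → ℝ≥0∞ := fun ζ =>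
    ∫⁻ x, (if coordNorm p (joint (x - ζ)) ≤ a then
        ENNReal.ofReal (deviation p f κ ζ (coordNorm p (joint (x - ζ)))) else 0) ∂law f with hJ
  have hpt : ∀ᵐ ζ ∂law f, ENNReal.ofReal |localMean p f φ A a (m + 1) k ζ - infoDensity f ζ| ≤
      ((exceptional p f κ a).indicator (fun _ => ENNReal.ofReal crude) ζ + ENNReal.ofReal loc) +
        ENNReal.ofReal ((m : ℝ) + 1) * J ζ := by
    filter_upwards [h.ae_bounds, h.ae_abs_infoDensity_le hc] with ζ hζ hi
    -- Nothing is known about ball masses at exceptional points, so there the estimate and its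
    -- target are bounded separately.
    by_cases hex : ζ ∈ exceptional p f κ a
    · rw [Set.indicator_of_mem hex, add_assoc]
      refine le_trans (ENNReal.ofReal_le_ofReal ?_) le_self_add
      refine (abs_sub _ _).trans (add_le_add ?_ hi)
      have := abs_localMean_le (p := p) hf hφ (n := m + 1) (k := k) A a ζ
      rwa [hcast] at this
    · rw [Set.indicator_of_notMem hex, zero_add]
      have hl := h.ofReal_abs_integral_pointEstimate_sub_le hdx hdy hc hB hφ hk1 hk ha ha1 hex
        hζ.1.1 hζ.2.1.1 hζ.2.2.1 hba hNa
      rw [← hA] at hl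
      rw [localMean, hcast]
      refine hl.trans (add_le_add (ENNReal.ofReal_le_ofReal ?_) (le_of_eq ?_))
      · rw [hloc]
        gcongr
      · rw [ENNReal.ofReal_add (by positivity) zero_le_one]
        simp [hJ, hκ]
  have hexm : MeasurableSet (exceptional p f κ a) := hf.measurableSet_exceptional hdx hdy κ a
  have hJle : ∫⁻ ζ, J ζ ∂law f ≤ ENNReal.ofReal (B * (deviationConst dx dy κ * (B * (L * a)) *
        (ballVol p (Fin dx ⊕ Fin dy) * a ^ (dx + dy)))) := by
    have hdm : Measurable (Function.uncurry fun ζ r => ENNReal.ofReal (deviation p f κ ζ r)) :=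
      (hf.measurable_deviation (p := p) hdx hdy κ).ennreal_ofReal
    have := hg.lintegral_lintegral_ball_le h.law_le ha.le hdm
      (M := ENNReal.ofReal (deviationConst dx dy κ * (B * (L * a))))
      (fun r hr hra => (h.lintegral_deviation_le hdx hdy hB hL hκ0 hr).trans
        (ENNReal.ofReal_le_ofReal (by
          unfold deviationConst
          gcongr)))
    rw [ENNReal.ofReal_mul hB, ENNReal.ofReal_mul (by positivity)]
    exact this
  have hm1 : Measurable fun ζ => (exceptional p f κ a).indicator
      (fun _ => ENNReal.ofReal crude) ζ + ENNReal.ofReal loc :=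
    (measurable_const.indicator hexm).add_const _
  have hm2 : Measurable fun ζ => (exceptional p f κ a).indicator
      (fun _ => ENNReal.ofReal crude) ζ := measurable_const.indicator hexm
  have hfinal : ENNReal.ofReal |∫ ζ, localMean p f φ A a (m + 1) k ζ - infoDensity f ζ ∂law f| ≤
      ENNReal.ofReal (crude * (3 * (B * (L / κ * a))) + loc + ((m : ℝ) + 1) *
        (B * (deviationConst dx dy κ * (B * (L * a)) *
        (ballVol p (Fin dx ⊕ Fin dy) * a ^ (dx + dy))))) := by
    calc ENNReal.ofReal |∫ ζ, localMean p f φ A a (m + 1) k ζ - infoDensity f ζ ∂law f|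
        ≤ ∫⁻ ζ, ENNReal.ofReal |localMean p f φ A a (m + 1) k ζ - infoDensity f ζ| ∂law f := by
          rw [← Real.norm_eq_abs, ofReal_norm]
          refine (enorm_integral_le_lintegral_enorm _).trans (le_of_eq (lintegral_congr fun ζ => ?_))
          rw [← ofReal_norm, Real.norm_eq_abs]
      _ ≤ _ := lintegral_mono_ae hpt
      _ = ENNReal.ofReal crude * law f (exceptional p f κ a) + ENNReal.ofReal loc +
          ENNReal.ofReal ((m : ℝ) + 1) * ∫⁻ ζ, J ζ ∂law f := by
          rw [lintegral_add_left hm1, lintegral_add_left hm2, lintegral_indicator_const hexm,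
            lintegral_const_mul' _ _ ENNReal.ofReal_ne_top, lintegral_const, measure_univ, mul_one]
      _ ≤ ENNReal.ofReal crude * ENNReal.ofReal (3 * (B * (L / κ * a))) + ENNReal.ofReal loc +
          ENNReal.ofReal ((m : ℝ) + 1) * ENNReal.ofReal (B * (deviationConst dx dy κ *
            (B * (L * a)) * (ballVol p (Fin dx ⊕ Fin dy) * a ^ (dx + dy)))) := by
          gcongr
          exact h.law_exceptional_le hdx hdy hB hL hκ0 ha
      _ = _ := by
          rw [← ENNReal.ofReal_mul hcrude0, ← ENNReal.ofReal_mul (by positivity),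
            ← ENNReal.ofReal_add (by positivity) hloc0,
            ← ENNReal.ofReal_add (by positivity) (by positivity)]
  exact (ENNReal.ofReal_le_ofReal_iff (by positivity)).1 hfinal

end Bias

/-! ### The rate -/

section Rate

variable {dx dy k : ℕ} {δ : ℝ}

lemma threshold_pow (hdx : 1 ≤ dx) (N : ℕ) :
    threshold dx dy δ N ^ (dx + dy) = Real.log N ^ (1 + δ) / N := by
  have h0 : 0 ≤ Real.log N ^ (1 + δ) / N :=
    div_nonneg (Real.rpow_nonneg (Real.log_natCast_nonneg N) _) N.cast_nonneg
  have hd : ((dx : ℝ) + dy) ≠ 0 := by positivity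
  rw [threshold, ← Real.rpow_natCast, ← Real.rpow_mul h0]
  push_cast
  rw [one_div, inv_mul_cancel₀ hd, Real.rpow_one]

lemma tendsto_threshold (hdx : 1 ≤ dx) :
    Filter.Tendsto (threshold dx dy δ) Filter.atTop (nhds 0) := by
  have hd : (0 : ℝ) < (dx : ℝ) + dy := by positivity
  have h1 := (isLittleO_log_rpow_rpow_atTop (1 + δ) one_pos).tendsto_div_nhds_zero
  have h2 := (h1.comp tendsto_natCast_atTop_atTop).rpow_const (p := 1 / ((dx : ℝ) + dy))
    (Or.inr (by positivity))
  rw [Real.zero_rpow (by positivity)] at h2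
  refine h2.congr fun N => ?_
  simp only [Function.comp_apply, Real.rpow_one, threshold]

lemma rate_nonneg (N : ℕ) : 0 ≤ rate dx dy k δ N := by
  have := Real.log_natCast_nonneg N
  unfold rate
  positivity

/-- The square equals the first term of the rate. -/
lemma sq_threshold_mul_le_rate {N : ℕ} (hN : 1 ≤ Real.log N) :
    (threshold dx dy δ N * Real.log N ^ (1 + δ)) ^ 2 ≤ rate dx dy k δ N := by
  have hl : 0 < Real.log N := by linarith
  have hN0 : (0 : ℝ) < N := N.cast_nonneg.lt_of_ne fun h => by simp [← h] at hl
  have hnn : 0 ≤ Real.log (Real.log N) ^ 2 * Real.log N ^ ((2 * (k : ℝ) + 2) * (1 + δ)) / N := by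
    positivity
  refine le_trans (le_of_eq ?_) (le_add_of_nonneg_right hnn)
  rw [threshold, Real.div_rpow (by positivity) hN0.le, ← Real.rpow_mul hl.le, div_mul_eq_mul_div,
    ← Real.rpow_add hl, div_pow, ← Real.rpow_natCast, ← Real.rpow_natCast, ← Real.rpow_mul hl.le,
    ← Real.rpow_mul hN0.le]
  congr 2 <;> (push_cast; ring)

/-- The exponent (2k+2)(1+δ) is at least 2 and log log N is at least 1, so the variance term fits
with room to spare. -/
lemma sq_log_div_le_rate (hδ : 0 < δ) {N : ℕ} (hN : 1 ≤ Real.log (Real.log N))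
    (hN1 : 1 ≤ Real.log N) : Real.log N ^ 2 / N ≤ rate dx dy k δ N := by
  have h1 : 0 ≤ Real.log N ^ (2 * (1 + δ) * (1 + 1 / ((dx : ℝ) + dy))) /
      (N : ℝ) ^ (2 / ((dx : ℝ) + dy)) := by positivity
  refine le_trans ?_ (le_add_of_nonneg_left h1)
  gcongr
  have h2 : Real.log N ^ 2 ≤ Real.log N ^ ((2 * (k : ℝ) + 2) * (1 + δ)) := by
    rw [← Real.rpow_natCast]
    refine Real.rpow_le_rpow_of_exponent_le hN1 ?_
    push_cast
    have : (0 : ℝ) ≤ k := k.cast_nonneg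
    nlinarith
  have h3 : 1 ≤ Real.log (Real.log N) ^ 2 := one_le_pow₀ hN
  calc Real.log N ^ 2 = 1 * Real.log N ^ 2 := (one_mul _).symm
    _ ≤ _ := mul_le_mul h3 h2 (by positivity) (by positivity)

/-- The error terms of the bias are at most of the order of the truncation threshold times the
number of sample points that it leaves in a ball. -/
lemma bias_terms_le {N ℓ l a q D K₁ K₂ K₃ K₄ K₅ ψ Λ τ : ℝ} (hl : 1 ≤ l) (hlℓ : l ≤ ℓ)
    (ha : 0 ≤ a) (haN : 1 / N ≤ a) (hK₁ : 0 ≤ K₁) (hK₂ : 0 ≤ K₂) (hK₃ : 0 ≤ K₃) (hK₄ : 0 ≤ K₄)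
    (hK₅ : 0 ≤ K₅) (hψ : 0 ≤ ψ) (hΛ : 0 ≤ Λ) (hτ : τ ≤ K₃ * a) (hD : D * q ≤ ℓ) :
    (K₁ * (1 + l) + Λ) * (K₂ * a) + (1 / N + (ψ + l + Λ + 2) * τ + K₄ * a) + K₅ * a * (D * q) ≤
      ((2 * K₁ + Λ) * K₂ + (1 + (ψ + Λ + 3) * K₃ + K₄) + K₅) * (a * ℓ) := by
  have hℓ : 1 ≤ ℓ := hl.trans hlℓ
  have haℓ : a ≤ a * ℓ := le_mul_of_one_le_right ha hℓ
  have h1 : (K₁ * (1 + l) + Λ) * (K₂ * a) ≤ (2 * K₁ + Λ) * K₂ * (a * ℓ) := by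
    have : K₁ * (1 + l) + Λ ≤ (2 * K₁ + Λ) * ℓ := by nlinarith
    calc (K₁ * (1 + l) + Λ) * (K₂ * a) ≤ ((2 * K₁ + Λ) * ℓ) * (K₂ * a) := by gcongr
      _ = _ := by ring
  have h2 : (ψ + l + Λ + 2) * τ ≤ (ψ + Λ + 3) * K₃ * (a * ℓ) := by
    have : ψ + l + Λ + 2 ≤ (ψ + Λ + 3) * ℓ := by nlinarith
    calc (ψ + l + Λ + 2) * τ ≤ (ψ + l + Λ + 2) * (K₃ * a) := by gcongr
      _ ≤ ((ψ + Λ + 3) * ℓ) * (K₃ * a) := by gcongr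
      _ = _ := by ring
  have h3 : K₄ * a ≤ K₄ * (a * ℓ) := by gcongr
  have h4 : K₅ * a * (D * q) ≤ K₅ * (a * ℓ) := by
    rw [mul_assoc]; gcongr
  linarith

end Rate

/-! ### Uniform bounds for large samples -/

section Final

variable {dx dy k : ℕ} {δ : ℝ} {p : ℝ≥0∞} [Fact (1 ≤ p)] {φ : ℕ → ℝ}

/-- The threshold satisfies N a^d = (log N)^(1+δ). As δ > 0 this outgrows every multiple of log N,
so truncation has probability O(1/N), while the expected number of points in a ball of radius `a`
costs only the factor (log N)^(1+δ). -/
theorem exists_bias_bound (hdx : 1 ≤ dx) (hdy : 1 ≤ dy) (hk1 : 1 ≤ k) (hδ : 0 < δ)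
    (hφ : LogLike φ) {A : ℝ} (hA : A = digamma k + Real.log (ballVol p (Fin dx) *
        ballVol p (Fin dy) / ballVol p (Fin dx ⊕ Fin dy))) {c B L : ℝ} (hc : 0 < c) (hcB : c ≤ B)
    (hL : 0 ≤ L) : ∃ C : ℝ, ∀ᶠ N : ℕ in Filter.atTop,
      ∀ f : (Fin dx → ℝ) × (Fin dy → ℝ) → ℝ, IsRegular f c B L →
        |∫ z, estimator p φ A (threshold dx dy δ N) k z ∂(Measure.pi fun _ : Fin N => law f) -
          mutualInfo f| ≤ C * (threshold dx dy δ N * Real.log N ^ (1 + δ)) := by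
  have hB : 0 ≤ B := hc.le.trans hcB
  have hv := (isGauge_coordNorm_joint (dy := dy) p hdx).const_pos
  have hvx := (isGauge_coordNorm_fin p hdx).const_pos
  have hvy := (isGauge_coordNorm_fin p hdy).const_pos
  set κ := c / 2 with hκ
  have hκ0 : 0 < κ := by positivity
  have hcc : 0 ≤ countConst p dx dy B κ := by unfold countConst; positivity
  have hdc : 0 ≤ deviationConst dx dy κ := by unfold deviationConst; positivity
  set v := ballVol p (Fin dx ⊕ Fin dy) with hvdef
  set q := κ / 2 ^ (dx + dy) * v with hq
  have hq0 : 0 < q := by positivity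
  set Λ := 3 * (|Real.log c| + |Real.log B|) with hΛ
  set K₁ := |A| + 3 with hK₁
  set K₂ := 3 * (B * (L / κ)) with hK₂
  set K₃ : ℝ := 2 ^ k with hK₃
  set K₄ := 8 * countConst p dx dy B κ with hK₄
  set K₅ := B * (deviationConst dx dy κ * (B * L) * v) with hK₅
  refine ⟨(2 * K₁ + Λ) * K₂ + (1 + (|digamma k| + Λ + 3) * K₃ + K₄) + K₅, ?_⟩
  have hlogt : Filter.Tendsto (fun N : ℕ => Real.log N) Filter.atTop Filter.atTop :=
    Real.tendsto_log_atTop.comp tendsto_natCast_atTop_atTop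
  have hpow : Filter.Tendsto (fun N : ℕ => Real.log N ^ δ) Filter.atTop Filter.atTop :=
    (tendsto_rpow_atTop hδ).comp hlogt
  have hth := tendsto_threshold (dx := dx) (dy := dy) (δ := δ) hdx
  have e1 : ∀ᶠ N : ℕ in Filter.atTop, threshold dx dy δ N ≤ 1 :=
    hth.eventually_le_const one_pos
  have e2 : ∀ᶠ N : ℕ in Filter.atTop, countConst p dx dy B κ * threshold dx dy δ N ≤ 1 / 2 := by
    have := hth.const_mul (countConst p dx dy B κ)
    rw [mul_zero] at this
    exact this.eventually_le_const (by norm_num)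
  filter_upwards [Filter.eventually_ge_atTop (k + 2), hlogt.eventually_ge_atTop 1,
    hpow.eventually_ge_atTop (4 / q), hpow.eventually_ge_atTop (1 / q), e1, e2] with
    N hNk hlog hpow4 hpow1 ha1 hba f hf
  obtain ⟨m, rfl⟩ : ∃ m, N = m + 2 := ⟨N - 2, by omega⟩
  set a := threshold dx dy δ (m + 2) with ha
  set l := Real.log ((m + 2 : ℕ) : ℝ) with hl
  set ℓ := l ^ (1 + δ) with hℓ
  have hl0 : 0 < l := by linarith
  have hNc : ((m + 2 : ℕ) : ℝ) = (m : ℝ) + 2 := by push_cast; ring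
  have hN0 : (0 : ℝ) < (m : ℝ) + 2 := by positivity
  have hℓe : ℓ = l * l ^ δ := by rw [hℓ, Real.rpow_add hl0, Real.rpow_one]
  have had : a ^ (dx + dy) = ℓ / ((m : ℝ) + 2) := by
    rw [ha, threshold_pow hdx, hNc, hℓ, hl, hNc]
  have hlℓ : l ≤ ℓ := by
    rw [hℓe]
    exact le_mul_of_one_le_right hl0.le (Real.one_le_rpow hlog hδ.le)
  have ha0 : 0 < a := by
    rw [ha, threshold, hNc]
    have : Real.log ((m : ℝ) + 2) = l := by rw [hl, hNc]
    rw [this]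
    positivity
  have haN : 1 / ((m : ℝ) + 2) ≤ a := by
    calc 1 / ((m : ℝ) + 2) ≤ ℓ / ((m : ℝ) + 2) := by gcongr; linarith
      _ = a ^ (dx + dy) := had.symm
      _ ≤ a := pow_le_of_le_one ha0.le ha1 (by omega)
  have hqN : κ / 2 ^ (dx + dy) * (v * a ^ (dx + dy)) = q * ℓ / ((m : ℝ) + 2) := by
    rw [had, hq]; ring
  have hNa : 1 ≤ ((m : ℝ) + 2) * (κ / 2 ^ (dx + dy) * (v * a ^ (dx + dy))) := by
    rw [hqN, mul_div_cancel₀ _ hN0.ne', hℓe]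
    rw [div_le_iff₀ hq0] at hpow1
    nlinarith
  have hτ : 2 ^ k * Real.exp (-(((m : ℝ) + 1) * (κ / 2 ^ (dx + dy) *
      (v * a ^ (dx + dy))) / 2)) ≤ K₃ * a := by
    rw [hK₃]
    refine mul_le_mul_of_nonneg_left (le_trans ?_ haN) (by positivity)
    -- The constant `4` absorbs the `2` of the Chernoff exponent and the ratio of the sample size `m
    -- + 1` to `N = m + 2`, which is at least 1/2.
    have hexp : l ≤ ((m : ℝ) + 1) * (κ / 2 ^ (dx + dy) * (v * a ^ (dx + dy))) / 2 := by
      have h4 : 4 * l ≤ q * ℓ := by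
        rw [div_le_iff₀ hq0] at hpow4
        rw [hℓe]
        nlinarith
      have h5 : (1 : ℝ) / 2 ≤ ((m : ℝ) + 1) / ((m : ℝ) + 2) := by
        rw [div_le_div_iff₀ (by norm_num) hN0]; linarith [m.cast_nonneg (α := ℝ)]
      calc l ≤ q * ℓ * (1 / 2) / 2 := by linarith
        _ ≤ q * ℓ * (((m : ℝ) + 1) / ((m : ℝ) + 2)) / 2 := by gcongr
        _ = _ := by rw [hqN]; ring
    calc _ ≤ Real.exp (-l) := Real.exp_le_exp.2 (neg_le_neg hexp)
      _ = 1 / ((m : ℝ) + 2) := by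
        rw [Real.exp_neg, hl, hNc, Real.exp_log hN0, one_div]
  have hmain := hf.abs_integral_estimator_sub_le hdx hdy hc hcB hL hφ hk1 (by omega : k ≤ m) ha0 ha1
    hA hba hNa
  have hlm : Real.log ((m : ℝ) + 2) = l := by rw [hl, hNc]
  rw [hlm] at hmain
  refine (hmain.trans (le_of_eq ?_)).trans (bias_terms_le (N := (m : ℝ) + 2) (D := (m : ℝ) + 1)
    (q := a ^ (dx + dy)) hlog hlℓ ha0.le haN (by positivity)
    (by positivity) (by positivity) (by positivity) (by positivity) (abs_nonneg _) (by positivity)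
    hτ ?_)
  · rw [hK₂, hK₄, hK₅]; ring
  · rw [had, mul_div_assoc', div_le_iff₀ hN0, mul_comm]
    exact mul_le_mul_of_nonneg_left (by linarith) (by linarith)

/-- Squared bias plus N times the squared bounded difference. The `4` comes from 1 + log N ≤ 2 log
N. -/
theorem exists_mse_bound (hdx : 1 ≤ dx) (hdy : 1 ≤ dy) (hk1 : 1 ≤ k) (hδ : 0 < δ)
    (hφ : LogLike φ) {A : ℝ} (hA : A = digamma k + Real.log (ballVol p (Fin dx) *
        ballVol p (Fin dy) / ballVol p (Fin dx ⊕ Fin dy))) {c B L : ℝ} (hc : 0 < c) (hcB : c ≤ B)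
    (hL : 0 ≤ L) : ∃ C : ℝ, ∀ᶠ N : ℕ in Filter.atTop,
      ∀ f : (Fin dx → ℝ) × (Fin dy → ℝ) → ℝ, IsRegular f c B L →
        ∫ z, (estimator p φ A (threshold dx dy δ N) k z - mutualInfo f) ^ 2
          ∂(Measure.pi fun _ : Fin N => law f) ≤ C * rate dx dy k δ N := by
  obtain ⟨C₁, h₁⟩ := exists_bias_bound hdx hdy hk1 hδ hφ hA hc hcB hL
  obtain ⟨C₂, hC₂, h₂⟩ := exists_estimator_bounded_differences dx dy p k hφ A
  refine ⟨C₁ ^ 2 + 4 * C₂ ^ 2, ?_⟩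
  have hlogt : Filter.Tendsto (fun N : ℕ => Real.log N) Filter.atTop Filter.atTop :=
    Real.tendsto_log_atTop.comp tendsto_natCast_atTop_atTop
  have hloglogt : Filter.Tendsto (fun N : ℕ => Real.log (Real.log N)) Filter.atTop Filter.atTop :=
    Real.tendsto_log_atTop.comp hlogt
  filter_upwards [h₁, Filter.eventually_ge_atTop (k + 1), hlogt.eventually_ge_atTop 1,
    hloglogt.eventually_ge_atTop 1] with N hN hNk hlog hloglog f hf
  obtain ⟨n, rfl⟩ : ∃ n, N = n + 1 := ⟨N - 1, by omega⟩
  have := hf.density.isProbabilityMeasure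
  have hN0 : (0 : ℝ) < ((n + 1 : ℕ) : ℝ) := by positivity
  have hNc : (n : ℝ) + 1 = ((n + 1 : ℕ) : ℝ) := by push_cast; ring
  refine (integral_sub_sq_le_of_bounded_differences (law f) (n + 1)
    (measurable_estimator φ (by omega) A _) (fun z => abs_estimator_le hφ A _ z)
    (fun z z' j hj => h₂ n (by omega) _ z z' j hj) (mutualInfo f)).trans ?_
  have hb := hN f hf
  have h3 : (∫ z, estimator p φ A (threshold dx dy δ (n + 1)) k z
      ∂(Measure.pi fun _ : Fin (n + 1) => law f) - mutualInfo f) ^ 2 ≤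
      C₁ ^ 2 * rate dx dy k δ (n + 1) := by
    rw [← sq_abs]
    refine (pow_le_pow_left₀ (abs_nonneg _) hb 2).trans ?_
    rw [mul_pow]
    gcongr
    exact sq_threshold_mul_le_rate hlog
  have h4 : ((n + 1 : ℕ) : ℝ) * (C₂ * (1 + Real.log (n + 1)) / (n + 1)) ^ 2 ≤
      4 * C₂ ^ 2 * rate dx dy k δ (n + 1) := by
    rw [hNc]
    set l := Real.log ((n + 1 : ℕ) : ℝ) with hl
    calc ((n + 1 : ℕ) : ℝ) * (C₂ * (1 + l) / ((n + 1 : ℕ) : ℝ)) ^ 2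
        = C₂ ^ 2 * (1 + l) ^ 2 / ((n + 1 : ℕ) : ℝ) := by field_simp
      _ ≤ C₂ ^ 2 * (2 * l) ^ 2 / ((n + 1 : ℕ) : ℝ) := by gcongr; linarith
      _ = 4 * C₂ ^ 2 * (l ^ 2 / ((n + 1 : ℕ) : ℝ)) := by ring
      _ ≤ _ := by
        gcongr
        exact sq_log_div_le_rate hδ hloglog hlog
  linarith

omit [Fact (1 ≤ p)] in
/-- Mean squared errors may be computed on the product space of the samples. -/
lemma integral_sq_sub_eq {E Ω : Type*} [MeasurableSpace E] [MeasurableSpace Ω] {P : Measure Ω}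
    [IsProbabilityMeasure P] {μ : Measure E} {N : ℕ} {Z : Fin N → Ω → E}
    (hZ : ∀ i, Measurable (Z i)) (hind : iIndepFun Z P) (hlaw : ∀ i, P.map (Z i) = μ)
    {F : (Fin N → E) → ℝ} (hF : Measurable F) {B : ℝ} (hB : ∀ z, |F z| ≤ B) (I : ℝ) :
    Integrable (fun ω => (F (fun i => Z i ω) - I) ^ 2) P ∧
      ∫ ω, (F (fun i => Z i ω) - I) ^ 2 ∂P = ∫ z, (F z - I) ^ 2 ∂(Measure.pi fun _ => μ) := by
  have hm : Measurable fun ω i => Z i ω := measurable_pi_lambda _ hZ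
  have hmap := (iIndepFun_iff_map_fun_eq_pi_map fun i => (hZ i).aemeasurable).1 hind
  simp only [hlaw] at hmap
  have hsq : Measurable fun z => (F z - I) ^ 2 := (hF.sub_const I).pow_const 2
  constructor
  · refine integrable_of_abs_le (hsq.comp hm) (B := (B + |I|) ^ 2) fun ω => ?_
    rw [abs_pow]
    exact pow_le_pow_left₀ (abs_nonneg _) ((abs_sub _ _).trans (by gcongr; exact hB _)) 2
  · rw [← hmap, integral_map hm.aemeasurable hsq.aestronglyMeasurable]

end Final

end KSG

end

/-- The mean squared errors of the truncated KSG and the truncated BI-KSG estimators. -/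
theorem mainTheorem4
    (dx dy k : ℕ) (hdx : 1 ≤ dx) (hdy : 1 ≤ dy) (hk : 1 ≤ k) (δ : ℝ) (hδ : 0 < δ)
    (Ca Cb Cc Cd Ce Cf Cg Ch C0 : ℝ) :
    ∃ (C : ℝ) (N₀ : ℕ),
      ∀ f : (Fin dx → ℝ) × (Fin dy → ℝ) → ℝ, KSG.IsDensity f →
        KSG.RateAssumption f Ca Cb Cc Cd Ce Cf Cg Ch C0 →
        ∀ N : ℕ, N₀ ≤ N →
          ∀ (Ω : Type*) [MeasurableSpace Ω] (P : Measure Ω) [IsProbabilityMeasure P]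
            (X : Fin N → Ω → (Fin dx → ℝ)) (Y : Fin N → Ω → (Fin dy → ℝ)),
            (∀ i, Measurable (X i)) → (∀ i, Measurable (Y i)) →
            iIndepFun (fun i ω => (X i ω, Y i ω)) P →
            (∀ i, P.map (fun ω => (X i ω, Y i ω)) =
              volume.withDensity (fun z => ENNReal.ofReal (f z))) →
            (Integrable (fun ω =>
                (KSG.tKSG k δ (fun i => (X i ω, Y i ω)) - KSG.mutualInfo f) ^ 2) P ∧
              ∫ ω, (KSG.tKSG k δ (fun i => (X i ω, Y i ω)) - KSG.mutualInfo f) ^ 2 ∂P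
                ≤ C * KSG.rate dx dy k δ N) ∧
            (Integrable (fun ω =>
                (KSG.tBIKSG k δ (fun i => (X i ω, Y i ω)) - KSG.mutualInfo f) ^ 2) P ∧
              ∫ ω, (KSG.tBIKSG k δ (fun i => (X i ω, Y i ω)) - KSG.mutualInfo f) ^ 2 ∂P
                ≤ C * KSG.rate dx dy k δ N) := by
  obtain ⟨c, B, L, hc, hcB, hL, hreg⟩ := KSG.exists_isRegular hdx Ca Cb Cc Cd Ce Cf Cg Ch C0
  have : Nonempty (Fin dx) := ⟨⟨0, hdx⟩⟩
  have : Nonempty (Fin dy) := ⟨⟨0, hdy⟩⟩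
  obtain ⟨C₁, h₁⟩ := KSG.exists_mse_bound (p := ∞) hdx hdy hk hδ KSG.logLike_digamma
    -- For the supremum norm the ball volumes are powers of two with 2^dx 2^dy = 2^(dx+dy), so the
    -- additive constant vanishes.
    (A := KSG.digamma k) (by simp [KSG.ballVol_top, pow_add]) hc hcB hL
  obtain ⟨C₂, h₂⟩ := KSG.exists_mse_bound (p := 2) hdx hdy hk hδ KSG.logLike_log
    (A := KSG.digamma k + Real.log (KSG.unitBallVol dx * KSG.unitBallVol dy /
      KSG.unitBallVol (dx + dy))) (by simp [KSG.ballVol_two]) hc hcB hL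
  obtain ⟨N₀, hN₀⟩ := Filter.eventually_atTop.1
    ((h₁.and h₂).and (Filter.eventually_ge_atTop (k + 1)))
  refine ⟨max C₁ C₂, N₀, fun f hf hfa N hN Ω _ P _ X Y hX hY hind hlaw => ?_⟩
  obtain ⟨⟨h₁, h₂⟩, hNk⟩ := hN₀ N hN
  obtain ⟨n, rfl⟩ : ∃ n, N = n + 1 := ⟨N - 1, by omega⟩
  have hr := hreg f hf hfa
  have hrate := KSG.rate_nonneg (dx := dx) (dy := dy) (k := k) (δ := δ) (n + 1)
  have hZ : ∀ i, Measurable fun ω => (X i ω, Y i ω) := fun i => (hX i).prodMk (hY i)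
  constructor
  · simp only [KSG.tKSG_eq_estimator]
    have h := KSG.integral_sq_sub_eq hZ hind hlaw
      (KSG.measurable_estimator (p := ∞) (k := k) _ (by omega) _ _)
      (KSG.abs_estimator_le KSG.logLike_digamma (KSG.digamma k) (KSG.threshold dx dy δ (n + 1)))
      (KSG.mutualInfo f)
    exact ⟨h.1, h.2.le.trans ((h₁ f hr).trans (by gcongr; exact le_max_left _ _))⟩
  · simp only [KSG.tBIKSG_eq_estimator]
    have h := KSG.integral_sq_sub_eq hZ hind hlaw
      (KSG.measurable_estimator (p := 2) (k := k) _ (by omega) _ _)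
      (KSG.abs_estimator_le KSG.logLike_log (KSG.digamma k + Real.log (KSG.unitBallVol dx *
        KSG.unitBallVol dy / KSG.unitBallVol (dx + dy))) (KSG.threshold dx dy δ (n + 1)))
      (KSG.mutualInfo f)
    exact ⟨h.1, h.2.le.trans ((h₂ f hr).trans (by gcongr; exact le_max_right _ _))⟩
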